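/- Let $X_1,X_2,\ldots$ be i.i.d. positive random variables with a density $f$ that is twice continuously differentiable on $(0,\infty)$. Suppose that there are $\alpha,\beta\in(0,+\infty]$ with $2\alpha+\beta>5/2$, $\mathbb E(X_1^{-\alpha})<\infty$ and $\mathbb E(X_1^{\beta})<\infty$ (for $\alpha=\infty$ or $\beta=\infty$ this means that all negative, respectively all positive, moments are finite). For $\nu,\gamma,\xi>0$ and $\theta\in[0,\pi/2]$ let $L_{\nu,\gamma,\xi,\theta}$ be the Meijer density, that is, the density on $(0,\infty)$ of $\nu Y^{\xi}$, where $Y$ has the Fisher-Snedecor distribution with $\frac{2\xi^2}{\gamma^2\cos^2\theta}$ and $\frac{2\xi^2}{\gamma^2\sin^2\theta}$ degrees of freedom if $0<\theta<\pi/2$, the $\mathrm{Gamma}(\xi^2/\gamma^2,\xi^2/\gamma^2)$ distribution (shape, rate) if $\theta=0$, and the $\mathrm{InvGamma}(\xi^2/\gamma^2,\xi^2/\gamma^2)$ distribution (that of the inverse of the previous Gamma variable) if $\theta=\pi/2$. Fix $\xi>0$ and $\theta\in[0,\pi/2]$ with $\frac{\xi}{\cos^2\theta}>\frac14-\frac{\beta}{2}$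 and $\frac{\xi}{\sin^2\theta}>1-\alpha$ (where $\xi/0=+\infty$). For $\eta>0$ put $$\gamma^{(k)}_\eta=\frac{\eta}{\sqrt{\eta^2+X_k}},\qquad \nu^{(k)}_\eta=1+\tfrac12\bigl(\gamma^{(k)}_\eta\bigr)^2\Bigl(1+\frac{\cos2\theta}{\xi}\Bigr),\qquad L^{(k)}_\eta=L_{\nu^{(k)}_\eta,\gamma^{(k)}_\eta,\xi,\theta}.$$ Let $\eta=\eta_n>0$ satisfy $\eta_n\to0$ and $n\eta_n\to\infty$, and suppose that, for all large $n$, $\nu^{(k)}_{\eta_n}>0$ almost surely, so that the kernels are defined (this is automatic if $3\xi+\cos2\theta\ge0$). Let $$\hat f(x)=\frac1n\sum_{k=1}^n\frac1{X_k}L^{(k)}_{\eta_n}\Bigl(\frac{x}{X_k}\Bigr).$$ Then for every $x\in(0,\infty)$, $\hat f(x)$ is square integrable for all large $n$ and, as $n\to\infty$, $$\mathbb E\bigl(\hat f(x)\bigr)-f(x)=\tfrac12\eta_n^2\,x f''(x)+o(\eta_n^2),\qquad \operatorname{Var}\bigl(\hat f(x)\bigr)=\frac{f(x)}{2\sqrt\pi\,n\eta_n\sqrt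 x}+o\bigl((n\eta_n)^{-1}\bigr).$$ -/

import Mathlib

open MeasureTheory ProbabilityTheory Set Filter Topology Asymptotics
open scoped ENNReal

/-- The Fisher-Snedecor density with `2 * a` and `2 * b` degrees of freedom, on `x > 0`. -/
noncomputable def fisherDensity (a b x : ℝ) : ℝ :=
  Real.Gamma (a + b) / (Real.Gamma a * Real.Gamma b) * (a / b) ^ a *
    (x ^ (a - 1) * (1 + a / b * x) ^ (-(a + b)))

/-- The Gamma density with shape `a` and rate `r`, on `x > 0`. -/
noncomputable def gammaDensity (a r x : ℝ) : ℝ :=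
  r ^ a / Real.Gamma a * (x ^ (a - 1) * Real.exp (-(r * x)))

/-- The Inverse Gamma density with parameters `a` and `r`, on `x > 0`. -/
noncomputable def invGammaDensity (a r x : ℝ) : ℝ :=
  r ^ a / Real.Gamma a * (x ^ (-a - 1) * Real.exp (-(r / x)))

/-- The density on `x > 0` of the basic variable `X` whose rescaled power `ν * X ^ ξ` follows the
Meijer distribution: Fisher-Snedecor for `0 < θ < π / 2`, Gamma for `θ = 0` and Inverse Gamma for
`θ = π / 2`. -/
noncomputable def meijerBase (γ ξ θ x : ℝ) : ℝ :=
  if θ = 0 then gammaDensity (ξ ^ 2 / γ ^ 2) (ξ ^ 2 / γ ^ 2) x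
  else if θ = Real.pi / 2 then invGammaDensity (ξ ^ 2 / γ ^ 2) (ξ ^ 2 / γ ^ 2) x
  else fisherDensity (ξ ^ 2 / (γ ^ 2 * Real.cos θ ^ 2)) (ξ ^ 2 / (γ ^ 2 * Real.sin θ ^ 2)) x

/-- The Meijer density `L_{ν,γ,ξ,θ}` on `y > 0`, i.e. the density of `ν * X ^ ξ` where `X` has
density `meijerBase γ ξ θ`. It is the function whose Mellin transform is the rescaled product of
Gamma functions given in `hasMellin_meijerDensity` below. -/
noncomputable def meijerDensity (ν γ ξ θ y : ℝ) : ℝ :=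
  1 / (ν * ξ) * (y / ν) ^ (1 / ξ - 1) * meijerBase γ ξ θ ((y / ν) ^ (1 / ξ))

/-- The parameter `γ = η / √(η² + X)` of the kernel attached to the observation `X`. -/
noncomputable def kernelGamma (η X : ℝ) : ℝ := η / Real.sqrt (η ^ 2 + X)

/-- The parameter `ν = 1 + γ² (1 + cos (2θ) / ξ) / 2` of the kernel attached to the
observation `X`. -/
noncomputable def kernelNu (ξ θ η X : ℝ) : ℝ :=
  1 + 1 / 2 * kernelGamma η X ^ 2 * (1 + Real.cos (2 * θ) / ξ)

/-- The Meijer kernel attached to the observation `X`. -/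
noncomputable def meijerKernel (ξ θ η X y : ℝ) : ℝ :=
  meijerDensity (kernelNu ξ θ η X) (kernelGamma η X) ξ θ y

/-- The Mellin-Meijer kernel density estimate at `x`, based on the sample
`X 0, …, X (n - 1)` and the smoothing parameter `η`. -/
noncomputable def mellinMeijerKDE (ξ θ η : ℝ) (n : ℕ) (X : ℕ → ℝ) (x : ℝ) : ℝ :=
  1 / (n : ℝ) * ∑ k ∈ Finset.range n, 1 / X k * meijerKernel ξ θ η (X k) (x / X k)

/-- The Mellin transform that defines the Meijer densities, in the three cases
`θ = 0`, `θ = π / 2` and `0 < θ < π / 2`. -/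
noncomputable def meijerMellin (ν γ ξ θ : ℝ) (z : ℂ) : ℂ :=
  if θ = 0 then
    (ν : ℂ) ^ (z - 1) / Complex.Gamma ((ξ ^ 2 / γ ^ 2 : ℝ) : ℂ) *
      ((γ ^ 2 / ξ ^ 2 : ℝ) : ℂ) ^ ((ξ : ℂ) * (z - 1)) *
      Complex.Gamma (((ξ ^ 2 / γ ^ 2 : ℝ) : ℂ) + ξ * (z - 1))
  else if θ = Real.pi / 2 then
    (ν : ℂ) ^ (z - 1) / Complex.Gamma ((ξ ^ 2 / γ ^ 2 : ℝ) : ℂ) *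
      ((γ ^ 2 / ξ ^ 2 : ℝ) : ℂ) ^ ((ξ : ℂ) * (1 - z)) *
      Complex.Gamma (((ξ ^ 2 / γ ^ 2 : ℝ) : ℂ) + ξ * (1 - z))
  else
    (ν : ℂ) ^ (z - 1) * ((1 / Real.tan θ ^ 2 : ℝ) : ℂ) ^ ((ξ : ℂ) * (z - 1)) *
      (Complex.Gamma (((ξ ^ 2 / (γ ^ 2 * Real.cos θ ^ 2) : ℝ) : ℂ) + ξ * (z - 1)) *
        Complex.Gamma (((ξ ^ 2 / (γ ^ 2 * Real.sin θ ^ 2) : ℝ) : ℂ) + ξ * (1 - z))) /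
      (Complex.Gamma ((ξ ^ 2 / (γ ^ 2 * Real.cos θ ^ 2) : ℝ) : ℂ) *
        Complex.Gamma ((ξ ^ 2 / (γ ^ 2 * Real.sin θ ^ 2) : ℝ) : ℂ))

theorem hasMellin_one_add_rpow {p : ℝ} {s : ℂ} (hs : 0 < s.re) (hp : s.re < p) :
    HasMellin (fun x : ℝ => (((1 + x) ^ (-p) : ℝ) : ℂ)) s
      (Complex.Gamma s * Complex.Gamma (p - s) / Complex.Gamma p) := by
  have hps : 0 < ((p : ℂ) - s).re := by simp; linarith
  set F : ℝ → ℂ := fun t => (t : ℂ) ^ (s - 1) * (1 - (t : ℂ)) ^ ((p : ℂ) - s - 1) with hF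
  have himg : (fun x : ℝ => x / (1 + x)) '' Ioi 0 = Ioo 0 1 := by
    ext t
    constructor
    · rintro ⟨x, hx, rfl⟩
      have hx' : (0 : ℝ) < x := hx
      exact ⟨by positivity, by rw [div_lt_one (by positivity)]; linarith⟩
    · rintro ⟨h0, h1⟩
      have h2 : 0 < 1 - t := by linarith
      refine ⟨t / (1 - t), by simp only [mem_Ioi]; positivity, ?_⟩
      field_simp
      ring
  have hinj : InjOn (fun x : ℝ => x / (1 + x)) (Ioi 0) := by
    intro x hx y hy h
    have hx' : (0 : ℝ) < x := hx
    have hy' : (0 : ℝ) < y := hy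
    simp only at h
    rw [div_eq_div_iff (by positivity) (by positivity)] at h
    linarith
  have hder : ∀ x ∈ Ioi (0 : ℝ), HasDerivWithinAt (fun x : ℝ => x / (1 + x))
      (1 / (1 + x) ^ 2) (Ioi 0) x := by
    intro x hx
    have hx' : (0 : ℝ) < x := hx
    have h := (hasDerivAt_id x).div ((hasDerivAt_id x).const_add 1)
      (show (1 : ℝ) + id x ≠ 0 by simp only [id]; positivity)
    refine (h.hasDerivWithinAt).congr_deriv ?_
    simp
  have heq : EqOn (fun x : ℝ => |1 / (1 + x) ^ 2| • F (x / (1 + x)))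
      (fun x : ℝ => (x : ℂ) ^ (s - 1) • (((1 + x) ^ (-p) : ℝ) : ℂ)) (Ioi 0) := by
    intro x hx
    have hx' : (0 : ℝ) < x := hx
    have h1 : (0 : ℝ) < 1 + x := by positivity
    have h1c : ((1 + x : ℝ) : ℂ) ≠ 0 := by exact_mod_cast h1.ne'
    have e1 : (1 : ℂ) - ((x / (1 + x) : ℝ) : ℂ) = (((1 + x)⁻¹ : ℝ) : ℂ) := by
      rw [← Complex.ofReal_one, ← Complex.ofReal_sub]
      congr 1
      field_simp
      ring
    have e2 : ((x / (1 + x) : ℝ) : ℂ) = (x : ℂ) * (((1 + x)⁻¹ : ℝ) : ℂ) := by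
      rw [div_eq_mul_inv, Complex.ofReal_mul]
    have e3 : |1 / (1 + x) ^ 2| = (1 + x)⁻¹ ^ 2 := by
      rw [abs_of_pos (by positivity)]; simp
    have hic : (((1 + x)⁻¹ : ℝ) : ℂ) ≠ 0 := by exact_mod_cast (inv_pos.2 h1).ne'
    have e4 : (((1 + x) ^ (-p) : ℝ) : ℂ) = (((1 + x)⁻¹ : ℝ) : ℂ) ^ (p : ℂ) := by
      rw [← Complex.ofReal_cpow (inv_pos.2 h1).le, Real.inv_rpow h1.le, Real.rpow_neg h1.le]
    simp only [hF, smul_eq_mul, Complex.real_smul]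
    rw [e1, e2, e3, e4, Complex.mul_cpow_ofReal_nonneg hx'.le (inv_pos.2 h1).le]
    have e5 : (((1 + x)⁻¹ : ℝ) : ℂ) ^ (p : ℂ) = (((1 + x)⁻¹ : ℝ) : ℂ) ^ (2 : ℕ) *
        ((((1 + x)⁻¹ : ℝ) : ℂ) ^ (s - 1) * (((1 + x)⁻¹ : ℝ) : ℂ) ^ ((p : ℂ) - s - 1)) := by
      rw [← Complex.cpow_natCast, ← Complex.cpow_add _ _ hic, ← Complex.cpow_add _ _ hic]
      congr 1
      push_cast
      ring
    rw [e5]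
    push_cast
    ring
  have hbeta := Complex.betaIntegral_convergent hs hps
  rw [intervalIntegrable_iff_integrableOn_Ioc_of_le zero_le_one,
    integrableOn_Ioc_iff_integrableOn_Ioo, ← himg] at hbeta
  have hconv := (integrableOn_image_iff_integrableOn_abs_deriv_smul measurableSet_Ioi hder hinj
    F).1 hbeta
  rw [integrableOn_congr_fun heq measurableSet_Ioi] at hconv
  refine ⟨hconv, ?_⟩
  have hint := integral_image_eq_integral_abs_deriv_smul measurableSet_Ioi hder hinj F
  rw [setIntegral_congr_fun measurableSet_Ioi heq, himg, ← integral_Ioc_eq_integral_Ioo,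
    ← intervalIntegral.integral_of_le zero_le_one] at hint
  have hb : Complex.betaIntegral s (p - s) = ∫ t in (0 : ℝ)..1, F t := rfl
  have hg := Complex.Gamma_mul_Gamma_eq_betaIntegral hs hps
  rw [hb, add_sub_cancel] at hg
  have hpG : Complex.Gamma p ≠ 0 := Complex.Gamma_ne_zero_of_re_pos (by simp; linarith)
  rw [mellin, ← hint, hg, mul_div_cancel_left₀ _ hpG]

theorem hasMellin_exp_neg {s : ℂ} (hs : 0 < s.re) :
    HasMellin (fun x : ℝ => ((Real.exp (-x) : ℝ) : ℂ)) s (Complex.Gamma s) := by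
  have h := Complex.GammaIntegral_convergent hs
  have e : (fun x : ℝ => ((Real.exp (-x) : ℝ) : ℂ) * (x : ℂ) ^ (s - 1)) =
      fun x : ℝ => (x : ℂ) ^ (s - 1) • ((Real.exp (-x) : ℝ) : ℂ) := by
    ext x; rw [smul_eq_mul, mul_comm]
  refine ⟨by simpa only [MellinConvergent, ← e] using h, ?_⟩
  rw [Complex.Gamma_eq_integral hs, Complex.GammaIntegral, mellin]
  simp only [← e]

theorem HasMellin.congr' {f g : ℝ → ℂ} {s m : ℂ} (h : HasMellin f s m)
    (hfg : ∀ x > 0, f x = g x) : HasMellin g s m := by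
  have e : EqOn (fun t : ℝ => (t : ℂ) ^ (s - 1) • f t) (fun t : ℝ => (t : ℂ) ^ (s - 1) • g t)
      (Ioi 0) := fun t ht => by simp only [hfg t ht]
  refine ⟨(integrableOn_congr_fun e measurableSet_Ioi).1 h.1, ?_⟩
  rw [← h.2]
  exact (setIntegral_congr_fun measurableSet_Ioi e).symm

/-- Multiplying by `C * x ^ q` and rescaling the argument. -/
theorem HasMellin.scale {h : ℝ → ℝ} {s m : ℂ} (C q r : ℝ) (hr : 0 < r)
    (H : HasMellin (fun x => (h x : ℂ)) (s + q) m) :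
    HasMellin (fun x : ℝ => ((C * (x ^ q * h (r * x)) : ℝ) : ℂ)) s
      (C * ((r : ℂ) ^ (-(s + q)) * m)) := by
  have h1 : HasMellin (fun x : ℝ => ((h (r * x) : ℝ) : ℂ)) (s + q) ((r : ℂ) ^ (-(s + q)) * m) :=
    ⟨(MellinConvergent.comp_mul_left (f := fun x => (h x : ℂ)) hr).2 H.1, by
      rw [mellin_comp_mul_left (fun x => (h x : ℂ)) _ hr, H.2, smul_eq_mul]⟩
  have h2 : HasMellin (fun x : ℝ => (x : ℂ) ^ (q : ℂ) • ((h (r * x) : ℝ) : ℂ)) s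
      ((r : ℂ) ^ (-(s + q)) * m) :=
    ⟨MellinConvergent.cpow_smul.2 h1.1, by rw [mellin_cpow_smul, h1.2]⟩
  have h3 := hasMellin_const_smul h2.1 (C : ℂ)
  rw [h2.2, smul_eq_mul] at h3
  refine h3.congr' fun x hx => ?_
  rw [← Complex.ofReal_cpow hx.le]
  simp

theorem hasMellin_fisherDensity {a b : ℝ} {s : ℂ} (ha : 0 < a) (hb : 0 < b)
    (h1 : 1 - a < s.re) (h2 : s.re < 1 + b) :
    HasMellin (fun x => (fisherDensity a b x : ℂ)) s
      (((b / a : ℝ) : ℂ) ^ (s - 1) * (Complex.Gamma (a + (s - 1)) * Complex.Gamma (b + (1 - s))) /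
        (Complex.Gamma a * Complex.Gamma b)) := by
  have H := (hasMellin_one_add_rpow (p := a + b) (s := s + ((a - 1 : ℝ) : ℂ))
    (by simp; linarith) (by simp; linarith)).scale (h := fun x => (1 + x) ^ (-(a + b)))
    (Real.Gamma (a + b) / (Real.Gamma a * Real.Gamma b) * (a / b) ^ a) (a - 1) (a / b)
    (by positivity)
  convert H using 1
  · rfl
  have hba : (0 : ℝ) < b / a := by positivity
  have hbac : ((b / a : ℝ) : ℂ) ≠ 0 := by exact_mod_cast hba.ne'
  have hab : a / b = (b / a)⁻¹ := by rw [inv_div]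
  have hG : Complex.Gamma ((a + b : ℝ) : ℂ) ≠ 0 :=
    Complex.Gamma_ne_zero_of_re_pos (by simp; linarith)
  have e0 : ((b / a : ℝ) : ℂ) ^ (s - 1) = (((a / b) ^ a : ℝ) : ℂ) *
      ((a / b : ℝ) : ℂ) ^ (-(s + ((a - 1 : ℝ) : ℂ))) := by
    have hpi : ((b / a : ℝ) : ℂ).arg ≠ Real.pi := by
      rw [Complex.arg_ofReal_of_nonneg hba.le]; exact Real.pi_pos.ne
    rw [hab, Real.inv_rpow hba.le, ← Real.rpow_neg hba.le, Complex.ofReal_cpow hba.le,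
      Complex.ofReal_inv, Complex.inv_cpow _ _ hpi, ← Complex.cpow_neg,
      ← Complex.cpow_add _ _ hbac]
    congr 1
    push_cast
    ring
  have e1 : s + ((a - 1 : ℝ) : ℂ) = a + (s - 1) := by push_cast; ring
  have e2 : ((a + b : ℝ) : ℂ) - (s + ((a - 1 : ℝ) : ℂ)) = b + (1 - s) := by push_cast; ring
  rw [e0, e2, e1]
  simp only [Complex.ofReal_mul, Complex.ofReal_div, ← Complex.Gamma_ofReal]
  field_simp

theorem hasMellin_gammaDensity {a r : ℝ} {s : ℂ} (hr : 0 < r) (h1 : 1 - a < s.re) :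
    HasMellin (fun x => (gammaDensity a r x : ℂ)) s
      ((r : ℂ) ^ (1 - s) * Complex.Gamma (a + (s - 1)) / Complex.Gamma a) := by
  have H := (hasMellin_exp_neg (s := s + ((a - 1 : ℝ) : ℂ)) (by simp; linarith)).scale
    (h := fun x => Real.exp (-x)) (r ^ a / Real.Gamma a) (a - 1) r hr
  convert H using 1
  · rfl
  have hrc : (r : ℂ) ≠ 0 := by exact_mod_cast hr.ne'
  have e0 : (r : ℂ) ^ (1 - s) = ((r ^ a : ℝ) : ℂ) * (r : ℂ) ^ (-(s + ((a - 1 : ℝ) : ℂ))) := by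
    rw [Complex.ofReal_cpow hr.le, ← Complex.cpow_add _ _ hrc]
    congr 1
    push_cast
    ring
  have e1 : s + ((a - 1 : ℝ) : ℂ) = a + (s - 1) := by push_cast; ring
  rw [e0, e1]
  simp only [Complex.ofReal_div, ← Complex.Gamma_ofReal]
  ring

theorem hasMellin_invGammaDensity {a r : ℝ} {s : ℂ} (hr : 0 < r) (h1 : s.re < 1 + a) :
    HasMellin (fun x => (invGammaDensity a r x : ℂ)) s
      ((r : ℂ) ^ (s - 1) * Complex.Gamma (a + (1 - s)) / Complex.Gamma a) := by
  have H := hasMellin_gammaDensity (a := a) (s := 2 - s) hr (by simp; linarith)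
  have e1 : (s + (-2 : ℝ)) / ((-1 : ℝ) : ℂ) = 2 - s := by push_cast; ring
  have h2 : HasMellin (fun x : ℝ => ((gammaDensity a r (x ^ (-1 : ℝ)) : ℝ) : ℂ))
      (s + ((-2 : ℝ) : ℂ)) ((r : ℂ) ^ (s - 1) * Complex.Gamma (a + (1 - s)) / Complex.Gamma a) := by
    refine ⟨(MellinConvergent.comp_rpow (f := fun x => (gammaDensity a r x : ℂ))
      (by norm_num)).2 (by rw [e1]; exact H.1), ?_⟩
    rw [mellin_comp_rpow (fun x => (gammaDensity a r x : ℂ)), e1, H.2]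
    norm_num
    ring_nf
  have h3 := h2.scale (h := fun x => gammaDensity a r (x ^ (-1 : ℝ))) 1 (-2) 1 one_pos
  simp only [Complex.ofReal_one, Complex.one_cpow, one_mul] at h3
  refine h3.congr' fun x hx => ?_
  congr 1
  rw [gammaDensity, invGammaDensity, Real.rpow_neg_one, Real.inv_rpow hx.le, ← Real.rpow_neg hx.le,
    mul_left_comm, ← mul_assoc (x ^ (-2 : ℝ)), ← Real.rpow_add hx, div_eq_mul_inv r x]
  ring_nf

/-- The density of `ν * X ^ ξ` in terms of that of `X`. -/
theorem HasMellin.rescaled_power {g : ℝ → ℝ} {z m : ℂ} {ν ξ : ℝ} (hν : 0 < ν) (hξ : 0 < ξ)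
    (H : HasMellin (fun x => (g x : ℂ)) (1 + ξ * (z - 1)) m) :
    HasMellin (fun y => ((1 / (ν * ξ) * (y / ν) ^ (1 / ξ - 1) * g ((y / ν) ^ (1 / ξ)) : ℝ) : ℂ)) z
      ((ν : ℂ) ^ (z - 1) * m) := by
  have hξc : (ξ : ℂ) ≠ 0 := by exact_mod_cast hξ.ne'
  have hνc : (ν : ℂ) ≠ 0 := by exact_mod_cast hν.ne'
  have e1 : (z + ((1 / ξ - 1 : ℝ) : ℂ)) / ((1 / ξ : ℝ) : ℂ) = 1 + ξ * (z - 1) := by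
    push_cast
    field_simp
    ring
  have h2 : HasMellin (fun x : ℝ => ((g (x ^ (1 / ξ)) : ℝ) : ℂ)) (z + ((1 / ξ - 1 : ℝ) : ℂ))
      (ξ * m) := by
    refine ⟨(MellinConvergent.comp_rpow (f := fun x => (g x : ℂ))
      (by positivity)).2 (by rw [e1]; exact H.1), ?_⟩
    rw [mellin_comp_rpow (fun x => (g x : ℂ)), e1, H.2, abs_of_pos (by positivity),
      Complex.real_smul]
    simp
  have h3 := h2.scale (h := fun x => g (x ^ (1 / ξ))) (1 / (ν * ξ) * ν⁻¹ ^ (1 / ξ - 1))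
    (1 / ξ - 1) ν⁻¹ (by positivity)
  have hpi : (ν : ℂ).arg ≠ Real.pi := by
    rw [Complex.arg_ofReal_of_nonneg hν.le]; exact Real.pi_pos.ne
  have e2 : (ν : ℂ) ^ (z - 1) * m = ((1 / (ν * ξ) * ν⁻¹ ^ (1 / ξ - 1) : ℝ) : ℂ) *
      (((ν⁻¹ : ℝ) : ℂ) ^ (-(z + ((1 / ξ - 1 : ℝ) : ℂ))) * (ξ * m)) := by
    rw [Real.inv_rpow hν.le, ← Real.rpow_neg hν.le, Complex.ofReal_mul,
      Complex.ofReal_cpow hν.le, Complex.ofReal_inv, Complex.inv_cpow _ _ hpi, ← Complex.cpow_neg,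
      neg_neg]
    have : (ν : ℂ) ^ (z - 1) = (ν : ℂ)⁻¹ * ((ν : ℂ) ^ ((-(1 / ξ - 1) : ℝ) : ℂ) *
        (ν : ℂ) ^ (z + ((1 / ξ - 1 : ℝ) : ℂ))) := by
      rw [← Complex.cpow_neg_one, ← Complex.cpow_add _ _ hνc, ← Complex.cpow_add _ _ hνc]
      congr 1
      push_cast
      ring
    rw [this]
    push_cast
    field_simp
  rw [e2]
  refine h3.congr' fun x hx => ?_
  congr 1
  rw [div_eq_mul_inv x ν, Real.mul_rpow hx.le (by positivity), mul_comm ν⁻¹ x]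
  ring

/-- The Mellin transform of the Meijer density, on its strip of holomorphy
`1 - ξ / (γ² cos² θ) < Re z < 1 + ξ / (γ² sin² θ)` (a bound with a zero denominator is void). -/
theorem hasMellin_meijerDensity {ν γ ξ θ : ℝ} {z : ℂ} (hν : 0 < ν) (hγ : 0 < γ) (hξ : 0 < ξ)
    (hθ0 : 0 ≤ θ) (hθ1 : θ ≤ Real.pi / 2)
    (hz0 : γ ^ 2 * Real.cos θ ^ 2 * (1 - z.re) < ξ)
    (hz1 : γ ^ 2 * Real.sin θ ^ 2 * (z.re - 1) < ξ) :
    HasMellin (fun y => (meijerDensity ν γ ξ θ y : ℂ)) z (meijerMellin ν γ ξ θ z) := by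
  have hre : (1 + (ξ : ℂ) * (z - 1)).re = 1 + ξ * (z.re - 1) := by simp
  have key : ∀ c : ℝ, 0 < c → ∀ t : ℝ, c * t < ξ → ξ * t < ξ ^ 2 / c := by
    intro c hc t ht
    rw [lt_div_iff₀ hc]
    nlinarith
  have hγξ : ((γ ^ 2 / ξ ^ 2 : ℝ) : ℂ) = (((ξ ^ 2 / γ ^ 2 : ℝ)) : ℂ)⁻¹ := by
    rw [← Complex.ofReal_inv, inv_div]
  have hr : (0 : ℝ) < ξ ^ 2 / γ ^ 2 := by positivity
  have hpi : ((ξ ^ 2 / γ ^ 2 : ℝ) : ℂ).arg ≠ Real.pi := by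
    rw [Complex.arg_ofReal_of_nonneg hr.le]; exact Real.pi_pos.ne
  unfold meijerDensity meijerBase meijerMellin
  split_ifs with h0 h1
  · subst h0
    have h := key (γ ^ 2) (by positivity) (1 - z.re) (by simpa using hz0)
    have H := (hasMellin_gammaDensity (a := ξ ^ 2 / γ ^ 2) (r := ξ ^ 2 / γ ^ 2)
      (s := 1 + ξ * (z - 1)) hr (by rw [hre]; linarith)).rescaled_power hν hξ
    convert H using 1
    rw [hγξ, Complex.inv_cpow _ _ hpi, ← Complex.cpow_neg]
    ring_nf
  · subst h1
    have h := key (γ ^ 2) (by positivity) (z.re - 1) (by simpa using hz1)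
    have H := (hasMellin_invGammaDensity (a := ξ ^ 2 / γ ^ 2) (r := ξ ^ 2 / γ ^ 2)
      (s := 1 + ξ * (z - 1)) hr (by rw [hre]; linarith)).rescaled_power hν hξ
    convert H using 1
    rw [hγξ, Complex.inv_cpow _ _ hpi, ← Complex.cpow_neg]
    ring_nf
  · have hθ0' : 0 < θ := lt_of_le_of_ne hθ0 (Ne.symm h0)
    have hθ1' : θ < Real.pi / 2 := lt_of_le_of_ne hθ1 h1
    have hc : 0 < Real.cos θ := Real.cos_pos_of_mem_Ioo ⟨by linarith, hθ1'⟩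
    have hsn : 0 < Real.sin θ := Real.sin_pos_of_pos_of_lt_pi hθ0' (by linarith)
    have g0 := key (γ ^ 2 * Real.cos θ ^ 2) (by positivity) (1 - z.re) hz0
    have g1 := key (γ ^ 2 * Real.sin θ ^ 2) (by positivity) (z.re - 1) hz1
    have H := (hasMellin_fisherDensity (a := ξ ^ 2 / (γ ^ 2 * Real.cos θ ^ 2))
      (b := ξ ^ 2 / (γ ^ 2 * Real.sin θ ^ 2)) (s := 1 + ξ * (z - 1)) (by positivity)
      (by positivity) (by rw [hre]; linarith) (by rw [hre]; linarith)).rescaled_power hν hξ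
    convert H using 1
    have ht : ξ ^ 2 / (γ ^ 2 * Real.sin θ ^ 2) / (ξ ^ 2 / (γ ^ 2 * Real.cos θ ^ 2)) =
        1 / Real.tan θ ^ 2 := by
      rw [Real.tan_eq_sin_div_cos]
      field_simp
    have e1 : (1 : ℂ) + ξ * (z - 1) - 1 = ξ * (z - 1) := by ring
    have e2 : (1 : ℂ) - (1 + ξ * (z - 1)) = ξ * (1 - z) := by ring
    rw [ht, e1, e2]
    ring

/-! ### Moments of the Gaussian weight. -/

section GaussianMoments

/-! In logarithmic scale all Meijer kernels come from one phase g = `meijerPhase ξ θ`: the density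
at y is y⁻¹ times a constant times exp(-N g(log y - log ν)), with N = γ⁻² (`meijerDensity_eq`). The
Gamma, Inverse Gamma and Fisher-Snedecor cases differ only through g, which is smooth and strictly
convex with g(0) = g'(0) = 0, g''(0) = 1, g'''(0) = κ = cos 2θ / ξ (`isPhase_meijerPhase`). For an
observation t, N = 1 + t/η² and ν = 1 + lam/N with lam = (1 + κ)/2. Since the sample is i.i.d., both
claims reduce to the first two moments of one summand, that is, to integrals of f against the kernel
and its square.

Near x, put t = x e^(-v) and ε² = η²/x. Jointly as ε → 0 and v → 0, the kernel (without its factor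
1/x) times e^(-v) is (ε√(2π))⁻¹ exp(-e^(-v) g(v)/ε²) exp(-3v/2 - g(v) + lam g'(v)) (1 + cε² + o(ε²))
(`windowKernel_expansion`). The constant c collects the correction to the normalising constant,
itself obtained by Laplace's method (`phaseNorm_expansion`), and the effect of the shift log ν.
Laplace's method with phase e^(-v) g(v) (`laplace_expansion`) and the second-order expansion of the
remaining weight (`weightedDensity_expansion`) give the mean up to o(ε²). At order ε², the
coefficient of f(x) vanishes whatever lam is, that of f'(x) is x((1 + κ)/2 - lam), so that the
choice of ν kills it, and x² f''(x)/2 remains (`exists_window_mean`). For the second moment the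
leading term suffices: squaring the Gaussian factor replaces ε by ε/√2, whence the constant 1/(2√π)
(`exists_window_sq`).

Away from x, observations on the right contribute an exponentially small amount. On the left N is
bounded when t is of order η², so that concentration is lost there, and the decay must come from the
linear growth g(v) ≥ S v - C. It bounds the kernel by a multiple of t^S exp(-ct/η²), hence of
η^(2(S+r)) t^(-r) (`exists_phaseKernel_off`). With a finite moment of order -r and S + r > 1 the
contribution to the mean is o(η²); the hypothesis ξ/sin²θ > 1 - α provides such S and r
(`exists_growth_meijerPhase`). -/

theorem integrable_abs_pow_mul_exp_neg_mul_sq (k : ℕ) {b : ℝ} (hb : 0 < b) :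
    Integrable fun z : ℝ => |z| ^ k * Real.exp (-b * z ^ 2) := by
  have h := (integrable_rpow_mul_exp_neg_mul_sq hb (s := k)
    (by have := Nat.cast_nonneg (α := ℝ) k; linarith)).norm
  refine h.congr (Eventually.of_forall fun z => ?_)
  simp

theorem integrable_pow_mul_exp_neg_mul_sq (k : ℕ) {b : ℝ} (hb : 0 < b) :
    Integrable fun z : ℝ => z ^ k * Real.exp (-b * z ^ 2) := by
  simpa using integrable_rpow_mul_exp_neg_mul_sq hb (s := k)
    (by have := Nat.cast_nonneg (α := ℝ) k; linarith)

theorem integral_exp_neg_half_sq :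
    ∫ z : ℝ, Real.exp (-(1 / 2) * z ^ 2) = Real.sqrt (2 * Real.pi) := by
  rw [integral_gaussian]
  congr 1
  ring

/-- Integration by parts: the derivative of z^(k+1) exp(-z²/2) has integral zero. -/
theorem integral_pow_add_two_mul_exp_neg_half_sq (k : ℕ) :
    ∫ z : ℝ, z ^ (k + 2) * Real.exp (-(1 / 2) * z ^ 2) =
      (k + 1) * ∫ z : ℝ, z ^ k * Real.exp (-(1 / 2) * z ^ 2) := by
  have hd : ∀ z : ℝ, HasDerivAt (fun z : ℝ => z ^ (k + 1) * Real.exp (-(1 / 2) * z ^ 2))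
      ((k + 1) * (z ^ k * Real.exp (-(1 / 2) * z ^ 2)) -
        z ^ (k + 2) * Real.exp (-(1 / 2) * z ^ 2)) z := by
    intro z
    have h1 := (hasDerivAt_pow (k + 1) z).mul
      (((hasDerivAt_pow 2 z).const_mul (-(1 / 2 : ℝ))).exp)
    refine h1.congr_deriv ?_
    push_cast [Nat.add_sub_cancel]
    ring
  have hk := integrable_pow_mul_exp_neg_mul_sq k (b := 1 / 2) (by norm_num)
  have hk1 := integrable_pow_mul_exp_neg_mul_sq (k + 1) (b := 1 / 2) (by norm_num)
  have hk2 := integrable_pow_mul_exp_neg_mul_sq (k + 2) (b := 1 / 2) (by norm_num)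
  have h := integral_eq_zero_of_hasDerivAt_of_integrable hd ((hk.const_mul _).sub hk2) hk1
  rw [integral_sub (hk.const_mul _) hk2, integral_const_mul] at h
  linarith

theorem integral_id_mul_exp_neg_half_sq :
    ∫ z : ℝ, z ^ 1 * Real.exp (-(1 / 2) * z ^ 2) = 0 := by
  have hd : ∀ z : ℝ, HasDerivAt (fun z : ℝ => -Real.exp (-(1 / 2) * z ^ 2))
      (z ^ 1 * Real.exp (-(1 / 2) * z ^ 2)) z := by
    intro z
    have h1 := (((hasDerivAt_pow 2 z).const_mul (-(1 / 2 : ℝ))).exp).neg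
    refine h1.congr_deriv ?_
    push_cast
    ring
  exact integral_eq_zero_of_hasDerivAt_of_integrable hd
    (integrable_pow_mul_exp_neg_mul_sq 1 (by norm_num))
    (integrable_exp_neg_mul_sq (by norm_num)).neg

/-- The moments of orders `0` to `8` of the Gaussian weight `exp (-z² / 2)`, up to the factor
`√(2π)`. -/
theorem integral_pow_mul_exp_neg_half_sq :
    (∫ z : ℝ, z ^ 0 * Real.exp (-(1 / 2) * z ^ 2) = Real.sqrt (2 * Real.pi)) ∧
    (∫ z : ℝ, z ^ 1 * Real.exp (-(1 / 2) * z ^ 2) = 0) ∧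
    (∫ z : ℝ, z ^ 2 * Real.exp (-(1 / 2) * z ^ 2) = Real.sqrt (2 * Real.pi)) ∧
    (∫ z : ℝ, z ^ 3 * Real.exp (-(1 / 2) * z ^ 2) = 0) ∧
    (∫ z : ℝ, z ^ 4 * Real.exp (-(1 / 2) * z ^ 2) = 3 * Real.sqrt (2 * Real.pi)) ∧
    (∫ z : ℝ, z ^ 5 * Real.exp (-(1 / 2) * z ^ 2) = 0) ∧
    (∫ z : ℝ, z ^ 6 * Real.exp (-(1 / 2) * z ^ 2) = 15 * Real.sqrt (2 * Real.pi)) ∧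
    (∫ z : ℝ, z ^ 7 * Real.exp (-(1 / 2) * z ^ 2) = 0) ∧
    (∫ z : ℝ, z ^ 8 * Real.exp (-(1 / 2) * z ^ 2) = 105 * Real.sqrt (2 * Real.pi)) := by
  have h0 : ∫ z : ℝ, z ^ 0 * Real.exp (-(1 / 2) * z ^ 2) = Real.sqrt (2 * Real.pi) := by
    simpa using integral_exp_neg_half_sq
  have h1 := integral_id_mul_exp_neg_half_sq
  have h2 := integral_pow_add_two_mul_exp_neg_half_sq 0
  have h3 := integral_pow_add_two_mul_exp_neg_half_sq 1
  have h4 := integral_pow_add_two_mul_exp_neg_half_sq 2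
  have h5 := integral_pow_add_two_mul_exp_neg_half_sq 3
  have h6 := integral_pow_add_two_mul_exp_neg_half_sq 4
  have h7 := integral_pow_add_two_mul_exp_neg_half_sq 5
  have h8 := integral_pow_add_two_mul_exp_neg_half_sq 6
  simp only [Nat.reduceAdd] at h2 h3 h4 h5 h6 h7 h8
  rw [h0] at h2
  rw [h1] at h3
  rw [h2] at h4
  rw [h3] at h5
  rw [h4] at h6
  rw [h5] at h7
  rw [h6] at h8
  refine ⟨h0, h1, ?_, ?_, ?_, ?_, ?_, ?_, ?_⟩
  · rw [h2]; norm_num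
  · rw [h3]; norm_num
  · rw [h4]; norm_num
  · rw [h5]; norm_num
  · rw [h6]; norm_num; ring
  · rw [h7]; norm_num
  · rw [h8]; norm_num; ring

end GaussianMoments

/-! ### Laplace's method to second order. -/

section Laplace

/-- Lagrange remainder. The factor exp (max r 0), rather than exp |r|, lets a one-sided bound on r
be absorbed by the Gaussian. -/
theorem abs_exp_sub_quadratic_le (r : ℝ) :
    |Real.exp r - 1 - r - r ^ 2 / 2| ≤ |r| ^ 3 * Real.exp (max r 0) := by
  rcases eq_or_ne r 0 with rfl | hr
  · simp
  obtain ⟨y, hy, h⟩ := taylor_mean_remainder_lagrange_iteratedDeriv (f := Real.exp) (n := 2)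
    (x₀ := 0) (x := r) hr.symm Real.contDiff_exp.contDiffOn
  have hyr : y ≤ max r 0 := by
    rcases le_total r 0 with h0 | h0
    · rw [uIoo_of_ge h0] at hy; exact le_max_of_le_right hy.2.le
    · rw [uIoo_of_le h0] at hy; exact le_max_of_le_left hy.2.le
  have hu : UniqueDiffOn ℝ (uIcc 0 r) := uniqueDiffOn_uIcc hr.symm
  have hit : ∀ k : ℕ, iteratedDerivWithin k Real.exp (uIcc 0 r) 0 = 1 := by
    intro k
    rw [iteratedDerivWithin_eq_iteratedDeriv hu Real.contDiff_exp.contDiffAt left_mem_uIcc,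
      iteratedDeriv_eq_iterate, Real.iter_deriv_exp, Real.exp_zero]
  rw [taylor_within_apply, iteratedDeriv_eq_iterate, Real.iter_deriv_exp] at h
  simp only [Finset.sum_range_succ, Finset.sum_range_zero, hit, Nat.factorial, smul_eq_mul] at h
  norm_num at h
  have e : Real.exp r - 1 - r - r ^ 2 / 2 = Real.exp y * r ^ 3 / 6 := by linarith
  rw [e, abs_div, abs_mul, Real.abs_exp, abs_pow, abs_of_pos (by norm_num : (0 : ℝ) < 6),
    div_le_iff₀ (by norm_num)]
  have h1 : Real.exp y ≤ Real.exp (max r 0) := Real.exp_le_exp.2 hyr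
  have h2 : 0 ≤ |r| ^ 3 * Real.exp (max r 0) := by positivity
  calc Real.exp y * |r| ^ 3 ≤ Real.exp (max r 0) * |r| ^ 3 := by gcongr
    _ ≤ _ := by linarith

/-- The correction of the Gaussian weight that comes from the terms `a v³ + b v⁴` of a phase. -/
noncomputable def laplacePoly (a b ε z : ℝ) : ℝ :=
  1 - a * ε * z ^ 3 + ε ^ 2 * (a ^ 2 * z ^ 6 / 2 - b * z ^ 4)

/-- One weight dominates all the powers of |z| in the error terms, which then share a single
integrable envelope. -/
theorem pow_le_pow_three_add_pow_twelve {y : ℝ} (hy : 0 ≤ y) {k : ℕ} (h3 : 3 ≤ k) (h12 : k ≤ 12) :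
    y ^ k ≤ y ^ 3 + y ^ 12 := by
  rcases le_total y 1 with h | h
  · exact (pow_le_pow_of_le_one hy h h3).trans (by linarith [pow_nonneg hy 12])
  · exact (pow_le_pow_right₀ h h12).trans (by linarith [pow_nonneg hy 3])

/-- With v = εz the exponent is -z²/2 + r, where r = -aεz³ - bε²z⁴ up to ε³. Expanding exp r to
second order gives `laplacePoly`; the bound φ ≥ v²/4 costs half of the Gaussian decay, which
explains the exponent -z²/4. -/
theorem laplace_pointwise {φ : ℝ → ℝ} {a b C δ : ℝ} (hδ : 0 < δ) (hδ1 : δ ≤ 1) (hC : 0 ≤ C)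
    (hφ : ∀ v, |v| ≤ δ → |φ v - (v ^ 2 / 2 + a * v ^ 3 + b * v ^ 4)| ≤ C * |v| ^ 5)
    (hφ' : ∀ v, |v| ≤ δ → v ^ 2 / 4 ≤ φ v) :
    ∃ C', ∀ ε, 0 < ε → ε ≤ 1 → ∀ z,
      |(Icc (-δ) δ).indicator (fun v => Real.exp (-(φ v / ε ^ 2))) (ε * z) -
        Real.exp (-(1 / 2) * z ^ 2) * laplacePoly a b ε z| ≤
      C' * ε ^ 3 * ((|z| ^ 3 + |z| ^ 12) * Real.exp (-(1 / 4) * z ^ 2)) := by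
  set C1 := |a| + |b| + C with hC1
  have hC1' : 0 ≤ C1 := by positivity
  have habs : ∀ z : ℝ, Real.exp (-(1 / 2) * z ^ 2) ≤ Real.exp (-(1 / 4) * z ^ 2) := fun z =>
    Real.exp_le_exp.2 (by nlinarith [sq_nonneg z])
  refine ⟨C1 ^ 3 + C + C1 * C1 + (1 + |a| + a ^ 2 + |b|) * (1 / δ) ^ 3, fun ε hε hε1 z => ?_⟩
  have hK : ∀ k : ℕ, 3 ≤ k → k ≤ 12 → |z| ^ k ≤ |z| ^ 3 + |z| ^ 12 := fun k h1 h2 =>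
    pow_le_pow_three_add_pow_twelve (abs_nonneg z) h1 h2
  set Q := |z| ^ 3 + |z| ^ 12 with hQ
  have hQ0 : 0 ≤ Q := by positivity
  set y := |z| with hy
  have hy0 : 0 ≤ y := abs_nonneg z
  have hε2 : ε ^ 2 ≤ 1 := pow_le_one₀ hε.le hε1
  by_cases hz : |ε * z| ≤ δ
  · rw [indicator_of_mem (by exact abs_le.1 hz)]
    have hεy : ε * y ≤ 1 := by
      have : |ε * z| = ε * y := by rw [abs_mul, abs_of_pos hε]
      linarith
    -- `r` is the excess over the Gaussian exponent and `e` is what remains of it beyond the orders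
    -- ε and ε².
    set r := -(φ (ε * z) / ε ^ 2 - z ^ 2 / 2) with hr
    set e := r - (-(a * ε * z ^ 3) - b * ε ^ 2 * z ^ 4) with he
    have hε0 : ε ^ 2 ≠ 0 := by positivity
    have heb : |e| ≤ C * ε ^ 3 * y ^ 5 := by
      have h1 := hφ _ hz
      have h2 : e = -((φ (ε * z) - ((ε * z) ^ 2 / 2 + a * (ε * z) ^ 3 + b * (ε * z) ^ 4)) /
          ε ^ 2) := by
        rw [he, hr]
        field_simp
        ring
      rw [h2, abs_neg, abs_div, abs_of_pos (by positivity : 0 < ε ^ 2), div_le_iff₀ (by positivity)]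
      refine h1.trans (le_of_eq ?_)
      rw [abs_mul, abs_of_pos hε]
      ring
    have hrle : r ≤ z ^ 2 / 4 := by
      have h1 := hφ' _ hz
      have h2 : z ^ 2 / 4 ≤ φ (ε * z) / ε ^ 2 := by
        rw [le_div_iff₀ (by positivity)]
        nlinarith
      rw [hr]
      linarith
    have hz3 : |a * ε * z ^ 3| = |a| * ε * y ^ 3 := by
      rw [abs_mul, abs_mul, abs_pow, abs_of_pos hε]
    have hz4 : |b * ε ^ 2 * z ^ 4| = |b| * ε ^ 2 * y ^ 4 := by
      rw [abs_mul, abs_mul, abs_pow, abs_pow, abs_of_pos hε]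
    have hre : r = e - a * ε * z ^ 3 - b * ε ^ 2 * z ^ 4 := by rw [he]; ring
    have hs1 : |r + a * ε * z ^ 3| ≤ C1 * ε ^ 2 * y ^ 4 := by
      have : r + a * ε * z ^ 3 = e - b * ε ^ 2 * z ^ 4 := by rw [hre]; ring
      rw [this]
      refine (abs_sub _ _).trans ?_
      rw [hz4]
      have : C * ε ^ 3 * y ^ 5 ≤ C * ε ^ 2 * y ^ 4 := by
        have h3 : C * ε ^ 3 * y ^ 5 = C * ε ^ 2 * y ^ 4 * (ε * y) := by ring
        rw [h3]
        exact mul_le_of_le_one_right (by positivity) hεy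
      have h4 : 0 ≤ |a| * ε ^ 2 * y ^ 4 := by positivity
      rw [hC1]
      linarith
    have hrb : |r| ≤ C1 * ε * y ^ 3 := by
      have h1 : |r| ≤ |r + a * ε * z ^ 3| + |a * ε * z ^ 3| := by
        have := abs_sub (r + a * ε * z ^ 3) (a * ε * z ^ 3)
        simpa using this
      have h2 : |r + a * ε * z ^ 3| ≤ (|b| + C) * ε ^ 2 * y ^ 4 := by
        have : r + a * ε * z ^ 3 = e - b * ε ^ 2 * z ^ 4 := by rw [hre]; ring
        rw [this]
        refine (abs_sub _ _).trans ?_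
        rw [hz4]
        have : C * ε ^ 3 * y ^ 5 ≤ C * ε ^ 2 * y ^ 4 := by
          have h3 : C * ε ^ 3 * y ^ 5 = C * ε ^ 2 * y ^ 4 * (ε * y) := by ring
          rw [h3]
          exact mul_le_of_le_one_right (by positivity) hεy
        linarith
      have h3 : (|b| + C) * ε ^ 2 * y ^ 4 ≤ (|b| + C) * ε * y ^ 3 := by
        have h3 : (|b| + C) * ε ^ 2 * y ^ 4 = (|b| + C) * ε * y ^ 3 * (ε * y) := by ring
        rw [h3]
        exact mul_le_of_le_one_right (by positivity) hεy
      rw [hz3] at h1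
      rw [hC1]
      linarith
    have hsq : |r ^ 2 / 2 - a ^ 2 * ε ^ 2 * z ^ 6 / 2| ≤ C1 * C1 * ε ^ 3 * y ^ 7 := by
      have h1 : r ^ 2 / 2 - a ^ 2 * ε ^ 2 * z ^ 6 / 2 =
          (r + a * ε * z ^ 3) * ((r - a * ε * z ^ 3) / 2) := by ring
      have h2 : |(r - a * ε * z ^ 3) / 2| ≤ C1 * ε * y ^ 3 := by
        rw [abs_div, abs_two, div_le_iff₀ two_pos]
        refine (abs_sub _ _).trans ?_
        rw [hz3]
        have : |a| * ε * y ^ 3 ≤ C1 * ε * y ^ 3 := by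
          gcongr
          rw [hC1]
          linarith [abs_nonneg b]
        linarith
      rw [h1, abs_mul]
      calc _ ≤ (C1 * ε ^ 2 * y ^ 4) * (C1 * ε * y ^ 3) := by gcongr
        _ = _ := by ring
    have hexp := abs_exp_sub_quadratic_le r
    have hmax : Real.exp (max r 0) ≤ Real.exp (z ^ 2 / 4) :=
      Real.exp_le_exp.2 (max_le hrle (by positivity))
    have hcube : |r| ^ 3 ≤ C1 ^ 3 * ε ^ 3 * y ^ 9 := by
      calc |r| ^ 3 ≤ (C1 * ε * y ^ 3) ^ 3 := by gcongr
        _ = _ := by ring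
    have hone : 1 ≤ Real.exp (z ^ 2 / 4) := Real.one_le_exp (by positivity)
    have hsum : |Real.exp r - laplacePoly a b ε z| ≤
        (C1 ^ 3 + C + C1 * C1) * ε ^ 3 * Q * Real.exp (z ^ 2 / 4) := by
      have h1 : Real.exp r - laplacePoly a b ε z =
          (Real.exp r - 1 - r - r ^ 2 / 2) + e + (r ^ 2 / 2 - a ^ 2 * ε ^ 2 * z ^ 6 / 2) := by
        rw [laplacePoly, he]
        ring
      rw [h1]
      refine (abs_add_three _ _ _).trans ?_
      have i1 : |Real.exp r - 1 - r - r ^ 2 / 2| ≤ C1 ^ 3 * ε ^ 3 * Q * Real.exp (z ^ 2 / 4) := by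
        refine hexp.trans ?_
        calc |r| ^ 3 * Real.exp (max r 0) ≤ (C1 ^ 3 * ε ^ 3 * y ^ 9) * Real.exp (z ^ 2 / 4) := by
              gcongr
          _ ≤ _ := by
              have := hK 9 (by norm_num) (by norm_num)
              gcongr
      have i2 : |e| ≤ C * ε ^ 3 * Q * Real.exp (z ^ 2 / 4) := by
        refine heb.trans ?_
        have := hK 5 (by norm_num) (by norm_num)
        calc _ ≤ C * ε ^ 3 * Q := by gcongr
          _ ≤ _ := le_mul_of_one_le_right (by positivity) hone
      have i3 : |r ^ 2 / 2 - a ^ 2 * ε ^ 2 * z ^ 6 / 2| ≤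
          C1 * C1 * ε ^ 3 * Q * Real.exp (z ^ 2 / 4) := by
        refine hsq.trans ?_
        have := hK 7 (by norm_num) (by norm_num)
        calc _ ≤ C1 * C1 * ε ^ 3 * Q := by gcongr
          _ ≤ _ := le_mul_of_one_le_right (by positivity) hone
      calc _ ≤ _ := add_le_add (add_le_add i1 i2) i3
        _ = _ := by ring
    have hfac : Real.exp (-(φ (ε * z) / ε ^ 2)) = Real.exp (-(1 / 2) * z ^ 2) * Real.exp r := by
      rw [← Real.exp_add]
      congr 1
      rw [hr]
      ring
    rw [hfac, ← mul_sub, abs_mul, Real.abs_exp]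
    calc _ ≤ Real.exp (-(1 / 2) * z ^ 2) *
          ((C1 ^ 3 + C + C1 * C1) * ε ^ 3 * Q * Real.exp (z ^ 2 / 4)) := by gcongr
      _ = (C1 ^ 3 + C + C1 * C1) * ε ^ 3 * (Q * Real.exp (-(1 / 4) * z ^ 2)) := by
          have : Real.exp (-(1 / 4) * z ^ 2) =
              Real.exp (-(1 / 2) * z ^ 2) * Real.exp (z ^ 2 / 4) := by
            rw [← Real.exp_add]; congr 1; ring
          rw [this]
          ring
      _ ≤ _ := by
          refine mul_le_mul_of_nonneg_right (mul_le_mul_of_nonneg_right ?_ (by positivity))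
            (by positivity)
          linarith [show 0 ≤ (1 + |a| + a ^ 2 + |b|) * (1 / δ) ^ 3 by positivity]
  · rw [indicator_of_notMem (by rw [mem_Icc, ← abs_le]; exact hz), zero_sub, abs_neg, abs_mul,
      Real.abs_exp]
    -- Outside the window ε|z|/δ is at least 1, so its cube can be inserted for free and supplies
    -- the factor ε³.
    have hlt : 1 ≤ ε * y * (1 / δ) := by
      rw [not_le, abs_mul, abs_of_pos hε] at hz
      rw [mul_one_div, le_div_iff₀ hδ]
      linarith
    have hlt3 : 1 ≤ ε ^ 3 * y ^ 3 * (1 / δ) ^ 3 := by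
      have := one_le_pow₀ hlt (n := 3)
      calc 1 ≤ _ := this
        _ = _ := by ring
    have hP : |laplacePoly a b ε z| ≤ 1 + |a| * y ^ 3 + a ^ 2 * y ^ 6 + |b| * y ^ 4 := by
      have e1 : laplacePoly a b ε z = 1 + (-(a * ε * z ^ 3)) + ε ^ 2 * (a ^ 2 * z ^ 6 / 2) +
          (-(ε ^ 2 * (b * z ^ 4))) := by
        rw [laplacePoly]; ring
      rw [e1]
      have j1 : |(-(a * ε * z ^ 3))| ≤ |a| * y ^ 3 := by
        rw [abs_neg, abs_mul, abs_mul, abs_pow, abs_of_pos hε]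
        calc |a| * ε * y ^ 3 ≤ |a| * 1 * y ^ 3 := by gcongr
          _ = _ := by ring
      have j2 : |ε ^ 2 * (a ^ 2 * z ^ 6 / 2)| ≤ a ^ 2 * y ^ 6 := by
        rw [abs_mul, abs_div, abs_mul, abs_pow, abs_pow, abs_pow, abs_of_pos hε, abs_two, sq_abs]
        have : 0 ≤ a ^ 2 * y ^ 6 := by positivity
        calc ε ^ 2 * (a ^ 2 * y ^ 6 / 2) ≤ 1 * (a ^ 2 * y ^ 6 / 2) := by gcongr
          _ ≤ _ := by linarith
      have j3 : |(-(ε ^ 2 * (b * z ^ 4)))| ≤ |b| * y ^ 4 := by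
        rw [abs_neg, abs_mul, abs_mul, abs_pow, abs_pow, abs_of_pos hε]
        calc ε ^ 2 * (|b| * y ^ 4) ≤ 1 * (|b| * y ^ 4) := by gcongr
          _ = _ := by ring
      refine (abs_add_le _ _).trans (add_le_add ((abs_add_le _ _).trans (add_le_add
        ((abs_add_le _ _).trans (add_le_add (by simp) j1)) j2)) j3)
    have hPQ : |laplacePoly a b ε z| ≤
        (1 + |a| + a ^ 2 + |b|) * (1 / δ) ^ 3 * ε ^ 3 * Q := by
      calc |laplacePoly a b ε z| ≤ (1 + |a| * y ^ 3 + a ^ 2 * y ^ 6 + |b| * y ^ 4) * 1 := by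
            rw [mul_one]; exact hP
        _ ≤ (1 + |a| * y ^ 3 + a ^ 2 * y ^ 6 + |b| * y ^ 4) *
            (ε ^ 3 * y ^ 3 * (1 / δ) ^ 3) := by gcongr
        _ = (y ^ 3 + |a| * y ^ 6 + a ^ 2 * y ^ 9 + |b| * y ^ 7) * ((1 / δ) ^ 3 * ε ^ 3) := by ring
        _ ≤ (Q + |a| * Q + a ^ 2 * Q + |b| * Q) * ((1 / δ) ^ 3 * ε ^ 3) := by
            have k3 := hK 3 (by norm_num) (by norm_num)
            have k6 := hK 6 (by norm_num) (by norm_num)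
            have k9 := hK 9 (by norm_num) (by norm_num)
            have k7 := hK 7 (by norm_num) (by norm_num)
            gcongr
        _ = _ := by ring
    calc _ ≤ Real.exp (-(1 / 4) * z ^ 2) *
          ((1 + |a| + a ^ 2 + |b|) * (1 / δ) ^ 3 * ε ^ 3 * Q) := by
          exact mul_le_mul (habs z) hPQ (abs_nonneg _) (Real.exp_pos _).le
      _ = (1 + |a| + a ^ 2 + |b|) * (1 / δ) ^ 3 * ε ^ 3 * (Q * Real.exp (-(1 / 4) * z ^ 2)) := by
          ring
      _ ≤ _ := by
          refine mul_le_mul_of_nonneg_right (mul_le_mul_of_nonneg_right ?_ (by positivity))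
            (by positivity)
          linarith [show 0 ≤ C1 ^ 3 + C + C1 * C1 by positivity]

theorem integral_pow_mul_laplacePoly (a b ε : ℝ) (j : ℕ) :
    ∫ z : ℝ, z ^ j * (Real.exp (-(1 / 2) * z ^ 2) * laplacePoly a b ε z) =
      (∫ z : ℝ, z ^ j * Real.exp (-(1 / 2) * z ^ 2)) -
      a * ε * (∫ z : ℝ, z ^ (j + 3) * Real.exp (-(1 / 2) * z ^ 2)) +
      ε ^ 2 * (a ^ 2 / 2 * (∫ z : ℝ, z ^ (j + 6) * Real.exp (-(1 / 2) * z ^ 2)) -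
        b * (∫ z : ℝ, z ^ (j + 4) * Real.exp (-(1 / 2) * z ^ 2))) := by
  have hI : ∀ k : ℕ, Integrable fun z : ℝ => z ^ k * Real.exp (-(1 / 2) * z ^ 2) := fun k =>
    integrable_pow_mul_exp_neg_mul_sq k (by norm_num)
  simp only [← integral_const_mul]
  rw [← integral_sub ((hI _).const_mul _) ((hI _).const_mul _), ← integral_const_mul,
    ← integral_sub (hI _) ((hI _).const_mul _), ← integral_add]
  · congr 1
    ext z
    rw [laplacePoly]
    ring
  · exact (hI _).sub ((hI _).const_mul _)
  · exact (((hI _).const_mul _).sub ((hI _).const_mul _)).const_mul _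

theorem integrable_pow_mul_laplacePoly (a b ε : ℝ) (j : ℕ) :
    Integrable fun z : ℝ => z ^ j * (Real.exp (-(1 / 2) * z ^ 2) * laplacePoly a b ε z) := by
  have hI : ∀ k : ℕ, Integrable fun z : ℝ => z ^ k * Real.exp (-(1 / 2) * z ^ 2) := fun k =>
    integrable_pow_mul_exp_neg_mul_sq k (by norm_num)
  refine (((hI j).sub ((hI (j + 3)).const_mul (a * ε))).add
    ((((hI (j + 6)).const_mul (a ^ 2 / 2)).sub ((hI (j + 4)).const_mul b)).const_mul
      (ε ^ 2))).congr (Eventually.of_forall fun z => ?_)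
  simp only [Pi.add_apply, Pi.sub_apply]
  rw [laplacePoly]
  ring

/-- Integrate `laplace_pointwise` against z^j; the substitution v = εz turns v^j dv into ε^(j+1) z^j
dz. -/
theorem laplace_moment {φ : ℝ → ℝ} {a b C δ : ℝ} (hδ : 0 < δ) (hδ1 : δ ≤ 1) (hC : 0 ≤ C)
    (hc : Continuous φ)
    (hφ : ∀ v, |v| ≤ δ → |φ v - (v ^ 2 / 2 + a * v ^ 3 + b * v ^ 4)| ≤ C * |v| ^ 5)
    (hφ' : ∀ v, |v| ≤ δ → v ^ 2 / 4 ≤ φ v) (j : ℕ) :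
    ∃ C', ∀ ε, 0 < ε → ε ≤ 1 →
      |(∫ v in Icc (-δ) δ, v ^ j * Real.exp (-(φ v / ε ^ 2))) -
        ε ^ (j + 1) * ∫ z : ℝ, z ^ j * (Real.exp (-(1 / 2) * z ^ 2) * laplacePoly a b ε z)| ≤
      C' * ε ^ (j + 4) := by
  obtain ⟨C₁, h⟩ := laplace_pointwise hδ hδ1 hC hφ hφ'
  have hI : ∀ k : ℕ, Integrable fun z : ℝ => |z| ^ k * Real.exp (-(1 / 4) * z ^ 2) := fun k =>
    integrable_abs_pow_mul_exp_neg_mul_sq k (by norm_num)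
  set D := ∫ z : ℝ, (|z| ^ (j + 3) + |z| ^ (j + 12)) * Real.exp (-(1 / 4) * z ^ 2) with hD
  have hDI : Integrable fun z : ℝ =>
      (|z| ^ (j + 3) + |z| ^ (j + 12)) * Real.exp (-(1 / 4) * z ^ 2) := by
    refine ((hI (j + 3)).add (hI (j + 12))).congr (Eventually.of_forall fun z => ?_)
    simp only [Pi.add_apply]
    ring
  refine ⟨C₁ * D, fun ε hε hε1 => ?_⟩
  set G : ℝ → ℝ := (Icc (-δ) δ).indicator (fun v => Real.exp (-(φ v / ε ^ 2))) with hG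
  have hGI : Integrable fun v => v ^ j * G v := by
    have h1 : (fun v => v ^ j * G v) =
        (Icc (-δ) δ).indicator (fun v => v ^ j * Real.exp (-(φ v / ε ^ 2))) := by
      ext v
      by_cases hv : v ∈ Icc (-δ) δ <;> simp [hG, hv]
    rw [h1, integrable_indicator_iff measurableSet_Icc]
    exact (Continuous.continuousOn (by fun_prop)).integrableOn_compact isCompact_Icc
  have h1 : (∫ v in Icc (-δ) δ, v ^ j * Real.exp (-(φ v / ε ^ 2))) =
      ε ^ (j + 1) * ∫ z, z ^ j * G (ε * z) := by
    have e1 : (∫ v in Icc (-δ) δ, v ^ j * Real.exp (-(φ v / ε ^ 2))) = ∫ v, v ^ j * G v := by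
      rw [← integral_indicator measurableSet_Icc]
      congr 1
      ext v
      by_cases hv : v ∈ Icc (-δ) δ <;> simp [hG, hv]
    have e2 := Measure.integral_comp_mul_left (fun v => v ^ j * G v) ε
    rw [abs_of_pos (by positivity), smul_eq_mul] at e2
    rw [e1, show (∫ v, v ^ j * G v) = ε * ∫ z, (ε * z) ^ j * G (ε * z) by
      rw [e2]; field_simp, pow_succ', mul_assoc, ← integral_const_mul (ε ^ j)]
    congr 2
    funext z
    ring
  have hGI' : Integrable fun z => z ^ j * G (ε * z) := by
    have e := (hGI.comp_mul_left' hε.ne').const_mul ((ε ^ j)⁻¹)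
    refine e.congr (Eventually.of_forall fun z => ?_)
    simp only
    rw [mul_pow]
    field_simp
  rw [h1, ← mul_sub, ← integral_sub hGI' (integrable_pow_mul_laplacePoly a b ε j), abs_mul,
    abs_of_pos (by positivity : 0 < ε ^ (j + 1))]
  have hb : |∫ z, (z ^ j * G (ε * z) -
      z ^ j * (Real.exp (-(1 / 2) * z ^ 2) * laplacePoly a b ε z))| ≤
      ∫ z, C₁ * ε ^ 3 * ((|z| ^ (j + 3) + |z| ^ (j + 12)) * Real.exp (-(1 / 4) * z ^ 2)) := by
    rw [← Real.norm_eq_abs]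
    refine norm_integral_le_of_norm_le (hDI.const_mul _) (Eventually.of_forall fun z => ?_)
    rw [← mul_sub, Real.norm_eq_abs, abs_mul, abs_pow]
    calc |z| ^ j * _ ≤ |z| ^ j * _ := mul_le_mul_of_nonneg_left (h ε hε hε1 z) (by positivity)
      _ = _ := by ring
  rw [integral_const_mul] at hb
  calc _ ≤ ε ^ (j + 1) * (C₁ * ε ^ 3 * D) := by gcongr
    _ = _ := by ring

/-- Laplace's method to second order, for the moments of order `0`, `1` and `2`. -/
theorem laplace_expansion {φ : ℝ → ℝ} {a b C δ : ℝ} (hδ : 0 < δ) (hδ1 : δ ≤ 1) (hC : 0 ≤ C)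
    (hc : Continuous φ)
    (hφ : ∀ v, |v| ≤ δ → |φ v - (v ^ 2 / 2 + a * v ^ 3 + b * v ^ 4)| ≤ C * |v| ^ 5)
    (hφ' : ∀ v, |v| ≤ δ → v ^ 2 / 4 ≤ φ v) :
    ∃ C', 0 ≤ C' ∧ ∀ ε, 0 < ε → ε ≤ 1 →
      |(ε * Real.sqrt (2 * Real.pi))⁻¹ * (∫ v in Icc (-δ) δ, Real.exp (-(φ v / ε ^ 2))) -
        (1 + ε ^ 2 * (15 * a ^ 2 / 2 - 3 * b))| ≤ C' * ε ^ 3 ∧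
      |(ε * Real.sqrt (2 * Real.pi))⁻¹ * (∫ v in Icc (-δ) δ, v * Real.exp (-(φ v / ε ^ 2))) -
        (-3 * a * ε ^ 2)| ≤ C' * ε ^ 3 ∧
      |(ε * Real.sqrt (2 * Real.pi))⁻¹ * (∫ v in Icc (-δ) δ, v ^ 2 * Real.exp (-(φ v / ε ^ 2))) -
        ε ^ 2| ≤ C' * ε ^ 3 := by
  obtain ⟨C0, h0⟩ := laplace_moment hδ hδ1 hC hc hφ hφ' 0
  obtain ⟨C1, h1⟩ := laplace_moment hδ hδ1 hC hc hφ hφ' 1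
  obtain ⟨C2, h2⟩ := laplace_moment hδ hδ1 hC hc hφ hφ' 2
  simp only [integral_pow_mul_laplacePoly, Nat.reduceAdd] at h0 h1 h2
  obtain ⟨m0, m1, m2, m3, m4, m5, m6, m7, m8⟩ := integral_pow_mul_exp_neg_half_sq
  rw [m0, m3, m6, m4] at h0
  rw [m1, m4, m7, m5] at h1
  rw [m2, m5, m8, m6] at h2
  set s := Real.sqrt (2 * Real.pi) with hs
  have hs0 : 0 < s := Real.sqrt_pos.2 (by positivity)
  -- The normalised second moment is ε² plus a term of order ε⁴ with this coefficient; `B` pays for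
  -- moving that term into the error.
  set B := |105 * a ^ 2 / 2 - 15 * b| with hB
  refine ⟨(|C0| + |C1| + |C2|) / s + B, by positivity, fun ε hε hε1 => ?_⟩
  -- Every moment error is at most of order ε⁴ because ε ≤ 1; the normalisation removes one power.
  have key : ∀ {I T D : ℝ} {k : ℕ}, 0 ≤ D → |I - ε * s * T| ≤ D * ε ^ (k + 4) →
      |(ε * s)⁻¹ * I - T| ≤ D / s * ε ^ 3 := by
    intro I T D k hD h
    have e : (ε * s)⁻¹ * I - T = (ε * s)⁻¹ * (I - ε * s * T) := by field_simp
    rw [e, abs_mul, abs_of_pos (by positivity)]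
    have hk : ε ^ (k + 4) ≤ ε ^ 4 := pow_le_pow_of_le_one hε.le hε1 (by omega)
    calc _ ≤ (ε * s)⁻¹ * (D * ε ^ 4) := by gcongr; exact h.trans (by gcongr)
      _ = _ := by field_simp
  have a0 := abs_nonneg C0
  have a1 := abs_nonneg C1
  have a2 := abs_nonneg C2
  have hε3 : 0 < ε ^ 3 := by positivity
  refine ⟨?_, ?_, ?_⟩
  · refine (key (k := 0) (abs_nonneg C0) ?_).trans ?_
    · refine le_trans (le_of_eq ?_) ((h0 ε hε hε1).trans
        (mul_le_mul_of_nonneg_right (le_abs_self C0) (by positivity)))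
      simp only [pow_zero, one_mul]
      congr 2
      ring
    · gcongr
      rw [add_div, add_div]
      have : 0 ≤ |C1| / s := by positivity
      have : 0 ≤ |C2| / s := by positivity
      linarith [abs_nonneg (105 * a ^ 2 / 2 - 15 * b)]
  · refine (key (k := 1) (abs_nonneg C1) ?_).trans ?_
    · refine le_trans (le_of_eq ?_) ((h1 ε hε hε1).trans
        (mul_le_mul_of_nonneg_right (le_abs_self C1) (by positivity)))
      simp only [pow_one]
      congr 2
      ring
    · gcongr
      rw [add_div, add_div]
      have : 0 ≤ |C0| / s := by positivity
      have : 0 ≤ |C2| / s := by positivity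
      linarith [abs_nonneg (105 * a ^ 2 / 2 - 15 * b)]
  · have h3 : |(ε * s)⁻¹ * (∫ v in Icc (-δ) δ, v ^ 2 * Real.exp (-(φ v / ε ^ 2))) -
        ε ^ 2 * (1 + ε ^ 2 * (105 * a ^ 2 / 2 - 15 * b))| ≤ |C2| / s * ε ^ 3 := by
      refine key (k := 2) (abs_nonneg C2) ?_
      refine le_trans (le_of_eq ?_) ((h2 ε hε hε1).trans
        (mul_le_mul_of_nonneg_right (le_abs_self C2) (by positivity)))
      congr 2
      ring
    have h4 : |ε ^ 2 * (1 + ε ^ 2 * (105 * a ^ 2 / 2 - 15 * b)) - ε ^ 2| ≤ B * ε ^ 3 := by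
      have e : ε ^ 2 * (1 + ε ^ 2 * (105 * a ^ 2 / 2 - 15 * b)) - ε ^ 2 =
          (105 * a ^ 2 / 2 - 15 * b) * ε ^ 3 * ε := by ring
      rw [e, abs_mul, abs_mul, abs_of_pos hε, abs_of_pos hε3]
      exact mul_le_of_le_one_right (by positivity) hε1
    refine (abs_sub_le _ _ _).trans ((add_le_add h3 h4).trans ?_)
    rw [← add_mul]
    gcongr
    linarith

end Laplace

/-! ### Convex phases and their normalising constants. -/

section Phase

/-- A smooth strictly convex phase with a nondegenerate minimum at `0`, normalized by
`g'' 0 = 1`, and with third derivative `κ` there. -/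
structure IsPhase (g : ℝ → ℝ) (κ : ℝ) : Prop where
  contDiff : ContDiff ℝ 5 g
  zero : g 0 = 0
  deriv_zero : deriv g 0 = 0
  deriv2_zero : deriv (deriv g) 0 = 1
  deriv3_zero : deriv (deriv (deriv g)) 0 = κ
  deriv2_pos : ∀ v, 0 < deriv (deriv g) v
  integrable : Integrable fun v => Real.exp (-g v)

/-- The constant that turns `exp (-N * g)` into a probability density. -/
noncomputable def phaseNorm (g : ℝ → ℝ) (N : ℝ) : ℝ := (∫ v, Real.exp (-(N * g v)))⁻¹

/-- The coefficient of order four of a phase. -/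
noncomputable def quarticCoeff (g : ℝ → ℝ) : ℝ := iteratedDeriv 4 g 0 / 24

/-- Once |v| is small against the coefficients, the terms of order at least three are below v²/4.
The lower bound feeds Laplace's method, the upper one bounds `phaseNorm`. -/
theorem exists_window {φ : ℝ → ℝ} {a b : ℝ}
    (h : (fun v => φ v - (v ^ 2 / 2 + a * v ^ 3 + b * v ^ 4)) =O[𝓝 0] fun v => v ^ 5) :
    ∃ C δ₀, 0 ≤ C ∧ 0 < δ₀ ∧ δ₀ ≤ 1 ∧ ∀ v, |v| ≤ δ₀ →
      |φ v - (v ^ 2 / 2 + a * v ^ 3 + b * v ^ 4)| ≤ C * |v| ^ 5 ∧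
      v ^ 2 / 4 ≤ φ v ∧ φ v ≤ v ^ 2 := by
  obtain ⟨C, hC, hb⟩ := h.exists_nonneg
  rw [IsBigOWith] at hb
  obtain ⟨δ₁, hδ₁, h1⟩ := Metric.eventually_nhds_iff.1 hb
  set A := |a| + |b| + C + 1 with hA
  have hA0 : 0 < A := by positivity
  refine ⟨C, min (δ₁ / 2) (1 / (4 * A)), hC, by positivity, ?_, fun v hv => ?_⟩
  · refine (min_le_right _ _).trans ?_
    rw [div_le_one (by positivity)]
    linarith [abs_nonneg a, abs_nonneg b]
  have hv1 : |v| < δ₁ := by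
    have := hv.trans (min_le_left _ _)
    linarith
  have hvA : |v| * A ≤ 1 / 4 := by
    have := hv.trans (min_le_right _ _)
    rw [le_div_iff₀ (by positivity)] at this
    linarith
  have hv2 : |v| ≤ 1 := by
    nlinarith [abs_nonneg a, abs_nonneg b, abs_nonneg v]
  have hO : |φ v - (v ^ 2 / 2 + a * v ^ 3 + b * v ^ 4)| ≤ C * |v| ^ 5 := by
    have := h1 (y := v) (by simpa [Real.dist_eq] using hv1)
    simpa [abs_pow] using this
  have hr : |φ v - v ^ 2 / 2| ≤ v ^ 2 / 4 := by
    have e : φ v - v ^ 2 / 2 = (φ v - (v ^ 2 / 2 + a * v ^ 3 + b * v ^ 4)) + a * v ^ 3 +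
      b * v ^ 4 := by ring
    rw [e]
    refine (abs_add_three _ _ _).trans ?_
    rw [abs_mul, abs_mul, abs_pow, abs_pow]
    have h5 : |v| ^ 5 ≤ |v| ^ 3 := pow_le_pow_of_le_one (abs_nonneg v) hv2 (by norm_num)
    have h4 : |v| ^ 4 ≤ |v| ^ 3 := pow_le_pow_of_le_one (abs_nonneg v) hv2 (by norm_num)
    have e2 : |v| ^ 3 = |v| * v ^ 2 := by rw [← sq_abs v]; ring
    calc _ ≤ C * |v| ^ 3 + |a| * |v| ^ 3 + |b| * |v| ^ 3 := by gcongr; exact hO.trans (by gcongr)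
      _ ≤ A * |v| ^ 3 := by
        rw [hA]
        nlinarith [pow_nonneg (abs_nonneg v) 3]
      _ = |v| * A * v ^ 2 := by rw [e2]; ring
      _ ≤ 1 / 4 * v ^ 2 := by gcongr
      _ = _ := by ring
  rw [abs_le] at hr
  exact ⟨hO, by linarith [hr.1], by linarith [hr.2, sq_nonneg v]⟩

theorem tendsto_inv_pow_mul_exp_neg_div_sq {c : ℝ} (hc : 0 < c) (k : ℕ) :
    Tendsto (fun s : ℝ => (s ^ k)⁻¹ * Real.exp (-(c / s ^ 2))) (𝓝[>] 0) (𝓝 0) := by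
  have h1 : Tendsto (fun s : ℝ => c / s ^ 2) (𝓝[>] 0) atTop := by
    have h2 : Tendsto (fun s : ℝ => s ^ 2) (𝓝[>] 0) (𝓝[>] 0) := by
      refine tendsto_nhdsWithin_iff.2 ⟨tendsto_nhdsWithin_of_tendsto_nhds ?_, ?_⟩
      · simpa using (continuous_pow 2).tendsto (0 : ℝ)
      · filter_upwards [self_mem_nhdsWithin] with s hs using pow_pos (mem_Ioi.1 hs) 2
    simpa [div_eq_mul_inv] using (tendsto_inv_nhdsGT_zero.comp h2).const_mul_atTop hc
  have h3 := ((Real.tendsto_pow_mul_exp_neg_atTop_nhds_zero k).comp h1).const_mul ((c ^ k)⁻¹)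
  rw [mul_zero] at h3
  refine squeeze_zero' ?_ ?_ h3
  · filter_upwards [self_mem_nhdsWithin] with s hs
    have hs0 : 0 < s := hs
    positivity
  · filter_upwards [Ioo_mem_nhdsGT (one_pos : (0 : ℝ) < 1)] with s hs
    obtain ⟨hs0, hs1⟩ := hs
    have h4 : (s ^ k)⁻¹ ≤ ((s ^ 2) ^ k)⁻¹ := by
      refine inv_anti₀ (by positivity) (pow_le_pow_left₀ (by positivity) ?_ k)
      nlinarith
    simp only [Function.comp_apply]
    calc _ ≤ ((s ^ 2) ^ k)⁻¹ * Real.exp (-(c / s ^ 2)) := by gcongr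
      _ = _ := by rw [div_pow]; field_simp

namespace IsPhase

variable {g : ℝ → ℝ} {κ : ℝ}

theorem continuous (hg : IsPhase g κ) : Continuous g := hg.contDiff.continuous

theorem contDiff_deriv (hg : IsPhase g κ) : ContDiff ℝ 4 (deriv g) :=
  (contDiff_succ_iff_deriv.1 (show ContDiff ℝ (4 + 1) g from hg.contDiff)).2.2

theorem contDiff_deriv2 (hg : IsPhase g κ) : ContDiff ℝ 3 (deriv (deriv g)) :=
  (contDiff_succ_iff_deriv.1 (show ContDiff ℝ (3 + 1) (deriv g) from hg.contDiff_deriv)).2.2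

theorem hasDerivAt (hg : IsPhase g κ) (v : ℝ) : HasDerivAt g (deriv g v) v :=
  (hg.contDiff.differentiable (by norm_num) v).hasDerivAt

theorem hasDerivAt_deriv (hg : IsPhase g κ) (v : ℝ) :
    HasDerivAt (deriv g) (deriv (deriv g) v) v :=
  (hg.contDiff_deriv.differentiable (by norm_num) v).hasDerivAt

theorem hasDerivAt_deriv2 (hg : IsPhase g κ) (v : ℝ) :
    HasDerivAt (deriv (deriv g)) (deriv (deriv (deriv g)) v) v :=
  (hg.contDiff_deriv2.differentiable (by norm_num) v).hasDerivAt

/-- Peano's formula at order five; the fifth-order term is put into the remainder, which becomes a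
big O. -/
theorem taylor (hg : IsPhase g κ) :
    (fun v => g v - (v ^ 2 / 2 + κ / 6 * v ^ 3 + quarticCoeff g * v ^ 4)) =O[𝓝 0]
      fun v => v ^ 5 := by
  have h := taylor_isLittleO_univ (x₀ := 0) (n := 5) hg.contDiff
  simp only [taylor_within_apply, Finset.sum_range_succ, Finset.sum_range_zero,
    iteratedDerivWithin_univ, sub_zero, smul_eq_mul, Nat.factorial] at h
  have e1 : iteratedDeriv 1 g 0 = 0 := by rw [iteratedDeriv_one, hg.deriv_zero]
  have e2 : iteratedDeriv 2 g 0 = 1 := by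
    rw [iteratedDeriv_succ, iteratedDeriv_one, hg.deriv2_zero]
  have e3 : iteratedDeriv 3 g 0 = κ := by
    rw [iteratedDeriv_succ, iteratedDeriv_succ, iteratedDeriv_one, hg.deriv3_zero]
  rw [e1, e2, e3, iteratedDeriv_zero, hg.zero] at h
  have h' := h.isBigO.add ((isBigO_refl (fun v : ℝ => v ^ 5) (𝓝 0)).const_mul_left
    (iteratedDeriv 5 g 0 / 120))
  refine h'.congr_left fun v => ?_
  rw [quarticCoeff]
  push_cast
  ring

/-- The precision at t = x e^(-v) is itself proportional to e^(-v) at leading order, so the phase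
seen by Laplace's method is e^(-v) g(v). Its coefficients come from multiplying by 1 - v + v²/2. -/
theorem taylor_exp_mul (hg : IsPhase g κ) :
    (fun v => Real.exp (-v) * g v - (v ^ 2 / 2 + (κ - 3) / 6 * v ^ 3 +
      (quarticCoeff g - κ / 6 + 1 / 4) * v ^ 4)) =O[𝓝 0] fun v => v ^ 5 := by
  set p : ℝ → ℝ := fun v => v ^ 2 / 2 + κ / 6 * v ^ 3 + quarticCoeff g * v ^ 4 with hp
  have hexp : (fun v : ℝ => Real.exp (-v) - (1 - v + v ^ 2 / 2)) =O[𝓝 0] fun v => v ^ 3 := by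
    have h := abs_exp_sub_quadratic_le
    refine IsBigO.of_bound (Real.exp 1) ?_
    filter_upwards [Metric.ball_mem_nhds (0 : ℝ) one_pos] with v hv
    have hv1 : |v| < 1 := by simpa [Real.dist_eq] using hv
    have h1 := h (-v)
    rw [abs_neg] at h1
    have h2 : Real.exp (max (-v) 0) ≤ Real.exp 1 :=
      Real.exp_le_exp.2 (max_le (by linarith [neg_abs_le v]) zero_le_one)
    rw [Real.norm_eq_abs, norm_pow, Real.norm_eq_abs]
    calc |Real.exp (-v) - (1 - v + v ^ 2 / 2)| =
        |Real.exp (-v) - 1 - -v - (-v) ^ 2 / 2| := by congr 1; ring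
      _ ≤ _ := h1
      _ ≤ |v| ^ 3 * Real.exp 1 := by gcongr
      _ = _ := by ring
  have hp2 : p =O[𝓝 0] fun v => v ^ 2 := by
    have e : p = fun v => v ^ 2 * (1 / 2 + κ / 6 * v + quarticCoeff g * v ^ 2) := by
      ext v; rw [hp]; ring
    rw [e]
    have : (fun v : ℝ => 1 / 2 + κ / 6 * v + quarticCoeff g * v ^ 2) =O[𝓝 0]
        fun _ => (1 : ℝ) := (Continuous.tendsto (by fun_prop) 0).isBigO_one ℝ
    simpa using (isBigO_refl (fun v : ℝ => v ^ 2) (𝓝 0)).mul this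
  have hone : (fun v : ℝ => Real.exp (-v)) =O[𝓝 0] fun _ => (1 : ℝ) :=
    (Continuous.tendsto (by fun_prop) 0).isBigO_one ℝ
  have t1 : (fun v => Real.exp (-v) * (g v - p v)) =O[𝓝 0] fun v => v ^ 5 := by
    simpa using hone.mul hg.taylor
  have t2 : (fun v => (Real.exp (-v) - (1 - v + v ^ 2 / 2)) * p v) =O[𝓝 0] fun v => v ^ 5 := by
    refine (hexp.mul hp2).congr_right fun v => by ring
  have t3 : (fun v : ℝ => v ^ 5 * (κ / 12 - quarticCoeff g + quarticCoeff g / 2 * v)) =O[𝓝 0]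
      fun v => v ^ 5 := by
    have : (fun v : ℝ => κ / 12 - quarticCoeff g + quarticCoeff g / 2 * v) =O[𝓝 0]
        fun _ => (1 : ℝ) := (Continuous.tendsto (by fun_prop) 0).isBigO_one ℝ
    simpa using (isBigO_refl (fun v : ℝ => v ^ 5) (𝓝 0)).mul this
  refine ((t1.add t2).add t3).congr_left fun v => ?_
  rw [hp]
  ring

theorem strictMono_deriv (hg : IsPhase g κ) : StrictMono (deriv g) :=
  strictMono_of_deriv_pos hg.deriv2_pos

theorem strictMonoOn (hg : IsPhase g κ) : StrictMonoOn g (Ici 0) := by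
  refine strictMonoOn_of_deriv_pos (convex_Ici 0) hg.continuous.continuousOn fun v hv => ?_
  rw [interior_Ici] at hv
  rw [← hg.deriv_zero]
  exact hg.strictMono_deriv hv

theorem strictAntiOn (hg : IsPhase g κ) : StrictAntiOn g (Iic 0) := by
  refine strictAntiOn_of_deriv_neg (convex_Iic 0) hg.continuous.continuousOn fun v hv => ?_
  rw [interior_Iic] at hv
  rw [← hg.deriv_zero]
  exact hg.strictMono_deriv hv

/-- By strict convexity g decreases before 0 and increases after it, so its infimum off a
neighbourhood of 0 is reached at an endpoint. -/
theorem exists_pos_le (hg : IsPhase g κ) {δ : ℝ} (hδ : 0 < δ) :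
    ∃ c, 0 < c ∧ ∀ v, δ ≤ |v| → c ≤ g v := by
  have h1 : 0 < g δ := by
    rw [← hg.zero]; exact hg.strictMonoOn self_mem_Ici hδ.le hδ
  have h2 : 0 < g (-δ) := by
    rw [← hg.zero]
    exact hg.strictAntiOn (show -δ ≤ 0 by linarith) self_mem_Iic (by linarith)
  refine ⟨min (g δ) (g (-δ)), lt_min h1 h2, fun v hv => ?_⟩
  rcases le_abs'.1 hv with h | h
  · exact (min_le_right _ _).trans (hg.strictAntiOn.antitoneOn (show v ≤ 0 by linarith)
      (show -δ ≤ 0 by linarith) h)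
  · exact (min_le_left _ _).trans (hg.strictMonoOn.monotoneOn hδ.le (hδ.le.trans h) h)

theorem nonneg (hg : IsPhase g κ) (v : ℝ) : 0 ≤ g v := by
  rcases eq_or_ne v 0 with rfl | h
  · rw [hg.zero]
  · obtain ⟨c, hc, h⟩ := hg.exists_pos_le (abs_pos.2 h)
    exact hc.le.trans (h v le_rfl)

theorem integrable_mul (hg : IsPhase g κ) {N : ℝ} (hN : 1 ≤ N) :
    Integrable fun v => Real.exp (-(N * g v)) := by
  have hc := hg.continuous
  refine hg.integrable.mono' (by fun_prop : Continuous fun v =>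
    Real.exp (-(N * g v))).aestronglyMeasurable (Eventually.of_forall fun v => ?_)
  rw [Real.norm_eq_abs, Real.abs_exp]
  exact Real.exp_le_exp.2 (by nlinarith [hg.nonneg v])

theorem integral_pos (hg : IsPhase g κ) {N : ℝ} (hN : 1 ≤ N) :
    0 < ∫ v, Real.exp (-(N * g v)) :=
  integral_exp_pos (hg.integrable_mul hN)

theorem phaseNorm_pos (hg : IsPhase g κ) {N : ℝ} (hN : 1 ≤ N) : 0 < phaseNorm g N :=
  inv_pos.2 (hg.integral_pos hN)

/-- On |v| ≤ δ/√N one has N g ≤ N v² ≤ 1, so the integral is at least of order 1/√N. -/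
theorem exists_phaseNorm_le (hg : IsPhase g κ) :
    ∃ C, 0 < C ∧ ∀ N, 1 ≤ N → phaseNorm g N ≤ C * Real.sqrt N := by
  obtain ⟨_, δ, _, hδ, hδ1, h⟩ := exists_window hg.taylor
  refine ⟨Real.exp 1 / (2 * δ), by positivity, fun N hN => ?_⟩
  have hs : 0 < Real.sqrt N := Real.sqrt_pos.2 (by linarith)
  have hs1 : 1 ≤ Real.sqrt N := Real.one_le_sqrt.2 hN
  have hsq : Real.sqrt N ^ 2 = N := Real.sq_sqrt (by linarith)
  have hlow : 2 * δ / Real.sqrt N * Real.exp (-1) ≤ ∫ v, Real.exp (-(N * g v)) := by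
    calc 2 * δ / Real.sqrt N * Real.exp (-1) =
        ∫ _ in Icc (-(δ / Real.sqrt N)) (δ / Real.sqrt N), Real.exp (-1) := by
          rw [setIntegral_const, Measure.real, Real.volume_Icc, ENNReal.toReal_ofReal,
            smul_eq_mul]
          · ring
          · have : 0 < δ / Real.sqrt N := by positivity
            linarith
      _ ≤ ∫ v in Icc (-(δ / Real.sqrt N)) (δ / Real.sqrt N), Real.exp (-(N * g v)) := by
          refine setIntegral_mono_on
            (continuousOn_const.integrableOn_compact isCompact_Icc) (hg.integrable_mul hN).integrableOn measurableSet_Icc fun v hv => ?_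
          have hv' : |v| ≤ δ / Real.sqrt N := abs_le.2 hv
          have hv1 : |v| * Real.sqrt N ≤ δ := by rwa [le_div_iff₀ hs] at hv'
          have hvδ : |v| ≤ δ := hv'.trans (div_le_self hδ.le hs1)
          refine Real.exp_le_exp.2 (neg_le_neg ?_)
          calc N * g v ≤ N * v ^ 2 := by
                have := (h v hvδ).2.2
                gcongr
            _ = (|v| * Real.sqrt N) ^ 2 := by rw [mul_pow, sq_abs, hsq]; ring
            _ ≤ 1 := pow_le_one₀ (by positivity) (hv1.trans hδ1)
      _ ≤ _ := setIntegral_le_integral (hg.integrable_mul hN)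
          (Eventually.of_forall fun v => (Real.exp_pos _).le)
  rw [phaseNorm]
  calc _ ≤ (2 * δ / Real.sqrt N * Real.exp (-1))⁻¹ := inv_anti₀ (by positivity) hlow
    _ = _ := by rw [Real.exp_neg]; field_simp

/-- Here s = N^(-1/2). This plays the part of Stirling's formula for the Gamma factors of the three
families: Laplace's method on a window, an exponentially small tail, and then the expansion of the
inverse. -/
theorem phaseNorm_expansion (hg : IsPhase g κ) :
    Tendsto (fun s : ℝ => (Real.sqrt (2 * Real.pi) * s * phaseNorm g (s ^ 2)⁻¹ - 1) / s ^ 2)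
      (𝓝[>] 0) (𝓝 (-(15 * (κ / 6) ^ 2 / 2 - 3 * quarticCoeff g))) := by
  set i := 15 * (κ / 6) ^ 2 / 2 - 3 * quarticCoeff g with hi
  set q := Real.sqrt (2 * Real.pi) with hq
  have hq0 : 0 < q := Real.sqrt_pos.2 (by positivity)
  obtain ⟨C, δ, hC, hδ, hδ1, h⟩ := exists_window hg.taylor
  obtain ⟨C', hC', hL⟩ := laplace_expansion hδ hδ1 hC hg.continuous
    (fun v hv => (h v hv).1) (fun v hv => (h v hv).2.1)
  obtain ⟨c, hc, hcg⟩ := hg.exists_pos_le hδ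
  set I1 := ∫ v, Real.exp (-g v) with hI1
  set J : ℝ → ℝ := fun s => (s * q)⁻¹ * ∫ v, Real.exp (-((s ^ 2)⁻¹ * g v)) with hJ
  have hJ1 : Tendsto (fun s => (J s - 1) / s ^ 2) (𝓝[>] 0) (𝓝 i) := by
    rw [tendsto_iff_norm_sub_tendsto_zero]
    have hlim : Tendsto (fun s : ℝ => C' * s + q⁻¹ * Real.exp c * I1 *
        ((s ^ 3)⁻¹ * Real.exp (-(c / s ^ 2)))) (𝓝[>] 0) (𝓝 0) := by
      have h1 : Tendsto (fun s : ℝ => C' * s) (𝓝[>] 0) (𝓝 (C' * 0)) :=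
        (tendsto_nhdsWithin_of_tendsto_nhds tendsto_id).const_mul C'
      have h2 := (tendsto_inv_pow_mul_exp_neg_div_sq hc 3).const_mul (q⁻¹ * Real.exp c * I1)
      simpa using h1.add h2
    refine squeeze_zero' (Eventually.of_forall fun s => norm_nonneg _) ?_ hlim
    filter_upwards [Ioo_mem_nhdsGT (one_pos : (0 : ℝ) < 1)] with s hs
    obtain ⟨hs0, hs1⟩ := hs
    have hN : 1 ≤ (s ^ 2)⁻¹ := (one_le_inv₀ (by positivity)).2 (pow_le_one₀ hs0.le hs1.le)
    have hint := hg.integrable_mul hN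
    have hsplit := integral_add_compl (measurableSet_Icc (a := -δ) (b := δ)) hint
    have htail0 : 0 ≤ ∫ v in (Icc (-δ) δ)ᶜ, Real.exp (-((s ^ 2)⁻¹ * g v)) :=
      integral_nonneg fun v => (Real.exp_pos _).le
    -- Off the window N g ≥ (N - 1)c + g: one unit of precision is kept for integrability and the
    -- rest gives the decay.
    have htail : ∫ v in (Icc (-δ) δ)ᶜ, Real.exp (-((s ^ 2)⁻¹ * g v)) ≤
        Real.exp c * Real.exp (-(c / s ^ 2)) * I1 := by
      calc _ ≤ ∫ v in (Icc (-δ) δ)ᶜ, Real.exp c * Real.exp (-(c / s ^ 2)) * Real.exp (-g v) := by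
            refine setIntegral_mono_on hint.integrableOn (hg.integrable.const_mul _).integrableOn
              measurableSet_Icc.compl fun v hv => ?_
            rw [mem_compl_iff, mem_Icc, ← abs_le, not_le] at hv
            rw [← Real.exp_add, ← Real.exp_add, Real.exp_le_exp]
            have := hcg v hv.le
            rw [div_eq_mul_inv]
            nlinarith
        _ ≤ ∫ v, Real.exp c * Real.exp (-(c / s ^ 2)) * Real.exp (-g v) :=
            setIntegral_le_integral (hg.integrable.const_mul _)
              (Eventually.of_forall fun v => by positivity)
        _ = _ := integral_const_mul _ _
    have hw := (hL s hs0 hs1.le).1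
    have hwe : (∫ v in Icc (-δ) δ, Real.exp (-(g v / s ^ 2))) =
        ∫ v in Icc (-δ) δ, Real.exp (-((s ^ 2)⁻¹ * g v)) := by
      simp only [div_eq_inv_mul]
    rw [hwe] at hw
    set W := ∫ v in Icc (-δ) δ, Real.exp (-((s ^ 2)⁻¹ * g v))
    set R := ∫ v in (Icc (-δ) δ)ᶜ, Real.exp (-((s ^ 2)⁻¹ * g v))
    have e : (J s - 1) / s ^ 2 - i =
        ((s * q)⁻¹ * W - (1 + s ^ 2 * i)) / s ^ 2 + (s * q)⁻¹ * R / s ^ 2 := by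
      rw [hJ]
      simp only
      rw [← hsplit]
      field_simp
      ring
    rw [e]
    refine (norm_add_le _ _).trans (add_le_add ?_ ?_)
    · rw [Real.norm_eq_abs, abs_div, abs_of_pos (by positivity : 0 < s ^ 2),
        div_le_iff₀ (by positivity)]
      exact hw.trans (le_of_eq (by ring))
    · rw [Real.norm_eq_abs, abs_of_nonneg (by positivity)]
      calc (s * q)⁻¹ * R / s ^ 2 ≤
          (s * q)⁻¹ * (Real.exp c * Real.exp (-(c / s ^ 2)) * I1) / s ^ 2 := by gcongr
        _ = _ := by field_simp
  have hs2 : Tendsto (fun s : ℝ => s ^ 2) (𝓝[>] 0) (𝓝 0) := by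
    refine tendsto_nhdsWithin_of_tendsto_nhds ?_
    simpa using (continuous_pow 2).tendsto (0 : ℝ)
  have hJ0 : Tendsto J (𝓝[>] 0) (𝓝 1) := by
    have h1 := (hJ1.mul hs2).add_const 1
    simp only [mul_zero, zero_add] at h1
    refine h1.congr' ?_
    filter_upwards [self_mem_nhdsWithin] with s hs
    have hs0 : s ≠ 0 := ne_of_gt hs
    field_simp
    ring
  have hfin := hJ1.neg.mul (hJ0.inv₀ one_ne_zero)
  rw [inv_one, mul_one] at hfin
  refine hfin.congr' ?_
  filter_upwards [Ioo_mem_nhdsGT (one_pos : (0 : ℝ) < 1)] with s hs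
  obtain ⟨hs0, hs1⟩ := hs
  have hN : 1 ≤ (s ^ 2)⁻¹ := (one_le_inv₀ (by positivity)).2 (pow_le_one₀ hs0.le hs1.le)
  have hI := hg.integral_pos hN
  rw [phaseNorm, hJ]
  simp only
  generalize (∫ v, Real.exp (-((s ^ 2)⁻¹ * g v))) = I at hI ⊢
  field_simp
  ring

end IsPhase

end Phase

/-! ### Expansion of the kernel near the evaluation point. -/

section Window

/-- The product rule for first order expansions around `1`. -/
theorem tendsto_mul_sub_one_div {ι : Type*} {l : Filter ι} {p q e : ι → ℝ} {a b : ℝ}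
    (hp : Tendsto (fun i => (p i - 1) / e i) l (𝓝 a))
    (hq : Tendsto (fun i => (q i - 1) / e i) l (𝓝 b)) (he : Tendsto e l (𝓝 0))
    (he0 : ∀ᶠ i in l, e i ≠ 0) :
    Tendsto (fun i => (p i * q i - 1) / e i) l (𝓝 (a + b)) := by
  have h := (hp.add hq).add ((hp.mul hq).mul he)
  rw [mul_zero, add_zero] at h
  refine h.congr' ?_
  filter_upwards [he0] with i hi
  field_simp
  ring

theorem tendsto_exp_sub_one_div {ι : Type*} {l : Filter ι} {p e : ι → ℝ} {a : ℝ}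
    (hp : Tendsto (fun i => p i / e i) l (𝓝 a)) (he : Tendsto e l (𝓝 0))
    (he0 : ∀ᶠ i in l, e i ≠ 0) :
    Tendsto (fun i => (Real.exp (p i) - 1) / e i) l (𝓝 a) := by
  have hp0 : Tendsto p l (𝓝 0) := by
    have h := hp.mul he
    rw [mul_zero] at h
    refine h.congr' ?_
    filter_upwards [he0] with i hi
    field_simp
  have hd : (fun x : ℝ => Real.exp x - 1 - x) =o[𝓝 0] fun x => x := by
    have := (Real.hasDerivAt_exp 0).isLittleO
    simpa using this
  have h1 : (fun i => Real.exp (p i) - 1 - p i) =o[l] e := by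
    refine (hd.comp_tendsto hp0).trans_isBigO ?_
    exact isBigO_of_div_tendsto_nhds (he0.mono fun i hi h => absurd h hi) a hp
  have h2 := h1.tendsto_div_nhds_zero.add hp
  rw [zero_add] at h2
  refine h2.congr fun i => ?_
  ring

namespace IsPhase

variable {g : ℝ → ℝ} {κ : ℝ}

/-- Two successive mean value inequalities, using the continuity of g'' at 0. The base point moves
together with the increment, as required for the shift v - log ν with v not fixed. -/
theorem second_difference (hg : IsPhase g κ) :
    (fun p : ℝ × ℝ => g (p.1 - p.2) - g p.1 + p.2 * deriv g p.1 - p.2 ^ 2 / 2) =o[𝓝 (0, 0)]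
      fun p => p.2 ^ 2 := by
  rw [isLittleO_iff]
  intro c hc
  have hcont : ContinuousAt (deriv (deriv g)) 0 := hg.contDiff_deriv2.continuous.continuousAt
  obtain ⟨r, hr, hb⟩ := Metric.continuousAt_iff.1 hcont c hc
  rw [hg.deriv2_zero] at hb
  have hball : Metric.ball (0 : ℝ) (r / 2) ×ˢ Metric.ball (0 : ℝ) (r / 2) ∈ 𝓝 ((0 : ℝ), (0 : ℝ)) :=
    prod_mem_nhds (Metric.ball_mem_nhds _ (by positivity)) (Metric.ball_mem_nhds _ (by positivity))
  filter_upwards [hball] with ⟨v, y⟩ ⟨hv, hy⟩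
  simp only [Metric.mem_ball, Real.dist_eq, sub_zero] at hv hy
  have hsub : ∀ z ∈ Metric.closedBall v |y|, dist z 0 < r := by
    intro z hz
    rw [Metric.mem_closedBall, Real.dist_eq] at hz
    rw [Real.dist_eq, sub_zero]
    have := abs_add_le (z - v) v
    rw [sub_add_cancel] at this
    linarith
  have hconv := convex_closedBall v |y|
  have hvm : v ∈ Metric.closedBall v |y| := Metric.mem_closedBall_self (abs_nonneg y)
  have h1 : ∀ z ∈ Metric.closedBall v |y|, |deriv g z - deriv g v - (z - v)| ≤ c * |y| := by
    intro z hz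
    have h := hconv.norm_image_sub_le_of_norm_hasDerivWithin_le (f := fun z => deriv g z - z)
      (f' := fun z => deriv (deriv g) z - 1) (C := c)
      (fun w _ => ((hg.hasDerivAt_deriv w).sub (hasDerivAt_id w)).hasDerivWithinAt)
      (fun w hw => by simpa [Real.dist_eq] using (hb (hsub w hw)).le) hvm hz
    rw [Real.norm_eq_abs, Real.norm_eq_abs] at h
    rw [Metric.mem_closedBall, Real.dist_eq] at hz
    calc _ = |deriv g z - z - (deriv g v - v)| := by congr 1; ring
      _ ≤ c * |z - v| := h
      _ ≤ _ := by gcongr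
  have hvy : v - y ∈ Metric.closedBall v |y| := by
    rw [Metric.mem_closedBall, Real.dist_eq]
    simp
  have h2 := hconv.norm_image_sub_le_of_norm_hasDerivWithin_le
    (f := fun z => g z - (deriv g v * (z - v) + (z - v) ^ 2 / 2))
    (f' := fun z => deriv g z - deriv g v - (z - v)) (C := c * |y|)
    (fun w _ => by
      have := (hg.hasDerivAt w).sub ((((hasDerivAt_id w).sub_const v).const_mul (deriv g v)).add
        ((((hasDerivAt_id w).sub_const v).pow 2).div_const 2))
      refine (this.congr_deriv ?_).hasDerivWithinAt
      simp
      ring) h1 hvm hvy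
  rw [Real.norm_eq_abs, Real.norm_eq_abs, show v - y - v = -y by ring, abs_neg] at h2
  rw [Real.norm_eq_abs, norm_pow, Real.norm_eq_abs]
  calc _ = |g (v - y) - (deriv g v * -y + (-y) ^ 2 / 2) -
        (g v - (deriv g v * (v - v) + (v - v) ^ 2 / 2))| := by congr 1; ring
    _ ≤ _ := h2
    _ = _ := by ring

end IsPhase

/-- The precision `1 / γ²` at `t = x exp (-v)`, for `η² = x ε²`. -/
noncomputable def windowPrec (ε v : ℝ) : ℝ := 1 + Real.exp (-v) / ε ^ 2

/-- The kernel in the logarithmic variable `v = log (x / t)`, up to a factor `x`. -/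
noncomputable def windowKernel (g : ℝ → ℝ) (lam ε v : ℝ) : ℝ :=
  phaseNorm g (windowPrec ε v) *
    Real.exp (-(windowPrec ε v * g (v - Real.log (1 + lam * (windowPrec ε v)⁻¹))))

theorem abs_log_one_add_sub_le {y : ℝ} (hy : |y| ≤ 1 / 2) : |Real.log (1 + y) - y| ≤ 2 * y ^ 2 := by
  have hy' := abs_le.1 hy
  have hpos : 0 < 1 + y := by linarith
  have h1 := Real.log_le_sub_one_of_pos hpos
  have h2 := Real.one_sub_inv_le_log_of_pos hpos
  have h3 : y - 2 * y ^ 2 ≤ 1 - (1 + y)⁻¹ := by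
    rw [le_sub_iff_add_le, ← le_sub_iff_add_le', inv_le_comm₀ hpos] <;>
      [skip; nlinarith]
    rw [inv_le_comm₀ (by nlinarith) hpos, inv_eq_one_div, div_le_iff₀ hpos]
    nlinarith [mul_nonneg (sq_nonneg y) (by linarith : 0 ≤ 1 + 2 * y)]
  rw [abs_le]
  constructor <;> nlinarith [sq_nonneg y]

theorem windowPrec_pos (ε v : ℝ) : 0 < windowPrec ε v := by
  rw [windowPrec]; positivity

/-- The bracket is a product of three factors 1 + O(ε²). The ratio of √N to its leading part
e^(-v/2)/ε gives 1/2, the correction to `phaseNorm` gives the middle term, and the shift by log ν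
gives -lam²/2. The product filter makes the expansion uniform: a window in v can be fixed before ε
tends to 0. -/
theorem windowKernel_expansion {g : ℝ → ℝ} {κ : ℝ} (hg : IsPhase g κ) (lam : ℝ) :
    Tendsto (fun p : ℝ × ℝ =>
      (windowKernel g lam p.1 p.2 * Real.exp (-p.2) * (p.1 * Real.sqrt (2 * Real.pi)) *
        Real.exp (Real.exp (-p.2) * g p.2 / p.1 ^ 2) *
        Real.exp (3 / 2 * p.2 + g p.2 - lam * deriv g p.2) - 1) / p.1 ^ 2)
      (𝓝[>] 0 ×ˢ 𝓝 0)
      (𝓝 (1 / 2 - (15 * (κ / 6) ^ 2 / 2 - 3 * quarticCoeff g) - lam ^ 2 / 2)) := by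
  set l : Filter (ℝ × ℝ) := 𝓝[>] 0 ×ˢ 𝓝 0 with hl
  set q := Real.sqrt (2 * Real.pi) with hq
  have hpos : ∀ᶠ p : ℝ × ℝ in l, 0 < p.1 :=
    tendsto_fst.eventually (self_mem_nhdsWithin : Ioi (0 : ℝ) ∈ 𝓝[>] 0)
  have hε : Tendsto (fun p : ℝ × ℝ => p.1) l (𝓝 0) :=
    (tendsto_nhdsWithin_of_tendsto_nhds tendsto_id).comp tendsto_fst
  have hv : Tendsto (fun p : ℝ × ℝ => p.2) l (𝓝 0) := tendsto_snd
  have hε2 : Tendsto (fun p : ℝ × ℝ => p.1 ^ 2) l (𝓝 0) := by simpa using hε.pow 2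
  have hε0 : ∀ᶠ p : ℝ × ℝ in l, p.1 ^ 2 ≠ 0 := hpos.mono fun p hp => by positivity
  have hev : Tendsto (fun p : ℝ × ℝ => Real.exp p.2) l (𝓝 1) := by
    have := (Real.continuous_exp.tendsto 0).comp hv
    rwa [Real.exp_zero] at this
  set u : ℝ × ℝ → ℝ := fun p => p.1 ^ 2 * Real.exp p.2 with hu
  have hu0 : Tendsto u l (𝓝 0) := by simpa using hε2.mul hev
  have hupos : ∀ᶠ p in l, 0 < u p := hpos.mono fun p hp => by simp only [hu]; positivity
  -- With u = ε² e^v the precision is N = (1 + u)/u, so √(1 + u) is √N ε e^(v/2).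
  have hsqrt : Tendsto (fun p => (Real.sqrt (1 + u p) - 1) / p.1 ^ 2) l (𝓝 (1 / 2)) := by
    have h1 : Tendsto (fun p => Real.sqrt (1 + u p) + 1) l (𝓝 (Real.sqrt (1 + 0) + 1)) :=
      ((Real.continuous_sqrt.tendsto _).comp (hu0.const_add 1)).add_const 1
    have h2 := hev.div h1 (by positivity)
    rw [add_zero, Real.sqrt_one, one_add_one_eq_two] at h2
    refine h2.congr' ?_
    filter_upwards [hpos, hupos] with p hp hup
    have hs : Real.sqrt (1 + u p) ^ 2 = 1 + u p := Real.sq_sqrt (by positivity)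
    have h3 : 0 < Real.sqrt (1 + u p) := Real.sqrt_pos.2 (by positivity)
    rw [Pi.div_apply, div_eq_div_iff (by positivity) (by positivity)]
    have : u p = p.1 ^ 2 * Real.exp p.2 := rfl
    nlinarith
  set s : ℝ × ℝ → ℝ := fun p => Real.sqrt (u p / (1 + u p)) with hs
  have hs2 : ∀ᶠ p in l, s p ^ 2 = u p / (1 + u p) :=
    hupos.mono fun p hp => Real.sq_sqrt (by positivity)
  have hspos : ∀ᶠ p in l, 0 < s p := hupos.mono fun p hp => Real.sqrt_pos.2 (by positivity)
  have hs0 : Tendsto s l (𝓝[>] 0) := by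
    refine tendsto_nhdsWithin_iff.2 ⟨?_, hspos⟩
    have h1 := hu0.div (hu0.const_add 1) (by norm_num)
    have h2 := (Real.continuous_sqrt.tendsto _).comp h1
    simp only [add_zero, zero_div, Real.sqrt_zero] at h2
    exact h2
  have hsε : Tendsto (fun p => s p ^ 2 / p.1 ^ 2) l (𝓝 1) := by
    have h1 := hev.div (hu0.const_add 1) (by norm_num)
    rw [add_zero, div_one] at h1
    refine h1.congr' ?_
    filter_upwards [hs2, hpos, hupos] with p h2 hp hup
    rw [h2]
    simp only [hu, Pi.div_apply]
    field_simp
  have hN : ∀ᶠ p in l, windowPrec p.1 p.2 = (s p ^ 2)⁻¹ := by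
    filter_upwards [hs2, hpos] with p h2 hp
    rw [h2, windowPrec, Real.exp_neg]
    simp only [hu]
    field_simp
    ring
  have hB : Tendsto (fun p => (q * s p * phaseNorm g (s p ^ 2)⁻¹ - 1) / p.1 ^ 2) l
      (𝓝 (-(15 * (κ / 6) ^ 2 / 2 - 3 * quarticCoeff g))) := by
    have h := (hg.phaseNorm_expansion.comp hs0).mul hsε
    rw [mul_one] at h
    refine h.congr' ?_
    filter_upwards [hspos, hpos] with p h1 h2
    simp only [Function.comp_apply, ← hq]
    generalize phaseNorm g (s p ^ 2)⁻¹ = K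
    field_simp
  set ell : ℝ × ℝ → ℝ := fun p => Real.log (1 + lam * s p ^ 2) with hell
  have hs00 : Tendsto s l (𝓝 0) := hs0.mono_right nhdsWithin_le_nhds
  have hy0 : Tendsto (fun p => lam * s p ^ 2) l (𝓝 0) := by simpa using (hs00.pow 2).const_mul lam
  have hlog : ∀ᶠ p in l, |ell p - lam * s p ^ 2| ≤ 2 * (lam * s p ^ 2) ^ 2 := by
    have := hy0.eventually (Metric.closedBall_mem_nhds (0 : ℝ) (by norm_num : (0 : ℝ) < 1 / 2))
    filter_upwards [this] with p hp
    refine abs_log_one_add_sub_le ?_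
    simpa [Real.dist_eq] using hp
  have hNl : Tendsto (fun p => ell p / s p ^ 2) l (𝓝 lam) := by
    rw [tendsto_iff_norm_sub_tendsto_zero]
    have h0 : Tendsto (fun p => 2 * lam ^ 2 * s p ^ 2) l (𝓝 0) := by
      simpa using (hs00.pow 2).const_mul (2 * lam ^ 2)
    refine squeeze_zero' (Eventually.of_forall fun p => norm_nonneg _) ?_ h0
    filter_upwards [hlog, hspos] with p hp hsp
    have e : ell p / s p ^ 2 - lam = (ell p - lam * s p ^ 2) / s p ^ 2 := by field_simp
    rw [e, Real.norm_eq_abs, abs_div, abs_of_pos (by positivity : 0 < s p ^ 2),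
      div_le_iff₀ (by positivity)]
    exact hp.trans (le_of_eq (by ring))
  have hell0 : Tendsto ell l (𝓝 0) := by
    have h := hNl.mul (hs00.pow 2)
    rw [show lam * (0 : ℝ) ^ 2 = 0 by ring] at h
    refine h.congr' ?_
    filter_upwards [hspos] with p hp
    field_simp
  have hd1 : Tendsto (fun p : ℝ × ℝ => deriv g p.2) l (𝓝 0) := by
    have := (hg.contDiff_deriv.continuous.tendsto 0).comp hv
    rwa [hg.deriv_zero] at this
  -- With ℓ = log ν, N(g(v - ℓ) - g(v)) + lam g'(v) is split into the second-order remainder, Nℓ²/2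
  -- and (lam - Nℓ) g'(v). Only the middle piece survives division by ε²: in the last, lam - Nℓ =
  -- O(ε²) and g'(v) → 0.
  have hD1 : Tendsto (fun p => (g (p.2 - ell p) - g p.2 + ell p * deriv g p.2 - ell p ^ 2 / 2) *
      (s p ^ 2)⁻¹ / p.1 ^ 2) l (𝓝 0) := by
    have hpair : Tendsto (fun p : ℝ × ℝ => (p.2, ell p)) l (𝓝 (0, 0)) := hv.prodMk_nhds hell0
    have h1 := hg.second_difference.comp_tendsto hpair
    have h2 : (fun p => ell p ^ 2 * ((s p ^ 2)⁻¹ / p.1 ^ 2)) =O[l] fun _ => (1 : ℝ) := by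
      have h3 := (hNl.pow 2).mul hsε
      refine IsBigO.congr' (h3.isBigO_one ℝ) ?_ EventuallyEq.rfl
      filter_upwards [hspos, hpos] with p h4 h5
      field_simp
    have h4 := (h1.mul_isBigO (isBigO_refl (fun p => (s p ^ 2)⁻¹ / p.1 ^ 2) l)).trans_isBigO h2
    refine ((isLittleO_one_iff ℝ).1 h4).congr fun p => ?_
    simp only [Function.comp_apply]
    ring
  have hD2 : Tendsto (fun p => ell p ^ 2 / 2 * (s p ^ 2)⁻¹ / p.1 ^ 2) l (𝓝 (lam ^ 2 / 2)) := by
    have h3 := ((hNl.pow 2).mul hsε).div_const 2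
    rw [mul_one] at h3
    refine h3.congr' ?_
    filter_upwards [hspos, hpos] with p h4 h5
    field_simp
  have hD3 : Tendsto (fun p => (lam - ell p * (s p ^ 2)⁻¹) / p.1 ^ 2 * deriv g p.2) l (𝓝 0) := by
    have h1 : (fun p => (lam - ell p * (s p ^ 2)⁻¹) / p.1 ^ 2) =O[l] fun _ => (1 : ℝ) := by
      have h2 : (fun p => (lam - ell p * (s p ^ 2)⁻¹) / p.1 ^ 2) =O[l]
          fun p => s p ^ 2 / p.1 ^ 2 := by
        refine IsBigO.of_bound (2 * lam ^ 2) ?_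
        filter_upwards [hlog, hspos, hpos] with p hp hsp hpp
        have e : (lam - ell p * (s p ^ 2)⁻¹) / p.1 ^ 2 =
            -(ell p - lam * s p ^ 2) / (s p ^ 2 * p.1 ^ 2) := by field_simp; ring
        rw [e, Real.norm_eq_abs, Real.norm_eq_abs, abs_div, abs_neg,
          abs_of_pos (by positivity : 0 < s p ^ 2 * p.1 ^ 2),
          abs_of_pos (by positivity : 0 < s p ^ 2 / p.1 ^ 2), div_le_iff₀ (by positivity)]
        refine hp.trans (le_of_eq ?_)
        field_simp
      exact h2.trans (hsε.isBigO_one ℝ)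
    have h3 := h1.mul_isLittleO ((isLittleO_one_iff ℝ).2 hd1)
    rw [one_mul] at h3
    exact (isLittleO_one_iff ℝ).1 h3
  have hD : Tendsto (fun p => -((g (p.2 - ell p) - g p.2) * (s p ^ 2)⁻¹ + lam * deriv g p.2) /
      p.1 ^ 2) l (𝓝 (-(lam ^ 2 / 2))) := by
    have h := ((hD1.add hD2).add hD3).neg
    rw [zero_add, add_zero] at h
    refine h.congr fun p => ?_
    ring
  have hfin := tendsto_mul_sub_one_div (tendsto_mul_sub_one_div hsqrt hB hε2 hε0)
    (tendsto_exp_sub_one_div hD hε2 hε0) hε2 hε0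
  have hconst : 1 / 2 + -(15 * (κ / 6) ^ 2 / 2 - 3 * quarticCoeff g) + -(lam ^ 2 / 2) =
      1 / 2 - (15 * (κ / 6) ^ 2 / 2 - 3 * quarticCoeff g) - lam ^ 2 / 2 := by ring
  rw [hconst] at hfin
  refine hfin.congr' ?_
  filter_upwards [hN, hspos, hpos, hupos, hs2] with p hNp hsp hpp hup hs2p
  congr 2
  rw [windowKernel, hNp, inv_inv]
  have hA : Real.sqrt (1 + u p) = p.1 / s p * Real.exp (p.2 / 2) := by
    rw [← Real.sqrt_sq (by positivity : 0 ≤ p.1 / s p * Real.exp (p.2 / 2))]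
    congr 1
    rw [mul_pow, div_pow, hs2p, ← Real.exp_nat_mul]
    have : Real.exp ((2 : ℕ) * (p.2 / 2)) = Real.exp p.2 := by congr 1; push_cast; ring
    rw [this]
    simp only [hu]
    field_simp
  -- The summand 1 of the precision leaves a factor exp(-g(v)) that does not depend on ε and joins
  -- the weight.
  have hNg : (s p ^ 2)⁻¹ * g p.2 = g p.2 + Real.exp (-p.2) * g p.2 / p.1 ^ 2 := by
    rw [← hNp, windowPrec]; ring
  have hE : Real.exp (-((g (p.2 - ell p) - g p.2) * (s p ^ 2)⁻¹ + lam * deriv g p.2)) *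
      Real.exp (p.2 / 2) =
      Real.exp (-((s p ^ 2)⁻¹ * g (p.2 - ell p))) * Real.exp (-p.2) *
        Real.exp (Real.exp (-p.2) * g p.2 / p.1 ^ 2) *
        Real.exp (3 / 2 * p.2 + g p.2 - lam * deriv g p.2) := by
    rw [← Real.exp_add, ← Real.exp_add, ← Real.exp_add, ← Real.exp_add]
    congr 1
    linear_combination hNg
  rw [hA]
  have hne : s p ≠ 0 := hsp.ne'
  calc p.1 / s p * Real.exp (p.2 / 2) * (q * s p * phaseNorm g (s p ^ 2)⁻¹) *
        Real.exp (-((g (p.2 - ell p) - g p.2) * (s p ^ 2)⁻¹ + lam * deriv g p.2))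
      = phaseNorm g (s p ^ 2)⁻¹ * p.1 * q * (Real.exp (-((g (p.2 - ell p) - g p.2) *
        (s p ^ 2)⁻¹ + lam * deriv g p.2)) * Real.exp (p.2 / 2)) := by
        field_simp
    _ = _ := by rw [hE]; ring

end Window

/-! ### First and second moments of the kernel in a window. -/

section WindowIntegrals

theorem isLittleO_sq_of_hasDerivAt {F F1 : ℝ → ℝ} {c : ℝ}
    (h1 : ∀ᶠ v in 𝓝 0, HasDerivAt F (F1 v) v) (h2 : HasDerivAt F1 c 0) :
    (fun v => F v - (F 0 + F1 0 * v + c / 2 * v ^ 2)) =o[𝓝 0] fun v => v ^ 2 := by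
  rw [isLittleO_iff]
  intro e he
  have h3 := h2.isLittleO.def he
  obtain ⟨r, hr, hb⟩ := Metric.eventually_nhds_iff_ball.1 (h1.and h3)
  filter_upwards [Metric.ball_mem_nhds (0 : ℝ) hr] with v hv
  have hv' : |v| < r := by simpa [Real.dist_eq] using hv
  have hsub : ∀ z ∈ Metric.closedBall (0 : ℝ) |v|, z ∈ Metric.ball (0 : ℝ) r := by
    intro z hz
    exact lt_of_le_of_lt (Metric.mem_closedBall.1 hz) hv'
  have h := (convex_closedBall (0 : ℝ) |v|).norm_image_sub_le_of_norm_hasDerivWithin_le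
    (f := fun z => F z - (F 0 + F1 0 * z + c / 2 * z ^ 2))
    (f' := fun z => F1 z - (F1 0 + c * z)) (C := e * |v|) (x := 0) (y := v)
    (fun z hz => by
      have := (hb z (hsub z hz)).1.sub ((((hasDerivAt_id z).const_mul (F1 0)).const_add (F 0)).add
        (((hasDerivAt_id z).pow 2).const_mul (c / 2)))
      refine (this.congr_deriv ?_).hasDerivWithinAt
      simp
      ring)
    (fun z hz => by
      have h4 := (hb z (hsub z hz)).2
      simp only [sub_zero, smul_eq_mul] at h4
      have hz' : |z| ≤ |v| := by simpa [Real.dist_eq] using hz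
      calc ‖F1 z - (F1 0 + c * z)‖ = ‖F1 z - F1 0 - z * c‖ := by congr 1; ring
        _ ≤ e * ‖z‖ := h4
        _ ≤ _ := by rw [Real.norm_eq_abs]; gcongr)
    (Metric.mem_closedBall_self (abs_nonneg v)) (by simp)
  rw [norm_pow]
  have e1 : F 0 - (F 0 + F1 0 * 0 + c / 2 * 0 ^ 2) = 0 := by ring
  simp only [e1, sub_zero] at h
  calc _ ≤ _ := h
    _ = _ := by rw [Real.norm_eq_abs]; ring

theorem tendsto_div_sq_of_abs_le {I : ℝ → ℝ} {a b C : ℝ}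
    (h : ∀ ε, 0 < ε → ε ≤ 1 → |I ε - (a + ε ^ 2 * b)| ≤ C * ε ^ 3) :
    Tendsto (fun ε => (I ε - a) / ε ^ 2) (𝓝[>] 0) (𝓝 b) := by
  rw [tendsto_iff_norm_sub_tendsto_zero]
  have h0 : Tendsto (fun ε : ℝ => C * ε) (𝓝[>] 0) (𝓝 0) := by
    have := (tendsto_nhdsWithin_of_tendsto_nhds (s := Ioi (0 : ℝ)) (a := 0) tendsto_id).const_mul C
    simpa using this
  refine squeeze_zero' (Eventually.of_forall fun _ => norm_nonneg _) ?_ h0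
  filter_upwards [Ioo_mem_nhdsGT (one_pos : (0 : ℝ) < 1)] with ε hε
  obtain ⟨hε0, hε1⟩ := hε
  have e : (I ε - a) / ε ^ 2 - b = (I ε - (a + ε ^ 2 * b)) / ε ^ 2 := by field_simp; ring
  rw [e, Real.norm_eq_abs, abs_div, abs_of_pos (by positivity : 0 < ε ^ 2),
    div_le_iff₀ (by positivity)]
  exact (h ε hε0 hε1.le).trans (le_of_eq (by ring))

/-- `laplace_expansion` as limits. -/
theorem laplace_tendsto {φ : ℝ → ℝ} {a b : ℝ} (hc : Continuous φ)
    (h : (fun v => φ v - (v ^ 2 / 2 + a * v ^ 3 + b * v ^ 4)) =O[𝓝 0] fun v => v ^ 5) :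
    ∃ δ₀, 0 < δ₀ ∧ ∀ δ, 0 < δ → δ ≤ δ₀ →
      Tendsto (fun ε : ℝ => ((ε * Real.sqrt (2 * Real.pi))⁻¹ *
        (∫ v in Icc (-δ) δ, Real.exp (-(φ v / ε ^ 2))) - 1) / ε ^ 2) (𝓝[>] 0)
        (𝓝 (15 * a ^ 2 / 2 - 3 * b)) ∧
      Tendsto (fun ε : ℝ => ((ε * Real.sqrt (2 * Real.pi))⁻¹ *
        (∫ v in Icc (-δ) δ, v * Real.exp (-(φ v / ε ^ 2)))) / ε ^ 2) (𝓝[>] 0) (𝓝 (-3 * a)) ∧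
      Tendsto (fun ε : ℝ => ((ε * Real.sqrt (2 * Real.pi))⁻¹ *
        (∫ v in Icc (-δ) δ, v ^ 2 * Real.exp (-(φ v / ε ^ 2)))) / ε ^ 2) (𝓝[>] 0) (𝓝 1) := by
  obtain ⟨C, δ₀, hC, hδ₀, hδ1, hw⟩ := exists_window h
  refine ⟨δ₀, hδ₀, fun δ hδ hδ' => ?_⟩
  obtain ⟨C', hC', hL⟩ := laplace_expansion hδ (hδ'.trans hδ1) hC hc
    (fun v hv => (hw v (hv.trans hδ')).1) (fun v hv => (hw v (hv.trans hδ')).2.1)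
  refine ⟨tendsto_div_sq_of_abs_le fun ε h1 h2 => (hL ε h1 h2).1, ?_, ?_⟩
  · have := tendsto_div_sq_of_abs_le (a := 0) (b := -3 * a) (C := C') fun ε h1 h2 => by
      have := (hL ε h1 h2).2.1
      rwa [zero_add, mul_comm (ε ^ 2)]
    simpa only [sub_zero] using this
  · have := tendsto_div_sq_of_abs_le (a := 0) (b := 1) (C := C') fun ε h1 h2 => by
      have := (hL ε h1 h2).2.2
      rwa [zero_add, mul_one]
    simpa only [sub_zero] using this

theorem measurable_phaseNorm {g : ℝ → ℝ} (hg : Continuous g) : Measurable (phaseNorm g) := by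
  have h : StronglyMeasurable (Function.uncurry fun (N v : ℝ) => Real.exp (-(N * g v))) :=
    (Continuous.stronglyMeasurable (by unfold Function.uncurry; fun_prop))
  exact (h.integral_prod_right (ν := volume)).measurable.inv

theorem measurable_windowKernel {g : ℝ → ℝ} (hg : Continuous g) (lam ε : ℝ) :
    Measurable (windowKernel g lam ε) := by
  have h1 : Measurable (windowPrec ε) := by unfold windowPrec; fun_prop
  have h2 := (measurable_phaseNorm hg).comp h1
  have h3 := hg.measurable.comp (measurable_id.sub
    (Real.measurable_log.comp ((h1.inv.const_mul lam).const_add 1)))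
  exact h2.mul (Real.measurable_exp.comp ((h1.mul h3).neg))

theorem one_le_windowPrec (ε v : ℝ) : 1 ≤ windowPrec ε v := by
  rw [windowPrec]
  have : 0 ≤ Real.exp (-v) / ε ^ 2 := by positivity
  linarith

theorem windowKernel_pos {g : ℝ → ℝ} {κ : ℝ} (hg : IsPhase g κ) (lam ε v : ℝ) :
    0 < windowKernel g lam ε v :=
  mul_pos (hg.phaseNorm_pos (one_le_windowPrec ε v)) (Real.exp_pos _)

theorem exists_windowKernel_le {g : ℝ → ℝ} {κ : ℝ} (hg : IsPhase g κ) (lam ε δ : ℝ) :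
    ∃ B, ∀ v ∈ Icc (-δ) δ, windowKernel g lam ε v ≤ B := by
  obtain ⟨C, hC, h⟩ := hg.exists_phaseNorm_le
  refine ⟨C * Real.sqrt (1 + Real.exp δ / ε ^ 2), fun v hv => ?_⟩
  have h1 : windowPrec ε v ≤ 1 + Real.exp δ / ε ^ 2 := by
    rw [windowPrec]
    have : Real.exp (-v) ≤ Real.exp δ := Real.exp_le_exp.2 (by linarith [hv.1])
    gcongr
  have h2 : Real.exp (-(windowPrec ε v * g (v - Real.log (1 + lam * (windowPrec ε v)⁻¹)))) ≤ 1 :=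
    Real.exp_le_one_iff.2 (neg_nonpos.2 (mul_nonneg (windowPrec_pos ε v).le (hg.nonneg _)))
  have hK := hg.phaseNorm_pos (one_le_windowPrec ε v)
  calc windowKernel g lam ε v ≤ phaseNorm g (windowPrec ε v) * 1 := by
        rw [windowKernel]; gcongr
    _ ≤ C * Real.sqrt (windowPrec ε v) := by
        rw [mul_one]; exact h _ (one_le_windowPrec ε v)
    _ ≤ _ := by gcongr

theorem continuousOn_comp_mul_exp_neg {f : ℝ → ℝ} {x : ℝ} (hx : 0 < x)
    (hf : ContDiffOn ℝ 2 f (Ioi 0)) : Continuous fun v => f (x * Real.exp (-v)) :=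
  hf.continuousOn.comp_continuous (by fun_prop) fun v => mul_pos hx (Real.exp_pos _)

theorem integrableOn_windowKernel_pow {g : ℝ → ℝ} {κ : ℝ} (hg : IsPhase g κ) (lam ε δ : ℝ)
    {f : ℝ → ℝ} {x : ℝ} (hx : 0 < x) (hf : ContDiffOn ℝ 2 f (Ioi 0)) (k : ℕ) :
    IntegrableOn (fun v => f (x * Real.exp (-v)) * (windowKernel g lam ε v ^ k * Real.exp (-v)))
      (Icc (-δ) δ) := by
  obtain ⟨B, hB⟩ := exists_windowKernel_le hg lam ε δ
  have h1 : IntegrableOn (fun v => f (x * Real.exp (-v)) * Real.exp (-v)) (Icc (-δ) δ) :=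
    ((continuousOn_comp_mul_exp_neg hx hf).mul (by fun_prop)).continuousOn.integrableOn_compact
      isCompact_Icc
  have h2 := Integrable.bdd_mul (c := B ^ k) h1
    ((measurable_windowKernel hg.continuous lam ε).pow_const k).aestronglyMeasurable
    ((ae_restrict_iff' measurableSet_Icc).2 (Eventually.of_forall fun v hv => by
      rw [Real.norm_eq_abs, abs_of_pos (pow_pos (windowKernel_pos hg lam ε v) k)]
      exact pow_le_pow_left₀ (windowKernel_pos hg lam ε v).le (hB v hv) k))
  refine h2.congr (Eventually.of_forall fun v => ?_)
  simp only
  ring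

/-- The weight collects the factors of the kernel that do not depend on ε: e^(-v/2) from √N, e^(-v)
from the Jacobian, e^(-g) from the unit part of N and e^(lam g') from the shift. -/
theorem weightedDensity_expansion {g : ℝ → ℝ} {κ : ℝ} (hg : IsPhase g κ) (lam : ℝ)
    {f : ℝ → ℝ} {x : ℝ} (hx : 0 < x) (hf : ContDiffOn ℝ 2 f (Ioi 0)) :
    (fun v => f (x * Real.exp (-v)) * Real.exp (-(3 / 2 * v) - g v + lam * deriv g v) -
      (f x + (f x * (lam - 3 / 2) - x * deriv f x) * v +
        (f x * (lam * κ - 1 + (lam - 3 / 2) ^ 2) - 2 * x * deriv f x * (lam - 3 / 2) +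
          x * deriv f x + x ^ 2 * deriv (deriv f) x) / 2 * v ^ 2)) =o[𝓝 0] fun v => v ^ 2 := by
  have hopen : ∀ t : ℝ, 0 < t → ContDiffAt ℝ 2 f t := fun t ht =>
    hf.contDiffAt (Ioi_mem_nhds ht)
  have hf1 : ∀ t : ℝ, 0 < t → HasDerivAt f (deriv f t) t := fun t ht =>
    ((hopen t ht).differentiableAt (by norm_num)).hasDerivAt
  have hf2 : HasDerivAt (deriv f) (deriv (deriv f) x) x := by
    have h1 : ContDiffOn ℝ 1 (deriv f) (Ioi 0) :=
      ((contDiffOn_succ_iff_deriv_of_isOpen isOpen_Ioi).1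
        (show ContDiffOn ℝ (1 + 1) f (Ioi 0) from hf)).2.2
    exact ((h1.contDiffAt (Ioi_mem_nhds hx)).differentiableAt (by norm_num)).hasDerivAt
  have ht : ∀ v : ℝ, HasDerivAt (fun v => x * Real.exp (-v)) (-(x * Real.exp (-v))) v := by
    intro v
    refine (((hasDerivAt_id v).neg.exp).const_mul x).congr_deriv ?_
    simp
  have hfx : ∀ v : ℝ, HasDerivAt (fun v => f (x * Real.exp (-v)))
      (deriv f (x * Real.exp (-v)) * -(x * Real.exp (-v))) v := fun v =>
    (hf1 _ (mul_pos hx (Real.exp_pos _))).comp v (ht v)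
  have hE : ∀ v : ℝ, HasDerivAt (fun v => -(3 / 2 * v) - g v + lam * deriv g v)
      (-(3 / 2) - deriv g v + lam * deriv (deriv g) v) v := by
    intro v
    refine (((((hasDerivAt_id v).const_mul (3 / 2 : ℝ)).neg).sub (hg.hasDerivAt v)).add
      ((hg.hasDerivAt_deriv v).const_mul lam)).congr_deriv ?_
    simp
  have h := isLittleO_sq_of_hasDerivAt (Eventually.of_forall fun v => (hfx v).mul (hE v).exp)
    (c := f x * (lam * κ - 1 + (lam - 3 / 2) ^ 2) - 2 * x * deriv f x * (lam - 3 / 2) +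
          x * deriv f x + x ^ 2 * deriv (deriv f) x) (by
      have hE2 : HasDerivAt (fun v => -(3 / 2) - deriv g v + lam * deriv (deriv g) v)
          (-deriv (deriv g) 0 + lam * deriv (deriv (deriv g)) 0) 0 := by
        refine (((hg.hasDerivAt_deriv 0).const_sub (-(3 / 2 : ℝ))).add
          ((hg.hasDerivAt_deriv2 0).const_mul lam)).congr_deriv ?_
        simp
      have hf2' : HasDerivAt (deriv f) (deriv (deriv f) x) (x * Real.exp (-0)) := by
        simpa using hf2
      have h1 := ((hf2'.comp (0 : ℝ) (ht 0)).mul (ht 0).neg).mul (hE 0).exp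
      have h2 := (hfx 0).mul ((hE 0).exp.mul hE2)
      refine (h1.add h2).congr_deriv ?_
      simp [hg.zero, hg.deriv_zero, hg.deriv2_zero, hg.deriv3_zero]
      ring)
  refine h.congr_left fun v => ?_
  simp only [Pi.mul_apply, hg.zero, hg.deriv_zero, hg.deriv2_zero, mul_zero, neg_zero, sub_zero,
    add_zero, Real.exp_zero, mul_one, one_mul]
  ring

/-- Pairs of mutually inverse factors are inserted so that the last factor is the quantity expanded
in `windowKernel_expansion`. -/
theorem windowKernel_mul_exp_neg_eq {g : ℝ → ℝ} {lam ε v : ℝ} (hε : 0 < ε) :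
    windowKernel g lam ε v * Real.exp (-v) =
      (ε * Real.sqrt (2 * Real.pi))⁻¹ * Real.exp (-(Real.exp (-v) * g v / ε ^ 2)) *
        Real.exp (-(3 / 2 * v) - g v + lam * deriv g v) *
        (windowKernel g lam ε v * Real.exp (-v) * (ε * Real.sqrt (2 * Real.pi)) *
          Real.exp (Real.exp (-v) * g v / ε ^ 2) *
          Real.exp (3 / 2 * v + g v - lam * deriv g v)) := by
  have hq : 0 < Real.sqrt (2 * Real.pi) := Real.sqrt_pos.2 (by positivity)
  have h1 : Real.exp (-(Real.exp (-v) * g v / ε ^ 2)) *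
      Real.exp (Real.exp (-v) * g v / ε ^ 2) = 1 := by
    rw [← Real.exp_add, neg_add_cancel, Real.exp_zero]
  have h2 : Real.exp (-(3 / 2 * v) - g v + lam * deriv g v) *
      Real.exp (3 / 2 * v + g v - lam * deriv g v) = 1 := by
    rw [← Real.exp_add, ← Real.exp_zero]
    congr 1
    ring
  have h3 : (ε * Real.sqrt (2 * Real.pi))⁻¹ * (ε * Real.sqrt (2 * Real.pi)) = 1 :=
    inv_mul_cancel₀ (by positivity)
  calc _ = windowKernel g lam ε v * Real.exp (-v) * 1 * 1 * 1 := by ring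
    _ = _ := by
      nth_rewrite 1 [← h1, ← h2, ← h3]
      ring

/-- The bias of the kernel estimator in a window around `x`. -/
theorem exists_window_mean {g : ℝ → ℝ} {κ : ℝ} (hg : IsPhase g κ) {f : ℝ → ℝ} {x : ℝ} (hx : 0 < x)
    (hf : ContDiffOn ℝ 2 f (Ioi 0)) {ρ : ℝ} (hρ : 0 < ρ) :
    ∃ δ₁, 0 < δ₁ ∧ ∀ δ, 0 < δ → δ ≤ δ₁ → ∀ᶠ ε in 𝓝[>] 0,
      |(∫ v in Icc (-δ) δ, f (x * Real.exp (-v)) *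
          (windowKernel g ((1 + κ) / 2) ε v * Real.exp (-v))) -
        f x - ε ^ 2 * (x ^ 2 * deriv (deriv f) x / 2)| ≤ ρ * ε ^ 2 := by
  set lam := (1 + κ) / 2 with hlam
  have hT := weightedDensity_expansion hg lam hx hf
  have hR := windowKernel_expansion hg lam
  obtain ⟨δ₀, hδ₀, hL⟩ := laplace_tendsto (φ := fun v => Real.exp (-v) * g v)
    (by have := hg.continuous; fun_prop) hg.taylor_exp_mul
  set c := 1 / 2 - (15 * (κ / 6) ^ 2 / 2 - 3 * quarticCoeff g) - lam ^ 2 / 2 with hc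
  set T : ℝ → ℝ := fun v =>
    f (x * Real.exp (-v)) * Real.exp (-(3 / 2 * v) - g v + lam * deriv g v) with hTdef
  set T1 := f x * (lam - 3 / 2) - x * deriv f x with hT1
  set T2 := (f x * (lam * κ - 1 + (lam - 3 / 2) ^ 2) - 2 * x * deriv f x * (lam - 3 / 2) +
          x * deriv f x + x ^ 2 * deriv (deriv f) x) / 2 with hT2
  set q : ℝ → ℝ := fun ε => (ε * Real.sqrt (2 * Real.pi))⁻¹ with hq
  set A : ℝ → ℝ → ℝ := fun ε v => Real.exp (-(Real.exp (-v) * g v / ε ^ 2)) with hA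
  set R : ℝ → ℝ → ℝ := fun ε v => windowKernel g lam ε v * Real.exp (-v) *
    (ε * Real.sqrt (2 * Real.pi)) * Real.exp (Real.exp (-v) * g v / ε ^ 2) *
    Real.exp (3 / 2 * v + g v - lam * deriv g v) with hRdef
  have hTc : Continuous T := by
    have h1 := continuousOn_comp_mul_exp_neg hx hf
    have h2 := hg.continuous
    have h3 := hg.contDiff_deriv.continuous
    exact h1.mul (by fun_prop)
  have hT0 : T 0 = f x := by simp [hTdef, hg.zero, hg.deriv_zero]
  set B := |f x| + 1 with hB
  have hB0 : 0 < B := by positivity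
  -- The two pointwise errors, e v² from the weight and e ε² from the kernel, are integrated with
  -- the bounds J2 ≤ 2ε² and J0 ≤ 2 below; `D` is their total cost.
  set D := 2 * (1 + |c|) + 2 * B with hD
  have hD0 : 0 < D := by positivity
  set e := ρ / 2 / D with he
  have he0 : 0 < e := by positivity
  have hTB : ∀ᶠ v in 𝓝 0, |T v| ≤ B := by
    have := (hTc.tendsto 0).abs.eventually_lt_const (u := B) (by rw [hT0, hB]; linarith)
    exact this.mono fun v hv => le_of_lt hv
  have hTe := hT.def he0
  have hRe := hR.eventually (Metric.closedBall_mem_nhds c he0)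
  -- The joint limit separates into a condition on ε and one on v; the latter fixes the width of the
  -- window.
  obtain ⟨pa, hpa, pb, hpb, hab⟩ := eventually_prod_iff.1 hRe
  obtain ⟨r, hr, hball⟩ := Metric.eventually_nhds_iff.1 ((hTB.and hTe).and hpb)
  refine ⟨min δ₀ (r / 2), by positivity, fun δ hδ hδ' => ?_⟩
  obtain ⟨hJ0, hJ1, hJ2⟩ := hL δ hδ (hδ'.trans (min_le_left _ _))
  set J0 : ℝ → ℝ := fun ε => q ε * ∫ v in Icc (-δ) δ, A ε v with hJ0def
  set J1 : ℝ → ℝ := fun ε => q ε * ∫ v in Icc (-δ) δ, v * A ε v with hJ1def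
  set J2 : ℝ → ℝ := fun ε => q ε * ∫ v in Icc (-δ) δ, v ^ 2 * A ε v with hJ2def
  have hε2 : Tendsto (fun ε : ℝ => ε ^ 2) (𝓝[>] 0) (𝓝 0) := by
    refine tendsto_nhdsWithin_of_tendsto_nhds ?_
    simpa using (continuous_pow 2).tendsto (0 : ℝ)
  have hlim : Tendsto (fun ε => ((1 + c * ε ^ 2) * (f x * J0 ε + T1 * J1 ε + T2 * J2 ε) - f x) /
      ε ^ 2) (𝓝[>] 0) (𝓝 (x ^ 2 * deriv (deriv f) x / 2)) := by
    have h1 := ((hJ0.const_mul (f x)).add (hJ1.const_mul T1)).add (hJ2.const_mul T2)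
    have h2 := (h1.mul ((hε2.const_mul c).const_add 1)).add_const (c * f x)
    -- The decisive cancellation. The quartic coefficient of g disappears between Laplace's
    -- expansion and `c`, the coefficient of f(x) is zero for every lam, and that of f'(x) is zero
    -- because lam = (1 + κ)/2.
    have hval : (f x * (15 * ((κ - 3) / 6) ^ 2 / 2 - 3 * (quarticCoeff g - κ / 6 + 1 / 4)) +
        T1 * (-3 * ((κ - 3) / 6)) + T2 * 1) * (1 + c * 0) + c * f x =
        x ^ 2 * deriv (deriv f) x / 2 := by
      rw [hT1, hT2, hc, hlam]
      ring
    rw [hval] at h2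
    refine h2.congr' ?_
    filter_upwards [self_mem_nhdsWithin] with ε hε
    have hε0 : ε ≠ 0 := ne_of_gt hε
    simp only [hJ0def, hJ1def, hJ2def, hq, hA]
    generalize (∫ v in Icc (-δ) δ, Real.exp (-(Real.exp (-v) * g v / ε ^ 2))) = I0
    generalize (∫ v in Icc (-δ) δ, v * Real.exp (-(Real.exp (-v) * g v / ε ^ 2))) = I1
    generalize (∫ v in Icc (-δ) δ, v ^ 2 * Real.exp (-(Real.exp (-v) * g v / ε ^ 2))) = I2
    generalize (ε * Real.sqrt (2 * Real.pi))⁻¹ = Q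
    field_simp
    ring
  have hJ0' : ∀ᶠ ε in 𝓝[>] 0, J0 ε ≤ 2 := by
    have h1 := (hJ0.mul hε2).add_const 1
    rw [mul_zero, zero_add] at h1
    filter_upwards [h1.eventually_lt_const (u := 2) (by norm_num), self_mem_nhdsWithin]
      with ε h2 hε
    have hε0 : ε ≠ 0 := ne_of_gt hε
    rw [div_mul_cancel₀ _ (by positivity), sub_add_cancel] at h2
    exact h2.le
  have hJ2' : ∀ᶠ ε in 𝓝[>] 0, J2 ε ≤ 2 * ε ^ 2 := by
    filter_upwards [hJ2.eventually_lt_const (u := 2) (by norm_num), self_mem_nhdsWithin]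
      with ε h2 hε
    have hε0 : 0 < ε := hε
    rw [div_lt_iff₀ (by positivity)] at h2
    exact h2.le
  filter_upwards [hpa, hlim.eventually (Metric.closedBall_mem_nhds _ (half_pos hρ)), hJ0', hJ2',
    Ioo_mem_nhdsGT (one_pos : (0 : ℝ) < 1)] with ε hεa hεl hε0 hε2' hε
  obtain ⟨hεp, hε1⟩ := hε
  have hq0 : 0 < q ε := by
    have : 0 < Real.sqrt (2 * Real.pi) := Real.sqrt_pos.2 (by positivity)
    simp only [hq]; positivity
  have hAc : Continuous (A ε) := by
    have := hg.continuous
    simp only [hA]; fun_prop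
  have hpt : ∀ v ∈ Icc (-δ) δ, ‖f (x * Real.exp (-v)) * (windowKernel g lam ε v * Real.exp (-v)) -
      q ε * ((1 + c * ε ^ 2) * (f x + T1 * v + T2 * v ^ 2) * A ε v)‖ ≤
      q ε * (((1 + |c|) * e * v ^ 2 + B * e * ε ^ 2) * A ε v) := by
    intro v hv
    have hvr : dist v 0 < r := by
      rw [Real.dist_eq, sub_zero]
      have h1 : |v| ≤ δ := abs_le.2 hv
      have h2 := hδ'.trans (min_le_right _ _)
      linarith
    obtain ⟨⟨hv1, hv2⟩, hv3⟩ := hball hvr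
    have hv4 : |(R ε v - 1) / ε ^ 2 - c| ≤ e := hab hεa hv3
    have hv5 : |R ε v - (1 + c * ε ^ 2)| ≤ e * ε ^ 2 := by
      have e1 : R ε v - (1 + c * ε ^ 2) = ((R ε v - 1) / ε ^ 2 - c) * ε ^ 2 := by
        field_simp; ring
      rw [e1, abs_mul, abs_of_pos (by positivity : 0 < ε ^ 2)]
      gcongr
    rw [norm_pow, Real.norm_eq_abs, Real.norm_eq_abs, sq_abs] at hv2
    have hw := windowKernel_mul_exp_neg_eq (g := g) (lam := lam) (v := v) hεp
    rw [hw]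
    have e2 : f (x * Real.exp (-v)) * (q ε * A ε v *
        Real.exp (-(3 / 2 * v) - g v + lam * deriv g v) * R ε v) -
        q ε * ((1 + c * ε ^ 2) * (f x + T1 * v + T2 * v ^ 2) * A ε v) =
        q ε * (((1 + c * ε ^ 2) * (T v - (f x + T1 * v + T2 * v ^ 2)) +
          T v * (R ε v - (1 + c * ε ^ 2))) * A ε v) := by
      simp only [hTdef]
      ring
    have hA0 : 0 < A ε v := Real.exp_pos _
    refine (le_of_eq (congrArg _ e2)).trans ?_
    rw [Real.norm_eq_abs, abs_mul, abs_mul, abs_of_pos hq0, abs_of_pos hA0]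
    refine mul_le_mul_of_nonneg_left (mul_le_mul_of_nonneg_right ?_ hA0.le) hq0.le
    refine (abs_add_le _ _).trans (add_le_add ?_ ?_)
    · rw [abs_mul, mul_assoc]
      refine mul_le_mul ?_ hv2 (abs_nonneg _) (by positivity)
      refine (abs_add_le _ _).trans ?_
      rw [abs_one, abs_mul, abs_of_pos (by positivity : 0 < ε ^ 2)]
      have : ε ^ 2 ≤ 1 := pow_le_one₀ hεp.le hε1.le
      have : |c| * ε ^ 2 ≤ |c| := mul_le_of_le_one_right (abs_nonneg c) this
      linarith
    · rw [abs_mul, mul_assoc]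
      exact mul_le_mul hv1 hv5 (abs_nonneg _) hB0.le
  have hi0 : IntegrableOn (fun v => A ε v) (Icc (-δ) δ) :=
    hAc.continuousOn.integrableOn_compact isCompact_Icc
  have hi1 : IntegrableOn (fun v => v * A ε v) (Icc (-δ) δ) :=
    (continuous_id.mul hAc).continuousOn.integrableOn_compact isCompact_Icc
  have hi2 : IntegrableOn (fun v => v ^ 2 * A ε v) (Icc (-δ) δ) :=
    ((continuous_pow 2).mul hAc).continuousOn.integrableOn_compact isCompact_Icc
  have hiw := integrableOn_windowKernel_pow hg lam ε δ hx hf 1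
  simp only [pow_one] at hiw
  have hcomb : ∀ a0 a1 a2 : ℝ, (∫ v in Icc (-δ) δ, q ε * ((a0 + a1 * v + a2 * v ^ 2) * A ε v)) =
      a0 * J0 ε + a1 * J1 ε + a2 * J2 ε := by
    intro a0 a1 a2
    have e3 : (fun v => q ε * ((a0 + a1 * v + a2 * v ^ 2) * A ε v)) = fun v =>
        q ε * a0 * A ε v + q ε * a1 * (v * A ε v) + q ε * a2 * (v ^ 2 * A ε v) := by
      ext v; ring
    have h01 : IntegrableOn (fun v => q ε * a0 * A ε v + q ε * a1 * (v * A ε v)) (Icc (-δ) δ) :=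
      (hi0.const_mul _).add (hi1.const_mul _)
    rw [e3, integral_add h01 (hi2.const_mul _),
      integral_add (hi0.const_mul _) (hi1.const_mul _), integral_const_mul, integral_const_mul,
      integral_const_mul]
    simp only [hJ0def, hJ1def, hJ2def]
    ring
  have hmain : |(∫ v in Icc (-δ) δ, f (x * Real.exp (-v)) *
      (windowKernel g lam ε v * Real.exp (-v))) -
      (1 + c * ε ^ 2) * (f x * J0 ε + T1 * J1 ε + T2 * J2 ε)| ≤
      (1 + |c|) * e * J2 ε + B * e * ε ^ 2 * J0 ε := by
    have e4 := hcomb ((1 + c * ε ^ 2) * f x) ((1 + c * ε ^ 2) * T1) ((1 + c * ε ^ 2) * T2)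
    have e5 := hcomb (B * e * ε ^ 2) 0 ((1 + |c|) * e)
    have e6 : (1 + c * ε ^ 2) * (f x * J0 ε + T1 * J1 ε + T2 * J2 ε) =
        ∫ v in Icc (-δ) δ, q ε * ((1 + c * ε ^ 2) * (f x + T1 * v + T2 * v ^ 2) * A ε v) := by
      rw [show (1 + c * ε ^ 2) * (f x * J0 ε + T1 * J1 ε + T2 * J2 ε) =
        (1 + c * ε ^ 2) * f x * J0 ε + (1 + c * ε ^ 2) * T1 * J1 ε +
          (1 + c * ε ^ 2) * T2 * J2 ε by ring, ← e4]
      congr 1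
      ext v
      ring
    have e7 : (1 + |c|) * e * J2 ε + B * e * ε ^ 2 * J0 ε =
        ∫ v in Icc (-δ) δ, q ε * (((1 + |c|) * e * v ^ 2 + B * e * ε ^ 2) * A ε v) := by
      rw [show (1 + |c|) * e * J2 ε + B * e * ε ^ 2 * J0 ε =
        B * e * ε ^ 2 * J0 ε + 0 * J1 ε + (1 + |c|) * e * J2 ε by ring, ← e5]
      congr 1
      ext v
      ring
    have hi3 : IntegrableOn (fun v => q ε * ((1 + c * ε ^ 2) * (f x + T1 * v + T2 * v ^ 2) *
        A ε v)) (Icc (-δ) δ) :=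
      (Continuous.continuousOn (by fun_prop)).integrableOn_compact isCompact_Icc
    have hi4 : IntegrableOn (fun v => q ε * (((1 + |c|) * e * v ^ 2 + B * e * ε ^ 2) * A ε v))
        (Icc (-δ) δ) :=
      (Continuous.continuousOn (by fun_prop)).integrableOn_compact isCompact_Icc
    rw [e6, e7, ← integral_sub hiw hi3, ← Real.norm_eq_abs]
    exact norm_integral_le_of_norm_le hi4
      ((ae_restrict_iff' measurableSet_Icc).2 (Eventually.of_forall hpt))
  have hbound : (1 + |c|) * e * J2 ε + B * e * ε ^ 2 * J0 ε ≤ ρ / 2 * ε ^ 2 := by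
    have hc0 : 0 ≤ 1 + |c| := by positivity
    calc _ ≤ (1 + |c|) * e * (2 * ε ^ 2) + B * e * ε ^ 2 * 2 := by gcongr
      _ = e * D * ε ^ 2 := by rw [hD]; ring
      _ = _ := by rw [he, div_mul_cancel₀ _ hD0.ne']
  have hl2 : |(1 + c * ε ^ 2) * (f x * J0 ε + T1 * J1 ε + T2 * J2 ε) - f x -
      ε ^ 2 * (x ^ 2 * deriv (deriv f) x / 2)| ≤ ρ / 2 * ε ^ 2 := by
    rw [Real.dist_eq] at hεl
    have e8 : (1 + c * ε ^ 2) * (f x * J0 ε + T1 * J1 ε + T2 * J2 ε) - f x -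
        ε ^ 2 * (x ^ 2 * deriv (deriv f) x / 2) =
        (((1 + c * ε ^ 2) * (f x * J0 ε + T1 * J1 ε + T2 * J2 ε) - f x) / ε ^ 2 -
          x ^ 2 * deriv (deriv f) x / 2) * ε ^ 2 := by
      field_simp
    rw [e8, abs_mul, abs_of_pos (by positivity : 0 < ε ^ 2)]
    gcongr
  have hfin := abs_add_le ((∫ v in Icc (-δ) δ, f (x * Real.exp (-v)) *
      (windowKernel g lam ε v * Real.exp (-v))) -
      (1 + c * ε ^ 2) * (f x * J0 ε + T1 * J1 ε + T2 * J2 ε))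
      ((1 + c * ε ^ 2) * (f x * J0 ε + T1 * J1 ε + T2 * J2 ε) - f x -
      ε ^ 2 * (x ^ 2 * deriv (deriv f) x / 2))
  calc _ = _ := by congr 1; ring
    _ ≤ _ := hfin
    _ ≤ ρ / 2 * ε ^ 2 + ρ / 2 * ε ^ 2 := add_le_add (hmain.trans hbound) hl2
    _ = _ := by ring

/-- The second moment of the kernel estimator in a window around `x`. -/
theorem exists_window_sq {g : ℝ → ℝ} {κ : ℝ} (hg : IsPhase g κ) (lam : ℝ) {f : ℝ → ℝ} {x : ℝ}
    (hx : 0 < x) (hf : ContDiffOn ℝ 2 f (Ioi 0)) {ρ : ℝ} (hρ : 0 < ρ) :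
    ∃ δ₁, 0 < δ₁ ∧ ∀ δ, 0 < δ → δ ≤ δ₁ → ∀ᶠ ε in 𝓝[>] 0,
      |ε * (∫ v in Icc (-δ) δ, f (x * Real.exp (-v)) *
          (windowKernel g lam ε v ^ 2 * Real.exp (-v))) -
        f x / (2 * Real.sqrt Real.pi)| ≤ ρ := by
  have hR := windowKernel_expansion hg lam
  obtain ⟨δ₀, hδ₀, hL⟩ := laplace_tendsto (φ := fun v => Real.exp (-v) * g v)
    (by have := hg.continuous; fun_prop) hg.taylor_exp_mul
  set q : ℝ → ℝ := fun ε => (ε * Real.sqrt (2 * Real.pi))⁻¹ with hq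
  set A : ℝ → ℝ → ℝ := fun ε v => Real.exp (-(Real.exp (-v) * g v / ε ^ 2)) with hA
  set R : ℝ × ℝ → ℝ := fun p => windowKernel g lam p.1 p.2 * Real.exp (-p.2) *
    (p.1 * Real.sqrt (2 * Real.pi)) * Real.exp (Real.exp (-p.2) * g p.2 / p.1 ^ 2) *
    Real.exp (3 / 2 * p.2 + g p.2 - lam * deriv g p.2) with hRdef
  set l : Filter (ℝ × ℝ) := 𝓝[>] 0 ×ˢ 𝓝 0 with hl
  have hpos : ∀ᶠ p : ℝ × ℝ in l, 0 < p.1 :=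
    tendsto_fst.eventually (self_mem_nhdsWithin : Ioi (0 : ℝ) ∈ 𝓝[>] 0)
  have hε : Tendsto (fun p : ℝ × ℝ => p.1) l (𝓝 0) :=
    (tendsto_nhdsWithin_of_tendsto_nhds tendsto_id).comp tendsto_fst
  have hR1 : Tendsto R l (𝓝 1) := by
    have h1 := (hR.mul (hε.pow 2)).add_const 1
    rw [show ∀ a : ℝ, a * 0 ^ 2 + 1 = 1 by intro a; ring] at h1
    refine h1.congr' ?_
    filter_upwards [hpos] with p hp
    rw [div_mul_cancel₀ _ (by positivity), sub_add_cancel]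
  -- The factor e^v corrects the square of e^(-v), since the Jacobian occurs only once.
  set S0 : ℝ → ℝ := fun v => f (x * Real.exp (-v)) *
    (Real.exp (-(3 / 2 * v) - g v + lam * deriv g v) ^ 2 * Real.exp v) with hS0
  have hS0c : Continuous S0 := by
    have h2 := hg.continuous
    have h3 := hg.contDiff_deriv.continuous
    exact (continuousOn_comp_mul_exp_neg hx hf).mul (by fun_prop)
  have hS : Tendsto (fun p : ℝ × ℝ => S0 p.2 * R p ^ 2) l (𝓝 (f x)) := by
    have h1 : Tendsto (fun p : ℝ × ℝ => S0 p.2) l (𝓝 (S0 0)) :=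
      (hS0c.tendsto 0).comp tendsto_snd
    have h2 := h1.mul (hR1.pow 2)
    have h3 : S0 0 * 1 ^ 2 = f x := by simp [hS0, hg.zero, hg.deriv_zero]
    rwa [h3] at h2
  have he0 : 0 < ρ / 4 := by positivity
  obtain ⟨pa, hpa, pb, hpb, hab⟩ :=
    eventually_prod_iff.1 (hS.eventually (Metric.closedBall_mem_nhds (f x) he0))
  obtain ⟨r, hr, hball⟩ := Metric.eventually_nhds_iff.1 hpb
  refine ⟨min δ₀ (r / 2), by positivity, fun δ hδ hδ' => ?_⟩
  obtain ⟨hJ, -, -⟩ := hL δ hδ (hδ'.trans (min_le_left _ _))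
  set J : ℝ → ℝ := fun ε => q ε * ∫ v in Icc (-δ) δ, A ε v with hJdef
  have hJ1 : Tendsto J (𝓝[>] 0) (𝓝 1) := by
    have hε2 : Tendsto (fun ε : ℝ => ε ^ 2) (𝓝[>] 0) (𝓝 0) := by
      refine tendsto_nhdsWithin_of_tendsto_nhds ?_
      simpa using (continuous_pow 2).tendsto (0 : ℝ)
    have h1 := (hJ.mul hε2).add_const 1
    rw [mul_zero, zero_add] at h1
    refine h1.congr' ?_
    filter_upwards [self_mem_nhdsWithin] with ε hε
    have hε0 : ε ≠ 0 := ne_of_gt hε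
    rw [div_mul_cancel₀ _ (by positivity), sub_add_cancel]
  have hs2 : 0 < Real.sqrt 2 := Real.sqrt_pos.2 two_pos
  have hscale : Tendsto (fun ε : ℝ => ε / Real.sqrt 2) (𝓝[>] 0) (𝓝[>] 0) := by
    refine tendsto_nhdsWithin_iff.2 ⟨tendsto_nhdsWithin_of_tendsto_nhds ?_, ?_⟩
    · simpa using (continuous_id.div_const (Real.sqrt 2)).tendsto (0 : ℝ)
    · filter_upwards [self_mem_nhdsWithin] with ε hε
      exact div_pos hε hs2
  have hJs := hJ1.comp hscale
  have hJl : Tendsto (fun ε => f x * J (ε / Real.sqrt 2)) (𝓝[>] 0) (𝓝 (f x)) := by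
    simpa using hJs.const_mul (f x)
  filter_upwards [hpa, hJl.eventually (Metric.closedBall_mem_nhds _ he0),
    hJs.eventually_lt_const (u := 2) (by norm_num), self_mem_nhdsWithin] with ε hεa hεl hε2 hε
  have hεp : 0 < ε := hε
  have hAc : Continuous (A ε) := by
    have := hg.continuous
    simp only [hA]; fun_prop
  -- Squaring doubles the exponent, so the previous Laplace integral is used at scale ε/√2.
  have hAsq : ∀ v, A ε v ^ 2 = A (ε / Real.sqrt 2) v := by
    intro v
    simp only [hA]
    rw [← Real.exp_nat_mul, div_pow, Real.sq_sqrt two_pos.le]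
    congr 1
    push_cast
    field_simp
  have hpt : ∀ v ∈ Icc (-δ) δ,
      ‖f (x * Real.exp (-v)) * (windowKernel g lam ε v ^ 2 * Real.exp (-v)) -
        q ε ^ 2 * f x * A (ε / Real.sqrt 2) v‖ ≤ q ε ^ 2 * (ρ / 4) * A (ε / Real.sqrt 2) v := by
    intro v hv
    have hvr : dist v 0 < r := by
      rw [Real.dist_eq, sub_zero]
      have h1 : |v| ≤ δ := abs_le.2 hv
      have h2 := hδ'.trans (min_le_right _ _)
      linarith
    have h1 : |S0 v * R (ε, v) ^ 2 - f x| ≤ ρ / 4 := hab hεa (hball hvr)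
    have hw := windowKernel_mul_exp_neg_eq (g := g) (lam := lam) (v := v) hεp
    have e1 : f (x * Real.exp (-v)) * (windowKernel g lam ε v ^ 2 * Real.exp (-v)) =
        q ε ^ 2 * A (ε / Real.sqrt 2) v * (S0 v * R (ε, v) ^ 2) := by
      have e2 : windowKernel g lam ε v ^ 2 * Real.exp (-v) =
          (windowKernel g lam ε v * Real.exp (-v)) ^ 2 * Real.exp v := by
        have : Real.exp (-v) * Real.exp v = 1 := by rw [← Real.exp_add]; simp
        calc _ = windowKernel g lam ε v ^ 2 * Real.exp (-v) * 1 := by ring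
          _ = _ := by rw [← this]; ring
      rw [e2, hw, ← hAsq]
      simp only [hS0, hRdef, hA, hq]
      ring
    rw [e1, show q ε ^ 2 * A (ε / Real.sqrt 2) v * (S0 v * R (ε, v) ^ 2) -
      q ε ^ 2 * f x * A (ε / Real.sqrt 2) v =
      q ε ^ 2 * A (ε / Real.sqrt 2) v * (S0 v * R (ε, v) ^ 2 - f x) by ring, Real.norm_eq_abs,
      abs_mul, abs_of_nonneg (mul_nonneg (sq_nonneg _) (Real.exp_pos _).le)]
    calc _ ≤ q ε ^ 2 * A (ε / Real.sqrt 2) v * (ρ / 4) :=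
          mul_le_mul_of_nonneg_left h1 (mul_nonneg (sq_nonneg _) (Real.exp_pos _).le)
      _ = _ := by ring
  have hi0 : IntegrableOn (fun v => A (ε / Real.sqrt 2) v) (Icc (-δ) δ) := by
    have hAc' : Continuous fun v => A ε v ^ 2 := hAc.pow 2
    simp only [← hAsq]
    exact hAc'.continuousOn.integrableOn_compact isCompact_Icc
  have hiw := integrableOn_windowKernel_pow hg lam ε δ hx hf 2
  have hmain : |(∫ v in Icc (-δ) δ, f (x * Real.exp (-v)) *
      (windowKernel g lam ε v ^ 2 * Real.exp (-v))) -
      q ε ^ 2 * f x * ∫ v in Icc (-δ) δ, A (ε / Real.sqrt 2) v| ≤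
      q ε ^ 2 * (ρ / 4) * ∫ v in Icc (-δ) δ, A (ε / Real.sqrt 2) v := by
    rw [← integral_const_mul, ← integral_const_mul, ← integral_sub hiw (hi0.const_mul _),
      ← Real.norm_eq_abs]
    exact norm_integral_le_of_norm_le (hi0.const_mul _)
      ((ae_restrict_iff' measurableSet_Icc).2 (Eventually.of_forall hpt))
  have hsp : 0 < Real.sqrt Real.pi := Real.sqrt_pos.2 Real.pi_pos
  -- The prefactor is (2πε)⁻¹ and the integral is ε√π J, whence the constant 1/(2√π).
  have hqI : ε * q ε ^ 2 * (∫ v in Icc (-δ) δ, A (ε / Real.sqrt 2) v) =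
      J (ε / Real.sqrt 2) / (2 * Real.sqrt Real.pi) := by
    simp only [hJdef, hq]
    generalize (∫ v in Icc (-δ) δ, A (ε / Real.sqrt 2) v) = I
    have h2 : Real.sqrt 2 ^ 2 = 2 := Real.sq_sqrt two_pos.le
    rw [Real.sqrt_mul two_pos.le]
    field_simp
    rw [h2]
    ring
  have hpi1 : 1 ≤ 2 * Real.sqrt Real.pi := by
    have : 1 ≤ Real.sqrt Real.pi := Real.one_le_sqrt.2 (by linarith [Real.pi_gt_three])
    linarith
  have hdiv : ∀ a : ℝ, |a / (2 * Real.sqrt Real.pi)| ≤ |a| := fun a => by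
    rw [abs_div, abs_of_pos (by positivity : 0 < 2 * Real.sqrt Real.pi)]
    exact div_le_self (abs_nonneg a) hpi1
  have h1 : |ε * (∫ v in Icc (-δ) δ, f (x * Real.exp (-v)) *
      (windowKernel g lam ε v ^ 2 * Real.exp (-v))) -
      f x * J (ε / Real.sqrt 2) / (2 * Real.sqrt Real.pi)| ≤ ρ / 2 := by
    have e1 : f x * J (ε / Real.sqrt 2) / (2 * Real.sqrt Real.pi) =
        ε * (q ε ^ 2 * f x * ∫ v in Icc (-δ) δ, A (ε / Real.sqrt 2) v) := by
      rw [mul_div_assoc, ← hqI]; ring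
    rw [e1, ← mul_sub, abs_mul, abs_of_pos hεp]
    calc _ ≤ ε * (q ε ^ 2 * (ρ / 4) * ∫ v in Icc (-δ) δ, A (ε / Real.sqrt 2) v) := by gcongr
      _ = ρ / 4 * (J (ε / Real.sqrt 2) / (2 * Real.sqrt Real.pi)) := by rw [← hqI]; ring
      _ ≤ ρ / 4 * 2 := by
        gcongr
        refine (div_le_iff₀ (by positivity)).2 ?_
        simp only [Function.comp_apply] at hε2
        linarith
      _ = _ := by ring
  have h2 : |f x * J (ε / Real.sqrt 2) / (2 * Real.sqrt Real.pi) -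
      f x / (2 * Real.sqrt Real.pi)| ≤ ρ / 4 := by
    rw [← sub_div]
    exact (hdiv _).trans hεl
  refine (abs_sub_le _ _ _).trans ((add_le_add h1 h2).trans ?_)
  linarith

end WindowIntegrals

/-! ### Bounds on the kernel away from the evaluation point. -/

section OffWindow

/-- The precision `1 / γ²` attached to the observation `t`. -/
noncomputable def kernelPrec (η t : ℝ) : ℝ := 1 + t / η ^ 2

/-- The kernel at `x` attached to the observation `t`, with phase `g` and scale parameter
`1 + lam * γ²`. It is set to `0` where the scale parameter is not positive. -/
noncomputable def phaseKernel (g : ℝ → ℝ) (lam x η t : ℝ) : ℝ :=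
  if 0 < 1 + lam * (kernelPrec η t)⁻¹ then
    x⁻¹ * (phaseNorm g (kernelPrec η t) * Real.exp (-(kernelPrec η t *
      g (Real.log (x / t) - Real.log (1 + lam * (kernelPrec η t)⁻¹)))))
  else 0

theorem measurable_phaseKernel {g : ℝ → ℝ} (hg : Continuous g) (lam x η : ℝ) :
    Measurable (phaseKernel g lam x η) := by
  have h1 : Measurable (kernelPrec η) := by unfold kernelPrec; fun_prop
  have h2 := (measurable_phaseNorm hg).comp h1
  have h3 : Measurable fun t => 1 + lam * (kernelPrec η t)⁻¹ := (h1.inv.const_mul lam).const_add 1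
  have h4 : Measurable fun t : ℝ => Real.log (x / t) :=
    Real.measurable_log.comp (measurable_id.const_div x)
  have h5 := hg.measurable.comp (h4.sub (Real.measurable_log.comp h3))
  exact Measurable.ite (measurableSet_lt measurable_const h3)
    ((h2.mul (Real.measurable_exp.comp (h1.mul h5).neg)).const_mul _) measurable_const

theorem one_le_kernelPrec (η : ℝ) {t : ℝ} (ht : 0 ≤ t) : 1 ≤ kernelPrec η t := by
  rw [kernelPrec]
  have : 0 ≤ t / η ^ 2 := by positivity
  linarith

theorem phaseKernel_nonneg {g : ℝ → ℝ} {κ : ℝ} (hg : IsPhase g κ) (lam : ℝ) {x : ℝ} (hx : 0 < x)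
    (η : ℝ) {t : ℝ} (ht : 0 ≤ t) : 0 ≤ phaseKernel g lam x η t := by
  rw [phaseKernel]
  split_ifs
  · have := hg.phaseNorm_pos (one_le_kernelPrec η ht)
    positivity
  · exact le_rfl

/-- Reduces every bound on the kernel to a lower bound `m` on its exponent; where the scale
parameter is not positive the kernel is zero and nothing is asked. -/
theorem exists_phaseKernel_le_sqrt {g : ℝ → ℝ} {κ : ℝ} (hg : IsPhase g κ) (lam : ℝ) {x : ℝ}
    (hx : 0 < x) : ∃ C, 0 < C ∧ ∀ η t, 0 ≤ t → ∀ m, (0 < 1 + lam * (kernelPrec η t)⁻¹ →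
      m ≤ kernelPrec η t * g (Real.log (x / t) - Real.log (1 + lam * (kernelPrec η t)⁻¹))) →
      phaseKernel g lam x η t ≤ C * Real.sqrt (kernelPrec η t) * Real.exp (-m) := by
  obtain ⟨C, hC, h⟩ := hg.exists_phaseNorm_le
  refine ⟨x⁻¹ * C, by positivity, fun η t ht m hm => ?_⟩
  have hN := one_le_kernelPrec η ht
  rw [phaseKernel]
  split_ifs with h0
  · have h1 := h _ hN
    have h2 := hm h0
    have h3 := hg.phaseNorm_pos hN
    calc _ ≤ x⁻¹ * (C * Real.sqrt (kernelPrec η t) * Real.exp (-m)) := by gcongr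
      _ = _ := by ring
  · positivity

/-- Away from t = 0 the precision tends to infinity uniformly, so ν tends to 1. The restriction t ≥
t₀ matters: for t of order η² the precision stays bounded. -/
theorem eventually_abs_log_scale_le (lam : ℝ) {t₀ δ : ℝ} (ht₀ : 0 < t₀) (hδ : 0 < δ) :
    ∀ᶠ η in 𝓝[>] 0, ∀ t, t₀ ≤ t → |Real.log (1 + lam * (kernelPrec η t)⁻¹)| ≤ δ := by
  have hlim : Tendsto (fun η : ℝ => |lam| * (η ^ 2 / t₀)) (𝓝[>] 0) (𝓝 0) := by
    refine tendsto_nhdsWithin_of_tendsto_nhds ?_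
    have : Continuous fun η : ℝ => |lam| * (η ^ 2 / t₀) := by fun_prop
    simpa using this.tendsto 0
  filter_upwards [hlim.eventually_le_const (show 0 < min (1 / 2) (δ / 2) by positivity),
    self_mem_nhdsWithin] with η h1 hη t ht
  have hη0 : 0 < η := hη
  have ht0 : 0 < t := ht₀.trans_le ht
  have hN := one_le_kernelPrec η ht0.le
  have hy : |lam * (kernelPrec η t)⁻¹| ≤ min (1 / 2) (δ / 2) := by
    refine le_trans ?_ h1
    rw [abs_mul, abs_of_pos (inv_pos.2 (by linarith : 0 < kernelPrec η t))]
    gcongr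
    rw [inv_le_comm₀ (by linarith) (by positivity), inv_div, kernelPrec]
    have : t₀ / η ^ 2 ≤ t / η ^ 2 := by gcongr
    linarith
  set y := lam * (kernelPrec η t)⁻¹
  have hy1 := hy.trans (min_le_left _ _)
  have hy2 := hy.trans (min_le_right _ _)
  have h3 := abs_log_one_add_sub_le hy1
  have h4 := abs_add_le (Real.log (1 + y) - y) y
  rw [sub_add_cancel] at h4
  have h5 : 2 * y ^ 2 ≤ |y| := by
    rw [← sq_abs]
    nlinarith [abs_nonneg y]
  linarith

/-- Half of the exponential absorbs the factor √N coming from `phaseNorm`. -/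
theorem exists_sqrt_mul_exp_le {c : ℝ} (hc : 0 < c) :
    ∃ C, 0 < C ∧ ∀ y, 0 ≤ y → Real.sqrt (1 + y) * Real.exp (-(c * y)) ≤
      C * Real.exp (-(c / 2 * y)) := by
  refine ⟨1 + 2 / c, by positivity, fun y hy => ?_⟩
  have h1 : Real.sqrt (1 + y) ≤ 1 + y := by
    rw [Real.sqrt_le_left (by linarith)]
    nlinarith
  have h2 : c / 2 * y ≤ Real.exp (c / 2 * y) := by linarith [Real.add_one_le_exp (c / 2 * y)]
  have h3 : 1 ≤ Real.exp (c / 2 * y) := Real.one_le_exp (by positivity)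
  have h4 : 1 + y ≤ (1 + 2 / c) * Real.exp (c / 2 * y) := by
    have : y = 2 / c * (c / 2 * y) := by field_simp
    have : 2 / c * (c / 2 * y) ≤ 2 / c * Real.exp (c / 2 * y) := by gcongr
    linarith
  calc _ ≤ (1 + 2 / c) * Real.exp (c / 2 * y) * Real.exp (-(c * y)) := by
        gcongr; exact h1.trans h4
    _ = _ := by rw [mul_assoc, ← Real.exp_add]; congr 2; ring

theorem exists_rpow_mul_exp_le {c p : ℝ} (hc : 0 < c) (hp : 0 ≤ p) :
    ∃ C, 0 < C ∧ ∀ y, 0 ≤ y → y ^ p * Real.exp (-(c * y)) ≤ C := by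
  have h := tendsto_rpow_mul_exp_neg_mul_atTop_nhds_zero p c hc
  have hcont : ContinuousOn (fun y : ℝ => y ^ p * Real.exp (-c * y)) (Ici 0) :=
    (Real.continuous_rpow_const hp).continuousOn.mul (by fun_prop)
  obtain ⟨Y, hY⟩ := eventually_atTop.1 (h.eventually_le_const one_pos)
  obtain ⟨B, hB⟩ := (isCompact_Icc (a := (0 : ℝ)) (b := Y)).bddAbove_image
    (hcont.mono Icc_subset_Ici_self)
  refine ⟨max B 1, by positivity, fun y hy => ?_⟩
  rw [← neg_mul]
  rcases le_total y Y with h1 | h1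
  · exact le_max_of_le_left (hB (mem_image_of_mem _ ⟨hy, h1⟩))
  · exact le_max_of_le_right (hY y h1)

/-- To the right of the window the kernel is exponentially small. -/
theorem exists_phaseKernel_right {g : ℝ → ℝ} {κ : ℝ} (hg : IsPhase g κ) (lam : ℝ) {x δ : ℝ}
    (hx : 0 < x) (hδ : 0 < δ) :
    ∃ C c, 0 < C ∧ 0 < c ∧ ∀ᶠ η in 𝓝[>] 0, ∀ t, x * Real.exp δ ≤ t →
      phaseKernel g lam x η t ≤ C * Real.exp (-(c / η ^ 2)) := by
  obtain ⟨C, hC, hK⟩ := exists_phaseKernel_le_sqrt hg lam hx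
  -- The other half of δ is reserved for the shift log ν.
  obtain ⟨c, hc, hcg⟩ := hg.exists_pos_le (half_pos hδ)
  obtain ⟨D, hD, hDs⟩ := exists_sqrt_mul_exp_le hc
  refine ⟨C * D, c / 2 * x, by positivity, by positivity, ?_⟩
  filter_upwards [eventually_abs_log_scale_le lam hx (half_pos hδ), self_mem_nhdsWithin]
    with η hη hη0 t ht
  have hη1 : 0 < η := hη0
  have hxt : x ≤ t := (le_mul_of_one_le_right hx.le (Real.one_le_exp hδ.le)).trans ht
  have ht0 : 0 < t := hx.trans_le hxt
  have hlog : Real.log (x / t) ≤ -δ := by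
    rw [Real.log_le_iff_le_exp (by positivity), div_le_iff₀ ht0]
    calc x = Real.exp (-δ) * (x * Real.exp δ) := by
          rw [mul_left_comm, ← Real.exp_add]; simp
      _ ≤ _ := by gcongr
  have hτ : x / η ^ 2 ≤ t / η ^ 2 := by gcongr
  have hk := hK η t ht0.le (c * (t / η ^ 2)) (fun _ => by
    have h1 := abs_le.1 (hη t hxt)
    have h2 : c ≤ g (Real.log (x / t) - Real.log (1 + lam * (kernelPrec η t)⁻¹)) :=
      hcg _ (le_abs'.2 (Or.inl (by linarith)))
    have h3 : 0 ≤ t / η ^ 2 := by positivity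
    rw [kernelPrec] at h2 ⊢
    nlinarith)
  have h4 := hDs (t / η ^ 2) (by positivity)
  calc _ ≤ C * (Real.sqrt (1 + t / η ^ 2) * Real.exp (-(c * (t / η ^ 2)))) := by
        rw [← mul_assoc]; exact hk
    _ ≤ C * (D * Real.exp (-(c / 2 * (t / η ^ 2)))) := by gcongr
    _ ≤ C * (D * Real.exp (-(c / 2 * (x / η ^ 2)))) := by gcongr
    _ = _ := by rw [← mul_assoc, mul_div_assoc]

/-- To the left of the window the kernel is bounded by a power of the observation. -/
theorem exists_phaseKernel_left {g : ℝ → ℝ} {κ : ℝ} (hg : IsPhase g κ) (lam : ℝ) {x δ S : ℝ}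
    (hx : 0 < x) (hδ : 0 < δ) (hS : 0 < S) (hgS : ∃ C, ∀ v, S * v - C ≤ g v) :
    ∃ C c, 0 < C ∧ 0 < c ∧ ∀ᶠ η in 𝓝[>] 0, ∀ t, 0 < t → t ≤ x * Real.exp (-δ) →
      phaseKernel g lam x η t ≤ C * (t ^ S * Real.exp (-(c * (t / η ^ 2)))) := by
  obtain ⟨C, hC, hK⟩ := exists_phaseKernel_le_sqrt hg lam hx
  obtain ⟨c₀, hc₀, hcg⟩ := hg.exists_pos_le (half_pos hδ)
  obtain ⟨C₀, hgS⟩ := hgS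
  -- Since ν ≤ 1 + |lam| at every t, the shift costs at most this constant in the linear lower
  -- bound.
  set C₁ := S * Real.log (1 + |lam|) + C₀ with hC₁
  -- Below `t₀` the linear growth alone gives g ≥ 1, with no need for ν to be close to 1; from `t₀`
  -- to the window log ν is small and g stays above `c₀`.
  set t₀ := x * Real.exp (-((C₁ + 1) / S)) with ht₀
  have ht₀0 : 0 < t₀ := by positivity
  set c := min 1 c₀ with hc
  have hc0 : 0 < c := lt_min one_pos hc₀
  obtain ⟨D, hD, hDs⟩ := exists_sqrt_mul_exp_le hc0
  refine ⟨C * D * (Real.exp C₁ * (x ^ S)⁻¹), c / 2, by positivity, by positivity, ?_⟩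
  filter_upwards [eventually_abs_log_scale_le lam ht₀0 (half_pos hδ), self_mem_nhdsWithin]
    with η hη hη0 t ht0 ht
  have hη1 : 0 < η := hη0
  have hN := one_le_kernelPrec η ht0.le
  have hτ : 0 ≤ t / η ^ 2 := by positivity
  have hlog : δ ≤ Real.log (x / t) := by
    rw [Real.le_log_iff_exp_le (by positivity), le_div_iff₀ ht0]
    calc Real.exp δ * t ≤ Real.exp δ * (x * Real.exp (-δ)) := by gcongr
      _ = x := by rw [mul_left_comm, ← Real.exp_add]; simp
  have hk := hK η t ht0.le (S * Real.log (x / t) - C₁ + c * (t / η ^ 2)) (fun hpos => by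
    set σ := 1 + lam * (kernelPrec η t)⁻¹ with hσ
    have hσ1 : σ ≤ 1 + |lam| := by
      have h1 : lam * (kernelPrec η t)⁻¹ ≤ |lam| * 1 :=
        mul_le_mul (le_abs_self lam) (inv_le_one_of_one_le₀ hN) (by positivity) (abs_nonneg lam)
      rw [hσ]
      linarith
    have hlσ : Real.log σ ≤ Real.log (1 + |lam|) := Real.log_le_log hpos hσ1
    have h1 : S * Real.log (x / t) - C₁ ≤ g (Real.log (x / t) - Real.log σ) := by
      refine le_trans ?_ (hgS _)
      rw [hC₁]
      nlinarith
    have h2 : c ≤ g (Real.log (x / t) - Real.log σ) := by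
      rcases le_total t t₀ with h | h
      · refine (min_le_left _ _).trans (le_trans ?_ h1)
        have h3 : (C₁ + 1) / S ≤ Real.log (x / t) := by
          rw [Real.le_log_iff_exp_le (by positivity), le_div_iff₀ ht0]
          calc _ ≤ Real.exp ((C₁ + 1) / S) * t₀ := by gcongr
            _ = x := by rw [ht₀, mul_left_comm, ← Real.exp_add]; simp
        rw [div_le_iff₀ hS] at h3
        linarith
      · refine (min_le_right _ _).trans (hcg _ (le_abs'.2 (Or.inr ?_)))
        have h4 := abs_le.1 (hη t h)
        linarith
    -- N g = g + (t/η²) g: the unit part, through linear growth, yields the power t^S, and the rest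
    -- yields the exponential in t/η².
    rw [kernelPrec, add_mul, one_mul]
    have h5 : c * (t / η ^ 2) ≤ t / η ^ 2 * g (Real.log (x / t) - Real.log σ) := by
      rw [mul_comm]; gcongr
    linarith)
  have h4 := hDs (t / η ^ 2) hτ
  have h6 : Real.exp (-(S * Real.log (x / t) - C₁)) = Real.exp C₁ * (x ^ S)⁻¹ * t ^ S := by
    rw [Real.rpow_def_of_pos hx, Real.rpow_def_of_pos ht0, ← Real.exp_neg, ← Real.exp_add,
      ← Real.exp_add, Real.log_div hx.ne' ht0.ne']
    congr 1
    ring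
  calc _ ≤ C * (Real.sqrt (1 + t / η ^ 2) * Real.exp (-(c * (t / η ^ 2)))) *
        Real.exp (-(S * Real.log (x / t) - C₁)) := by
        refine hk.trans (le_of_eq ?_)
        rw [neg_add, Real.exp_add, kernelPrec]
        ring
    _ ≤ C * (D * Real.exp (-(c / 2 * (t / η ^ 2)))) *
        Real.exp (-(S * Real.log (x / t) - C₁)) := by gcongr
    _ = _ := by rw [h6]; ring

/-- Away from the window, the kernel is uniformly bounded, and of order `η ^ p` with `p > 2` up to a
negative power of the observation. -/
theorem exists_phaseKernel_off {g : ℝ → ℝ} {κ : ℝ} (hg : IsPhase g κ) (lam : ℝ) {x δ S r : ℝ}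
    (hx : 0 < x) (hδ : 0 < δ) (hS : 0 < S) (hgS : ∃ C, ∀ v, S * v - C ≤ g v)
    (hSr : 1 < S + r) :
    ∃ C, 0 < C ∧ ∀ᶠ η in 𝓝[>] 0, ∀ t, 0 < t →
      (t ≤ x * Real.exp (-δ) ∨ x * Real.exp δ ≤ t) →
      phaseKernel g lam x η t ≤ C ∧
      phaseKernel g lam x η t ≤ C * η ^ (2 * (S + r)) * (1 + t ^ (-r)) := by
  obtain ⟨C₁, c₁, hC₁, hc₁, h₁⟩ := exists_phaseKernel_right hg lam hx hδ
  obtain ⟨C₂, c₂, hC₂, hc₂, h₂⟩ := exists_phaseKernel_left hg lam hx hδ hS hgS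
  have hp : 0 ≤ S + r := by linarith
  obtain ⟨D₁, hD₁, hE₁⟩ := exists_rpow_mul_exp_le hc₁ hp
  obtain ⟨D₂, hD₂, hE₂⟩ := exists_rpow_mul_exp_le hc₂ hp
  refine ⟨C₁ + C₁ * D₁ + C₂ * x ^ S + C₂ * D₂, by positivity, ?_⟩
  filter_upwards [h₁, h₂, self_mem_nhdsWithin] with η hη₁ hη₂ hη0 t ht0 ht
  have hη : 0 < η := hη0
  have hηp : η ^ (2 * (S + r)) = (η ^ 2) ^ (S + r) := by
    rw [← Real.rpow_natCast, ← Real.rpow_mul hη.le]; norm_num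
  have hη2 : 0 < (η ^ 2) ^ (S + r) := by positivity
  have htr : 0 < t ^ (-r) := by positivity
  have q1 : 0 < C₁ * D₁ := by positivity
  have q2 : 0 < C₂ * x ^ S := by positivity
  have q3 : 0 < C₂ * D₂ := by positivity
  rw [hηp]
  rcases ht with ht | ht
  · have h := hη₂ t ht0 ht
    constructor
    · have h3 : t ≤ x := ht.trans (mul_le_of_le_one_right hx.le
        (Real.exp_le_one_iff.2 (by linarith)))
      have h4 : Real.exp (-(c₂ * (t / η ^ 2))) ≤ 1 := Real.exp_le_one_iff.2 (by
        have : 0 ≤ c₂ * (t / η ^ 2) := by positivity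
        linarith)
      calc _ ≤ _ := h
        _ ≤ C₂ * (x ^ S * 1) := by gcongr
        _ ≤ _ := by rw [mul_one]; linarith
    · have h5 := hE₂ (t / η ^ 2) (by positivity)
      -- Trades t^S for powers of η and of t/η²; the latter is swallowed by the exponential, and
      -- t^(-r) is left to the moment hypothesis.
      have h6 : t ^ S = (η ^ 2) ^ (S + r) * t ^ (-r) * (t / η ^ 2) ^ (S + r) := by
        rw [Real.div_rpow ht0.le (by positivity), Real.rpow_add ht0, Real.rpow_neg ht0.le]
        have : t ^ r ≠ 0 := by positivity
        field_simp
      calc _ ≤ _ := h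
        _ = C₂ * ((η ^ 2) ^ (S + r) * t ^ (-r) *
            ((t / η ^ 2) ^ (S + r) * Real.exp (-(c₂ * (t / η ^ 2))))) := by rw [h6]; ring
        _ ≤ C₂ * ((η ^ 2) ^ (S + r) * t ^ (-r) * D₂) := by gcongr
        _ = C₂ * D₂ * (η ^ 2) ^ (S + r) * t ^ (-r) := by ring
        _ ≤ (C₁ + C₁ * D₁ + C₂ * x ^ S + C₂ * D₂) * (η ^ 2) ^ (S + r) * (1 + t ^ (-r)) := by
          gcongr
          · linarith
          · linarith
  · have h := hη₁ t ht
    constructor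
    · have h4 : Real.exp (-(c₁ / η ^ 2)) ≤ 1 := Real.exp_le_one_iff.2 (by
        have : 0 ≤ c₁ / η ^ 2 := by positivity
        linarith)
      calc _ ≤ _ := h
        _ ≤ C₁ * 1 := by gcongr
        _ ≤ _ := by linarith
    · have h5 := hE₁ (1 / η ^ 2) (by positivity)
      have h6 : (η ^ 2) ^ (S + r) * (1 / η ^ 2) ^ (S + r) = 1 := by
        rw [← Real.mul_rpow (by positivity) (by positivity), mul_one_div_cancel (by positivity),
          Real.one_rpow]
      rw [mul_one_div] at h5
      calc _ ≤ _ := h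
        _ = C₁ * ((η ^ 2) ^ (S + r) *
            ((1 / η ^ 2) ^ (S + r) * Real.exp (-(c₁ / η ^ 2)))) := by
          rw [← mul_assoc ((η ^ 2) ^ (S + r)), h6, one_mul]
        _ ≤ C₁ * ((η ^ 2) ^ (S + r) * D₁) := by gcongr
        _ = C₁ * D₁ * (η ^ 2) ^ (S + r) * 1 := by ring
        _ ≤ (C₁ + C₁ * D₁ + C₂ * x ^ S + C₂ * D₂) * (η ^ 2) ^ (S + r) * (1 + t ^ (-r)) := by
          gcongr
          · linarith
          · linarith

end OffWindow

/-! ### First two moments of the kernel under the law of an observation. -/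

section KernelMoments

theorem image_mul_exp_neg_Icc {x : ℝ} (hx : 0 < x) (δ : ℝ) :
    (fun v => x * Real.exp (-v)) '' Icc (-δ) δ = Icc (x * Real.exp (-δ)) (x * Real.exp δ) := by
  ext t
  constructor
  · rintro ⟨v, hv, rfl⟩
    exact ⟨mul_le_mul_of_nonneg_left (Real.exp_le_exp.2 (by linarith [hv.2])) hx.le,
      mul_le_mul_of_nonneg_left (Real.exp_le_exp.2 (by linarith [hv.1])) hx.le⟩
  · rintro ⟨h1, h2⟩
    have ht : 0 < t := (by positivity : 0 < x * Real.exp (-δ)).trans_le h1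
    have h3 : Real.exp (-δ) ≤ t / x := by rw [le_div_iff₀ hx, mul_comm]; exact h1
    have h4 : t / x ≤ Real.exp δ := by rw [div_le_iff₀ hx, mul_comm]; exact h2
    rw [← Real.le_log_iff_exp_le (by positivity)] at h3
    rw [← Real.log_le_iff_le_exp (by positivity)] at h4
    refine ⟨-Real.log (t / x), ⟨by linarith, by linarith⟩, ?_⟩
    simp only [neg_neg]
    rw [Real.exp_log (by positivity)]
    field_simp

/-- The substitution t = x e^(-v), which maps the symmetric window in v onto a multiplicative
neighbourhood of x. -/
theorem setIntegral_withDensity_window {f : ℝ → ℝ} {x : ℝ} (hx : 0 < x)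
    (hf : ContinuousOn f (Ioi 0)) (hf0 : ∀ t, 0 < t → 0 ≤ f t) (δ : ℝ) (F : ℝ → ℝ) :
    ∫ t in Icc (x * Real.exp (-δ)) (x * Real.exp δ), F t
      ∂((volume.restrict (Ioi (0 : ℝ))).withDensity fun t => ENNReal.ofReal (f t)) =
    ∫ v in Icc (-δ) δ, f (x * Real.exp (-v)) * (F (x * Real.exp (-v)) * (x * Real.exp (-v))) := by
  have hsub : Icc (x * Real.exp (-δ)) (x * Real.exp δ) ⊆ Ioi 0 := fun t ht =>
    (by positivity : 0 < x * Real.exp (-δ)).trans_le ht.1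
  have hm : AEMeasurable (fun t => ENNReal.ofReal (f t))
      ((volume.restrict (Ioi (0 : ℝ))).restrict
        (Icc (x * Real.exp (-δ)) (x * Real.exp δ))) :=
    ((hf.aemeasurable measurableSet_Ioi).restrict).ennreal_ofReal
  rw [setIntegral_withDensity_eq_setIntegral_toReal_smul₀ hm
    (Eventually.of_forall fun t => ENNReal.ofReal_lt_top) _ measurableSet_Icc,
    Measure.restrict_restrict measurableSet_Icc, inter_eq_left.2 hsub, ← image_mul_exp_neg_Icc hx,
    integral_image_eq_integral_abs_deriv_smul (f' := fun v => -(x * Real.exp (-v)))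
      measurableSet_Icc]
  · refine setIntegral_congr_fun measurableSet_Icc fun v _ => ?_
    have hv : 0 < x * Real.exp (-v) := by positivity
    simp only [smul_eq_mul]
    rw [abs_neg, abs_of_pos hv, ENNReal.toReal_ofReal (hf0 _ hv)]
    ring
  · intro v _
    refine ((((hasDerivAt_id v).neg.exp).const_mul x).congr_deriv ?_).hasDerivWithinAt
    simp
  · intro v _ w _ h
    have h1 := mul_left_cancel₀ hx.ne' h
    have h2 := Real.exp_injective h1
    linarith

/-- With ε = η/√x the two precisions agree and log(x/t) = v. For small η the scale parameter is
positive on the whole window, so the default value 0 does not intervene. -/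
theorem eventually_phaseKernel_window (g : ℝ → ℝ) (lam : ℝ) {x : ℝ} (hx : 0 < x) (δ : ℝ) :
    ∀ᶠ η in 𝓝[>] 0, ∀ v ∈ Icc (-δ) δ, phaseKernel g lam x η (x * Real.exp (-v)) =
      x⁻¹ * windowKernel g lam (η / Real.sqrt x) v := by
  have hlim : Tendsto (fun η : ℝ => |lam| * (η ^ 2 / (x * Real.exp (-δ)))) (𝓝[>] 0) (𝓝 0) := by
    refine tendsto_nhdsWithin_of_tendsto_nhds ?_
    have : Continuous fun η : ℝ => |lam| * (η ^ 2 / (x * Real.exp (-δ))) := by fun_prop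
    simpa using this.tendsto 0
  filter_upwards [hlim.eventually_lt_const one_pos, self_mem_nhdsWithin] with η h1 hη v hv
  have hη0 : 0 < η := hη
  have hprec : kernelPrec η (x * Real.exp (-v)) = windowPrec (η / Real.sqrt x) v := by
    rw [kernelPrec, windowPrec, div_pow, Real.sq_sqrt hx.le]
    field_simp
  have hlog : Real.log (x / (x * Real.exp (-v))) = v := by
    rw [div_mul_cancel_left₀ hx.ne', ← Real.exp_neg, neg_neg, Real.log_exp]
  have hpos : 0 < 1 + lam * (kernelPrec η (x * Real.exp (-v)))⁻¹ := by
    have hN := one_le_kernelPrec η (by positivity : 0 ≤ x * Real.exp (-v))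
    have h2 : |lam * (kernelPrec η (x * Real.exp (-v)))⁻¹| < 1 := by
      refine lt_of_le_of_lt ?_ h1
      rw [abs_mul, abs_of_pos (inv_pos.2 (by linarith : 0 < kernelPrec η (x * Real.exp (-v))))]
      gcongr
      rw [inv_le_comm₀ (by linarith) (by positivity), inv_div, kernelPrec]
      have : x * Real.exp (-δ) / η ^ 2 ≤ x * Real.exp (-v) / η ^ 2 := by
        gcongr
        exact hv.2
      linarith
    linarith [(abs_lt.1 h2).1]
  rw [phaseKernel, if_pos hpos, hprec, hlog, windowKernel]

theorem not_mem_window {x δ t : ℝ} (ht : t ∉ Icc (x * Real.exp (-δ)) (x * Real.exp δ)) :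
    t ≤ x * Real.exp (-δ) ∨ x * Real.exp δ ≤ t := by
  rw [mem_Icc, not_and_or, not_le, not_le] at ht
  exact ht.imp le_of_lt le_of_lt

theorem tendsto_div_sqrt_nhdsGT {x : ℝ} (hx : 0 < x) :
    Tendsto (fun η : ℝ => η / Real.sqrt x) (𝓝[>] 0) (𝓝[>] 0) := by
  refine tendsto_nhdsWithin_iff.2 ⟨tendsto_nhdsWithin_of_tendsto_nhds ?_, ?_⟩
  · simpa using (continuous_id.div_const (Real.sqrt x)).tendsto (0 : ℝ)
  · filter_upwards [self_mem_nhdsWithin] with η hη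
    exact div_pos hη (Real.sqrt_pos.2 hx)

/-- The bound `B` depends on η, since near x the kernel may be as large as √N; it serves only for
square integrability. -/
theorem eventually_phaseKernel_bounded {g : ℝ → ℝ} {κ : ℝ} (hg : IsPhase g κ) (lam : ℝ) {x S r : ℝ}
    (hx : 0 < x) (hS : 0 < S) (hgS : ∃ C, ∀ v, S * v - C ≤ g v) (hSr : 1 < S + r) :
    ∀ᶠ η in 𝓝[>] 0, ∃ B, ∀ t, 0 < t → phaseKernel g lam x η t ≤ B := by
  obtain ⟨C, hC, hoff⟩ := exists_phaseKernel_off hg lam hx one_pos hS hgS hSr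
  obtain ⟨D, hD, hK⟩ := exists_phaseKernel_le_sqrt hg lam hx
  filter_upwards [hoff] with η hη
  refine ⟨max C (D * Real.sqrt (kernelPrec η (x * Real.exp 1))), fun t ht => ?_⟩
  by_cases h : t ∈ Icc (x * Real.exp (-1)) (x * Real.exp 1)
  · refine le_max_of_le_right ?_
    have h1 := hK η t ht.le 0 (fun _ =>
      mul_nonneg (by linarith [one_le_kernelPrec η ht.le]) (hg.nonneg _))
    rw [neg_zero, Real.exp_zero, mul_one] at h1
    refine h1.trans ?_
    have : kernelPrec η t ≤ kernelPrec η (x * Real.exp 1) := by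
      unfold kernelPrec
      gcongr
      exact h.2
    gcongr
  · exact le_max_of_le_left (hη t ht (not_mem_window h)).1

variable {f : ℝ → ℝ} {μ : Measure ℝ}

theorem ae_pos_of_eq_withDensity
    (hμ : μ = (volume.restrict (Ioi (0 : ℝ))).withDensity fun t => ENNReal.ofReal (f t)) :
    ∀ᵐ t ∂μ, 0 < t := by
  rw [hμ]
  exact (withDensity_absolutelyContinuous _ _).ae_le (ae_restrict_mem measurableSet_Ioi)

theorem eventually_memLp_phaseKernel {g : ℝ → ℝ} {κ : ℝ} (hg : IsPhase g κ) (lam : ℝ) {x S r : ℝ}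
    (hx : 0 < x) (hS : 0 < S) (hgS : ∃ C, ∀ v, S * v - C ≤ g v) (hSr : 1 < S + r)
    [IsProbabilityMeasure μ]
    (hμ : μ = (volume.restrict (Ioi (0 : ℝ))).withDensity fun t => ENNReal.ofReal (f t)) :
    ∀ᶠ η in 𝓝[>] 0, MemLp (phaseKernel g lam x η) 2 μ := by
  filter_upwards [eventually_phaseKernel_bounded hg lam hx hS hgS hSr] with η ⟨B, hB⟩
  refine MemLp.of_bound (measurable_phaseKernel hg.continuous lam x η).aestronglyMeasurable B ?_
  filter_upwards [ae_pos_of_eq_withDensity hμ] with t ht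
  rw [Real.norm_eq_abs, abs_of_nonneg (phaseKernel_nonneg hg lam hx η ht.le)]
  exact hB t ht

/-- The window gives the expansion in ε² = η²/x; its complement contributes at most a constant times
η^(2(S+r)) E(1 + X^(-r)), which is o(η²) as S + r > 1. -/
theorem integral_phaseKernel_isLittleO {g : ℝ → ℝ} {κ : ℝ} (hg : IsPhase g κ) {x S r : ℝ}
    (hx : 0 < x) (hS : 0 < S) (hgS : ∃ C, ∀ v, S * v - C ≤ g v) (hSr : 1 < S + r)
    [IsProbabilityMeasure μ]
    (hμ : μ = (volume.restrict (Ioi (0 : ℝ))).withDensity fun t => ENNReal.ofReal (f t))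
    (hf : ContDiffOn ℝ 2 f (Ioi 0)) (hf0 : ∀ t, 0 < t → 0 ≤ f t)
    (hint : Integrable (fun t => t ^ (-r)) μ) :
    (fun η => (∫ t, phaseKernel g ((1 + κ) / 2) x η t ∂μ) - f x -
      1 / 2 * η ^ 2 * x * deriv (deriv f) x) =o[𝓝[>] 0] fun η => η ^ 2 := by
  rw [isLittleO_iff]
  intro ρ hρ
  set lam := (1 + κ) / 2 with hlam
  -- The factor `x` compensates ε² = η²/x.
  obtain ⟨δ, hδ, hwin⟩ := exists_window_mean hg hx hf (show 0 < ρ / 2 * x by positivity)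
  have hw := (tendsto_div_sqrt_nhdsGT hx).eventually (hwin δ hδ le_rfl)
  obtain ⟨C, hC, hoff⟩ := exists_phaseKernel_off hg lam hx hδ hS hgS hSr
  set W := Icc (x * Real.exp (-δ)) (x * Real.exp δ) with hW
  have hint1 : Integrable (fun t => 1 + t ^ (-r)) μ := (integrable_const 1).add hint
  set K := ∫ t, (1 + t ^ (-r)) ∂μ with hK
  have hp : 0 < 2 * (S + r) - 2 := by linarith
  have hlim : Tendsto (fun η : ℝ => C * K * η ^ (2 * (S + r) - 2)) (𝓝[>] 0) (𝓝 0) := by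
    refine tendsto_nhdsWithin_of_tendsto_nhds ?_
    have := ((Real.continuous_rpow_const hp.le).tendsto (0 : ℝ)).const_mul (C * K)
    rwa [Real.zero_rpow hp.ne', mul_zero] at this
  filter_upwards [hw, hoff, eventually_phaseKernel_window g lam hx δ,
    eventually_memLp_phaseKernel hg lam hx hS hgS hSr hμ,
    hlim.eventually_le_const (half_pos hρ), self_mem_nhdsWithin] with η h1 h2 h3 h4 h5 hη0
  have hη : 0 < η := hη0
  have hi : Integrable (phaseKernel g lam x η) μ := h4.integrable one_le_two
  have hsplit := integral_add_compl (measurableSet_Icc : MeasurableSet W) hi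
  have hin : ∫ t in W, phaseKernel g lam x η t ∂μ = ∫ v in Icc (-δ) δ, f (x * Real.exp (-v)) *
      (windowKernel g lam (η / Real.sqrt x) v * Real.exp (-v)) := by
    rw [hμ, hW, setIntegral_withDensity_window hx hf.continuousOn hf0]
    refine setIntegral_congr_fun measurableSet_Icc fun v hv => ?_
    rw [h3 v hv]
    field_simp
  have hout : |∫ t in Wᶜ, phaseKernel g lam x η t ∂μ| ≤ C * η ^ (2 * (S + r)) * K := by
    rw [← Real.norm_eq_abs]
    calc _ ≤ ∫ t in Wᶜ, C * η ^ (2 * (S + r)) * (1 + t ^ (-r)) ∂μ := by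
          refine norm_integral_le_of_norm_le (hint1.const_mul _).integrableOn ?_
          filter_upwards [ae_restrict_mem (measurableSet_Icc : MeasurableSet W).compl,
            ae_restrict_of_ae (ae_pos_of_eq_withDensity hμ)] with t ht ht0
          rw [Real.norm_eq_abs, abs_of_nonneg (phaseKernel_nonneg hg lam hx η ht0.le)]
          exact (h2 t ht0 (not_mem_window ht)).2
      _ ≤ ∫ t, C * η ^ (2 * (S + r)) * (1 + t ^ (-r)) ∂μ := by
          refine setIntegral_le_integral (hint1.const_mul _) ?_
          filter_upwards [ae_pos_of_eq_withDensity hμ] with t ht0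
          have : 0 < t ^ (-r) := Real.rpow_pos_of_pos ht0 _
          simp only [Pi.zero_apply]
          positivity
      _ = _ := integral_const_mul _ _
  have hout2 : C * η ^ (2 * (S + r)) * K ≤ ρ / 2 * η ^ 2 := by
    have e : η ^ (2 * (S + r)) = η ^ (2 * (S + r) - 2) * η ^ 2 := by
      rw [← Real.rpow_natCast η 2, ← Real.rpow_add hη]
      congr 1
      push_cast
      ring
    calc _ = C * K * η ^ (2 * (S + r) - 2) * η ^ 2 := by rw [e]; ring
      _ ≤ _ := by gcongr
  rw [div_pow, Real.sq_sqrt hx.le] at h1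
  rw [← hsplit, hin, Real.norm_eq_abs, norm_pow, Real.norm_eq_abs, sq_abs]
  set I := ∫ v in Icc (-δ) δ, f (x * Real.exp (-v)) *
      (windowKernel g lam (η / Real.sqrt x) v * Real.exp (-v))
  set O := ∫ t in Wᶜ, phaseKernel g lam x η t ∂μ
  have e1 : I + O - f x - 1 / 2 * η ^ 2 * x * deriv (deriv f) x =
      (I - f x - η ^ 2 / x * (x ^ 2 * deriv (deriv f) x / 2)) + O := by
    field_simp
    ring
  rw [e1]
  have e2 : ρ / 2 * x * (η ^ 2 / x) = ρ / 2 * η ^ 2 := by field_simp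
  rw [e2] at h1
  refine (abs_add_le _ _).trans ((add_le_add h1 (hout.trans hout2)).trans (le_of_eq ?_))
  ring

/-- Only the leading order is needed: off the window a uniform bound on the kernel suffices, because
the integral is multiplied by η, and no moment enters. -/
theorem tendsto_integral_phaseKernel_sq {g : ℝ → ℝ} {κ : ℝ} (hg : IsPhase g κ) (lam : ℝ)
    {x S r : ℝ} (hx : 0 < x) (hS : 0 < S) (hgS : ∃ C, ∀ v, S * v - C ≤ g v) (hSr : 1 < S + r)
    [IsProbabilityMeasure μ]
    (hμ : μ = (volume.restrict (Ioi (0 : ℝ))).withDensity fun t => ENNReal.ofReal (f t))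
    (hf : ContDiffOn ℝ 2 f (Ioi 0)) (hf0 : ∀ t, 0 < t → 0 ≤ f t) :
    Tendsto (fun η => η * ∫ t, phaseKernel g lam x η t ^ 2 ∂μ) (𝓝[>] 0)
      (𝓝 (f x / (2 * Real.sqrt Real.pi * Real.sqrt x))) := by
  rw [Metric.tendsto_nhds]
  intro ρ hρ
  have hsx : 0 < Real.sqrt x := Real.sqrt_pos.2 hx
  obtain ⟨δ, hδ, hwin⟩ := exists_window_sq hg lam hx hf (show 0 < ρ / 2 * Real.sqrt x by positivity)
  have hw := (tendsto_div_sqrt_nhdsGT hx).eventually (hwin δ hδ le_rfl)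
  obtain ⟨C, hC, hoff⟩ := exists_phaseKernel_off hg lam hx hδ hS hgS hSr
  set W := Icc (x * Real.exp (-δ)) (x * Real.exp δ) with hW
  have hlim : Tendsto (fun η : ℝ => η * C ^ 2) (𝓝[>] 0) (𝓝 0) := by
    refine tendsto_nhdsWithin_of_tendsto_nhds ?_
    have : Continuous fun η : ℝ => η * C ^ 2 := by fun_prop
    simpa using this.tendsto 0
  filter_upwards [hw, hoff, eventually_phaseKernel_window g lam hx δ,
    eventually_memLp_phaseKernel hg lam hx hS hgS hSr hμ,
    hlim.eventually_lt_const (half_pos hρ), self_mem_nhdsWithin] with η h1 h2 h3 h4 h5 hη0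
  have hη : 0 < η := hη0
  have hi : Integrable (fun t => phaseKernel g lam x η t ^ 2) μ := h4.integrable_sq
  have hsplit := integral_add_compl (measurableSet_Icc : MeasurableSet W) hi
  have hin : ∫ t in W, phaseKernel g lam x η t ^ 2 ∂μ =
      x⁻¹ * ∫ v in Icc (-δ) δ, f (x * Real.exp (-v)) *
        (windowKernel g lam (η / Real.sqrt x) v ^ 2 * Real.exp (-v)) := by
    rw [hμ, hW, setIntegral_withDensity_window hx hf.continuousOn hf0, ← integral_const_mul]
    refine setIntegral_congr_fun measurableSet_Icc fun v hv => ?_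
    rw [h3 v hv]
    field_simp
  have hout : |∫ t in Wᶜ, phaseKernel g lam x η t ^ 2 ∂μ| ≤ C ^ 2 := by
    rw [← Real.norm_eq_abs]
    calc _ ≤ ∫ _ in Wᶜ, C ^ 2 ∂μ := by
          refine norm_integral_le_of_norm_le (integrable_const _) ?_
          filter_upwards [ae_restrict_mem (measurableSet_Icc : MeasurableSet W).compl,
            ae_restrict_of_ae (ae_pos_of_eq_withDensity hμ)] with t ht ht0
          have h0 := phaseKernel_nonneg hg lam hx η ht0.le
          rw [Real.norm_eq_abs, abs_of_nonneg (by positivity)]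
          exact pow_le_pow_left₀ h0 (h2 t ht0 (not_mem_window ht)).1 2
      _ ≤ ∫ _, C ^ 2 ∂μ := setIntegral_le_integral (integrable_const _)
          (Eventually.of_forall fun _ => by simp only [Pi.zero_apply]; positivity)
      _ = _ := by simp
  rw [Real.dist_eq, ← hsplit, hin]
  set I := ∫ v in Icc (-δ) δ, f (x * Real.exp (-v)) *
      (windowKernel g lam (η / Real.sqrt x) v ^ 2 * Real.exp (-v))
  set O := ∫ t in Wᶜ, phaseKernel g lam x η t ^ 2 ∂μ
  have hxx : x = Real.sqrt x ^ 2 := (Real.sq_sqrt hx.le).symm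
  have hpi : 0 < Real.sqrt Real.pi := Real.sqrt_pos.2 Real.pi_pos
  have e1 : η * (x⁻¹ * I + O) - f x / (2 * Real.sqrt Real.pi * Real.sqrt x) =
      (η / Real.sqrt x * I - f x / (2 * Real.sqrt Real.pi)) / Real.sqrt x + η * O := by
    have e2 : x⁻¹ = (Real.sqrt x)⁻¹ * (Real.sqrt x)⁻¹ := by
      rw [← mul_inv, ← sq, ← hxx]
    rw [e2]
    field_simp
    ring
  rw [e1]
  have h6 : |(η / Real.sqrt x * I - f x / (2 * Real.sqrt Real.pi)) / Real.sqrt x| ≤ ρ / 2 := by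
    rw [abs_div, abs_of_pos hsx, div_le_iff₀ hsx]
    exact h1
  have h7 : |η * O| < ρ / 2 := by
    rw [abs_mul, abs_of_pos hη]
    exact lt_of_le_of_lt (by gcongr) h5
  have h8 := abs_add_le
    ((η / Real.sqrt x * I - f x / (2 * Real.sqrt Real.pi)) / Real.sqrt x) (η * O)
  linarith

end KernelMoments

/-! ### The Meijer densities in logarithmic scale. -/

section MeijerPhase

/-- The phase of the Gamma kernels. -/
noncomputable def gammaPhase (ξ v : ℝ) : ℝ := ξ ^ 2 * (Real.exp (v / ξ) - 1 - v / ξ)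

/-- The phase of the Inverse Gamma kernels. -/
noncomputable def invGammaPhase (ξ v : ℝ) : ℝ := ξ ^ 2 * (Real.exp (-(v / ξ)) - 1 + v / ξ)

/-- The phase of the Fisher-Snedecor kernels. -/
noncomputable def fisherPhase (ξ A B v : ℝ) : ℝ :=
  ξ ^ 2 / (A * B) * Real.log (A + B * Real.exp (v / ξ)) - ξ ^ 2 / A * (v / ξ)

/-- The phase of the Meijer kernels. -/
noncomputable def meijerPhase (ξ θ v : ℝ) : ℝ :=
  if θ = 0 then gammaPhase ξ v
  else if θ = Real.pi / 2 then invGammaPhase ξ v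
  else fisherPhase ξ (Real.cos θ ^ 2) (Real.sin θ ^ 2) v

theorem IsPhase.of_hasDerivAt {g g1 g2 : ℝ → ℝ} {κ : ℝ} (hc : ContDiff ℝ 5 g) (h0 : g 0 = 0)
    (h1 : ∀ v, HasDerivAt g (g1 v) v) (h2 : ∀ v, HasDerivAt g1 (g2 v) v)
    (h3 : HasDerivAt g2 κ 0) (h10 : g1 0 = 0) (h20 : g2 0 = 1) (hpos : ∀ v, 0 < g2 v)
    (hint : Integrable fun v => Real.exp (-g v)) : IsPhase g κ := by
  have e1 : deriv g = g1 := funext fun v => (h1 v).deriv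
  have e2 : deriv g1 = g2 := funext fun v => (h2 v).deriv
  exact ⟨hc, h0, by rw [e1, h10], by rw [e1, e2, h20], by rw [e1, e2, h3.deriv],
    by rw [e1, e2]; exact hpos, hint⟩

theorem isPhase_gammaPhase {ξ : ℝ} (hξ : 0 < ξ)
    (hint : Integrable fun v => Real.exp (-gammaPhase ξ v)) :
    IsPhase (gammaPhase ξ) (1 / ξ) := by
  have hd : ∀ v : ℝ, HasDerivAt (fun v => v / ξ) (1 / ξ) v := fun v => (hasDerivAt_id v).div_const ξ
  have he : ∀ v : ℝ, HasDerivAt (fun v => Real.exp (v / ξ)) (Real.exp (v / ξ) * (1 / ξ)) v :=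
    fun v => (hd v).exp
  refine IsPhase.of_hasDerivAt (g1 := fun v => ξ * (Real.exp (v / ξ) - 1))
    (g2 := fun v => Real.exp (v / ξ)) ?_ (by simp [gammaPhase]) (fun v => ?_) (fun v => ?_) ?_
    (by simp) (by simp) (fun v => Real.exp_pos _) hint
  · unfold gammaPhase
    fun_prop
  · refine ((((he v).sub_const 1).sub (hd v)).const_mul (ξ ^ 2)).congr_deriv ?_
    field_simp
  · refine (((he v).sub_const 1).const_mul ξ).congr_deriv ?_
    field_simp
  · simpa using he 0

theorem isPhase_invGammaPhase {ξ : ℝ} (hξ : 0 < ξ)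
    (hint : Integrable fun v => Real.exp (-invGammaPhase ξ v)) :
    IsPhase (invGammaPhase ξ) (-1 / ξ) := by
  have hd : ∀ v : ℝ, HasDerivAt (fun v => v / ξ) (1 / ξ) v := fun v => (hasDerivAt_id v).div_const ξ
  have he : ∀ v : ℝ, HasDerivAt (fun v => Real.exp (-(v / ξ))) (Real.exp (-(v / ξ)) * -(1 / ξ)) v :=
    fun v => (hd v).neg.exp
  refine IsPhase.of_hasDerivAt (g1 := fun v => ξ * (1 - Real.exp (-(v / ξ))))
    (g2 := fun v => Real.exp (-(v / ξ))) ?_ (by simp [invGammaPhase]) (fun v => ?_) (fun v => ?_)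
    ?_ (by simp) (by simp) (fun v => Real.exp_pos _) hint
  · unfold invGammaPhase
    fun_prop
  · refine ((((he v).sub_const 1).add (hd v)).const_mul (ξ ^ 2)).congr_deriv ?_
    field_simp
    ring
  · refine (((he v).const_sub 1).const_mul ξ).congr_deriv ?_
    field_simp
  · refine (he 0).congr_deriv ?_
    simp [neg_div]

/-- For A = cos²θ and B = sin²θ the third derivative is cos 2θ / ξ, which interpolates between 1/ξ
(Gamma) and -1/ξ (Inverse Gamma). -/
theorem isPhase_fisherPhase {ξ A B : ℝ} (hξ : 0 < ξ) (hA : 0 < A) (hB : 0 < B) (hAB : A + B = 1)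
    (hint : Integrable fun v => Real.exp (-fisherPhase ξ A B v)) :
    IsPhase (fisherPhase ξ A B) ((1 - 2 * B) / ξ) := by
  have hd : ∀ v : ℝ, HasDerivAt (fun v => v / ξ) (1 / ξ) v := fun v => (hasDerivAt_id v).div_const ξ
  have he : ∀ v : ℝ, HasDerivAt (fun v => Real.exp (v / ξ)) (Real.exp (v / ξ) * (1 / ξ)) v :=
    fun v => (hd v).exp
  have hp : ∀ v : ℝ, 0 < A + B * Real.exp (v / ξ) := fun v => by positivity
  have hD : ∀ v : ℝ, HasDerivAt (fun v => A + B * Real.exp (v / ξ))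
      (B * (Real.exp (v / ξ) * (1 / ξ))) v := fun v => ((he v).const_mul B).const_add A
  have hA1 : A = 1 - B := by linarith
  refine IsPhase.of_hasDerivAt
    (g1 := fun v => ξ / A * (Real.exp (v / ξ) / (A + B * Real.exp (v / ξ)) - 1))
    (g2 := fun v => Real.exp (v / ξ) / (A + B * Real.exp (v / ξ)) ^ 2) ?_
    (by simp [fisherPhase, hAB]) (fun v => ?_) (fun v => ?_) ?_
    (by simp [hAB]) (by simp [hAB]) (fun v => div_pos (Real.exp_pos _) (pow_pos (hp v) 2)) hint
  · unfold fisherPhase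
    refine (contDiff_const.mul (ContDiff.log (by fun_prop) fun v => (hp v).ne')).sub (by fun_prop)
  · refine ((((hD v).log (hp v).ne').const_mul (ξ ^ 2 / (A * B))).sub
      ((hd v).const_mul (ξ ^ 2 / A))).congr_deriv ?_
    have := (hp v).ne'
    field_simp
  · refine ((((he v).div (hD v) (hp v).ne').sub_const 1).const_mul (ξ / A)).congr_deriv ?_
    have := (hp v).ne'
    field_simp
    ring
  · refine ((he 0).div ((hD 0).pow 2) (pow_pos (hp 0) 2).ne').congr_deriv ?_
    simp [hAB]
    field_simp

/-- Exponential growth beats every slope: use the tangent of exp at log m, with m chosen so that the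
slope becomes S after the linear term is subtracted. -/
theorem exists_le_gammaPhase {ξ : ℝ} (hξ : 0 < ξ) {S : ℝ} (hS : 0 < S) :
    ∃ C, ∀ v, S * v - C ≤ gammaPhase ξ v := by
  set m := 1 + S / ξ with hm
  have hm0 : 0 < m := by positivity
  refine ⟨ξ ^ 2 * (1 - m * (1 - Real.log m)), fun v => ?_⟩
  have h1 : m * (v / ξ - Real.log m + 1) ≤ Real.exp (v / ξ) := by
    have h2 := mul_le_mul_of_nonneg_left (Real.add_one_le_exp (v / ξ - Real.log m)) hm0.le
    rwa [Real.exp_sub, Real.exp_log hm0, mul_div_cancel₀ _ hm0.ne'] at h2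
  have h3 : S * v = ξ ^ 2 * ((m - 1) * (v / ξ)) := by
    rw [hm]
    field_simp
    ring
  rw [gammaPhase, h3, ← mul_sub]
  exact mul_le_mul_of_nonneg_left (by linarith) (by positivity)

theorem exists_le_invGammaPhase {ξ : ℝ} (hξ : 0 < ξ) :
    ∃ C, ∀ v, ξ * v - C ≤ invGammaPhase ξ v := by
  refine ⟨ξ ^ 2, fun v => ?_⟩
  have h3 : ξ * v - ξ ^ 2 = ξ ^ 2 * (v / ξ - 1) := by field_simp
  rw [invGammaPhase, h3]
  exact mul_le_mul_of_nonneg_left (by linarith [Real.exp_pos (-(v / ξ))]) (by positivity)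

/-- From log(A + B e^u) ≥ log B + u; the slope in v is ξ/(AB) - ξ/A = ξ/B since 1 - B = A. -/
theorem exists_le_fisherPhase {ξ A B : ℝ} (hξ : 0 < ξ) (hA : 0 < A) (hB : 0 < B)
    (hAB : A + B = 1) : ∃ C, ∀ v, ξ / B * v - C ≤ fisherPhase ξ A B v := by
  refine ⟨-(ξ ^ 2 / (A * B) * Real.log B), fun v => ?_⟩
  have h1 : Real.log B + v / ξ ≤ Real.log (A + B * Real.exp (v / ξ)) := by
    rw [← Real.log_exp (v / ξ), ← Real.log_mul hB.ne' (Real.exp_pos _).ne', Real.log_exp]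
    exact Real.log_le_log (by positivity) (by linarith)
  have h2 := mul_le_mul_of_nonneg_left h1 (show 0 ≤ ξ ^ 2 / (A * B) by positivity)
  have h3 : ξ / B * v = ξ ^ 2 / (A * B) * (v / ξ) - ξ ^ 2 / A * (v / ξ) := by
    have : A = 1 - B := by linarith
    field_simp
    linear_combination v * this
  rw [fisherPhase, h3]
  linarith

/-- In this lemma and the next ones only the dependence on w matters; the constant is recovered at
the end from total mass one. -/
theorem exists_exp_mul_gammaDensity {ξ : ℝ} (N : ℝ) : ∃ K, ∀ w : ℝ,
    Real.exp w * gammaDensity (ξ ^ 2 * N) (ξ ^ 2 * N) (Real.exp w) =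
      K * Real.exp (-(N * (ξ ^ 2 * (Real.exp w - 1 - w)))) := by
  set a := ξ ^ 2 * N with ha
  refine ⟨a ^ a / Real.Gamma a * Real.exp (-a), fun w => ?_⟩
  rw [gammaDensity, ← Real.exp_mul, ← Real.exp_add, mul_left_comm, mul_assoc (_ / _),
    ← Real.exp_add, ← Real.exp_add]
  congr 2
  rw [ha]
  ring

theorem exists_exp_mul_invGammaDensity {ξ : ℝ} (N : ℝ) : ∃ K, ∀ w : ℝ,
    Real.exp w * invGammaDensity (ξ ^ 2 * N) (ξ ^ 2 * N) (Real.exp w) =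
      K * Real.exp (-(N * (ξ ^ 2 * (Real.exp (-w) - 1 + w)))) := by
  set a := ξ ^ 2 * N with ha
  refine ⟨a ^ a / Real.Gamma a * Real.exp (-a), fun w => ?_⟩
  rw [invGammaDensity, ← Real.exp_mul, ← Real.exp_add, mul_left_comm, mul_assoc, ← Real.exp_add,
    ← Real.exp_add, div_eq_mul_inv a (Real.exp w), ← Real.exp_neg]
  congr 2
  rw [ha]
  ring

theorem exists_exp_mul_fisherDensity {ξ A B : ℝ} (hξ : 0 < ξ) (hA : 0 < A) (hB : 0 < B)
    (hAB : A + B = 1) {N : ℝ} (hN : 0 < N) : ∃ K, ∀ w : ℝ,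
    Real.exp w * fisherDensity (ξ ^ 2 * N / A) (ξ ^ 2 * N / B) (Real.exp w) =
      K * Real.exp (-(N * fisherPhase ξ A B (ξ * w))) := by
  have hsum : ξ ^ 2 * N / A + ξ ^ 2 * N / B = N * (ξ ^ 2 / (A * B)) := by
    have : ξ ^ 2 * N / A + ξ ^ 2 * N / B = N * (ξ ^ 2 * (A + B) / (A * B)) := by
      field_simp
      ring
    rw [this, hAB, mul_one]
  have hab : ξ ^ 2 * N / A / (ξ ^ 2 * N / B) = B / A := by field_simp
  have hfish : ∀ w, N * fisherPhase ξ A B (ξ * w) =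
      N * (ξ ^ 2 / (A * B)) * Real.log (A + B * Real.exp w) - ξ ^ 2 * N / A * w := by
    intro w
    rw [fisherPhase, mul_div_cancel_left₀ _ hξ.ne']
    ring
  rw [← hsum] at hfish
  simp only [hfish]
  simp only [fisherDensity, hab]
  set a := ξ ^ 2 * N / A
  set b := ξ ^ 2 * N / B
  refine ⟨Real.Gamma (a + b) / (Real.Gamma a * Real.Gamma b) * (B / A) ^ a * A ^ (a + b),
    fun w => ?_⟩
  have hpos : 0 < A + B * Real.exp w := by positivity
  have e1 : 1 + B / A * Real.exp w = (A + B * Real.exp w) / A := by field_simp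
  have h2 : (1 + B / A * Real.exp w) ^ (-(a + b)) =
      A ^ (a + b) * Real.exp (Real.log (A + B * Real.exp w) * -(a + b)) := by
    rw [e1, Real.div_rpow hpos.le hA.le, Real.rpow_neg hA.le, div_inv_eq_mul, mul_comm,
      Real.rpow_def_of_pos hpos]
  have h3 : Real.exp (-((a + b) * Real.log (A + B * Real.exp w) - a * w)) =
      Real.exp w * (Real.exp (w * (a - 1)) *
        Real.exp (Real.log (A + B * Real.exp w) * -(a + b))) := by
    rw [← Real.exp_add, ← Real.exp_add]
    congr 1
    ring
  rw [h2, h3, ← Real.exp_mul]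
  ring

theorem exists_exp_mul_meijerBase {γ ξ θ : ℝ} (hγ : 0 < γ) (hξ : 0 < ξ)
    (hθ : θ ∈ Icc 0 (Real.pi / 2)) : ∃ K, ∀ w : ℝ,
    Real.exp w * meijerBase γ ξ θ (Real.exp w) =
      K * Real.exp (-((γ ^ 2)⁻¹ * meijerPhase ξ θ (ξ * w))) := by
  unfold meijerBase meijerPhase
  simp only [← div_div, div_eq_mul_inv (ξ ^ 2) (γ ^ 2)]
  split_ifs with h0 h1
  · simp only [gammaPhase, mul_div_cancel_left₀ _ hξ.ne']
    exact exists_exp_mul_gammaDensity _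
  · simp only [invGammaPhase, mul_div_cancel_left₀ _ hξ.ne']
    exact exists_exp_mul_invGammaDensity _
  · have hc : 0 < Real.cos θ := Real.cos_pos_of_mem_Ioo
      ⟨by linarith [hθ.1, Real.pi_pos], lt_of_le_of_ne hθ.2 h1⟩
    have hs : 0 < Real.sin θ := Real.sin_pos_of_pos_of_lt_pi (lt_of_le_of_ne hθ.1 (Ne.symm h0))
      (by linarith [hθ.2, Real.pi_pos])
    exact exists_exp_mul_fisherDensity hξ (pow_pos hc 2) (pow_pos hs 2)
      (Real.cos_sq_add_sin_sq θ) (by positivity)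

/-- `K` is chosen before ν, which only translates log y; hence it may be computed at ν = 1. -/
theorem exists_meijerDensity_eq {γ ξ θ : ℝ} (hγ : 0 < γ) (hξ : 0 < ξ)
    (hθ : θ ∈ Icc 0 (Real.pi / 2)) : ∃ K, ∀ ν y : ℝ, 0 < ν → 0 < y →
    meijerDensity ν γ ξ θ y =
      y⁻¹ * (K * Real.exp (-((γ ^ 2)⁻¹ * meijerPhase ξ θ (Real.log y - Real.log ν)))) := by
  obtain ⟨K, hK⟩ := exists_exp_mul_meijerBase hγ hξ hθ
  refine ⟨ξ⁻¹ * K, fun ν y hν hy => ?_⟩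
  have h1 := hK ((Real.log y - Real.log ν) / ξ)
  have hyν : 0 < y / ν := div_pos hy hν
  have e1 : (y / ν) ^ (1 / ξ) = Real.exp ((Real.log y - Real.log ν) / ξ) := by
    rw [Real.rpow_def_of_pos hyν, Real.log_div hy.ne' hν.ne']
    ring_nf
  rw [mul_div_cancel₀ _ hξ.ne'] at h1
  rw [meijerDensity, Real.rpow_sub_one hyν.ne', e1]
  have e2 : ξ⁻¹ * K * Real.exp (-((γ ^ 2)⁻¹ * meijerPhase ξ θ (Real.log y - Real.log ν))) =
      ξ⁻¹ * (Real.exp ((Real.log y - Real.log ν) / ξ) *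
        meijerBase γ ξ θ (Real.exp ((Real.log y - Real.log ν) / ξ))) := by rw [h1, mul_assoc]
  rw [e2]
  field_simp

theorem meijerMellin_one {γ ξ θ : ℝ} (hγ : 0 < γ) (hξ : 0 < ξ)
    (hθ : θ ∈ Icc 0 (Real.pi / 2)) : meijerMellin 1 γ ξ θ 1 = 1 := by
  have hG : ∀ a : ℝ, 0 < a → Complex.Gamma (a : ℂ) ≠ 0 := fun a ha =>
    Complex.Gamma_ne_zero_of_re_pos (by simpa using ha)
  have h := hG (ξ ^ 2 / γ ^ 2) (by positivity)
  unfold meijerMellin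
  split_ifs with h0 h1
  · simp only [sub_self, mul_zero, add_zero, Complex.cpow_zero, mul_one]
    exact one_div_mul_cancel h
  · simp only [sub_self, mul_zero, add_zero, Complex.cpow_zero, mul_one]
    exact one_div_mul_cancel h
  · have hc : 0 < Real.cos θ := Real.cos_pos_of_mem_Ioo
      ⟨by linarith [hθ.1, Real.pi_pos], lt_of_le_of_ne hθ.2 h1⟩
    have hs : 0 < Real.sin θ := Real.sin_pos_of_pos_of_lt_pi (lt_of_le_of_ne hθ.1 (Ne.symm h0))
      (by linarith [hθ.2, Real.pi_pos])
    have h2 := hG (ξ ^ 2 / (γ ^ 2 * Real.cos θ ^ 2)) (by positivity)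
    have h3 := hG (ξ ^ 2 / (γ ^ 2 * Real.sin θ ^ 2)) (by positivity)
    simp only [sub_self, mul_zero, add_zero, Complex.cpow_zero, mul_one, one_mul]
    exact div_self (mul_ne_zero h2 h3)

/-- Integrability and total mass are read off the Mellin transform at z = 1, where the weight
y^(z-1) is constant. -/
theorem integral_meijerDensity {γ ξ θ : ℝ} (hγ : 0 < γ) (hξ : 0 < ξ)
    (hθ : θ ∈ Icc 0 (Real.pi / 2)) :
    IntegrableOn (meijerDensity 1 γ ξ θ) (Ioi 0) ∧
      ∫ y in Ioi (0 : ℝ), meijerDensity 1 γ ξ θ y = 1 := by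
  have h := hasMellin_meijerDensity (ν := 1) (γ := γ) (z := 1) one_pos hγ hξ hθ.1 hθ.2
    (by simpa using hξ) (by simpa using hξ)
  obtain ⟨h1, h2⟩ := h
  rw [meijerMellin_one hγ hξ hθ] at h2
  simp only [MellinConvergent, mellin, sub_self, Complex.cpow_zero, one_smul] at h1 h2
  constructor
  · have h3 := h1.re
    simp only [Complex.ofReal_re, RCLike.re_to_complex] at h3
    exact h3
  · rw [integral_complex_ofReal] at h2
    exact_mod_cast h2

theorem integral_exp_meijerPhase {γ ξ θ : ℝ} (hγ : 0 < γ) (hξ : 0 < ξ)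
    (hθ : θ ∈ Icc 0 (Real.pi / 2)) {K : ℝ} (hK : ∀ y : ℝ, 0 < y →
      meijerDensity 1 γ ξ θ y =
        y⁻¹ * (K * Real.exp (-((γ ^ 2)⁻¹ * meijerPhase ξ θ (Real.log y))))) :
    (Integrable fun v => K * Real.exp (-((γ ^ 2)⁻¹ * meijerPhase ξ θ v))) ∧
      ∫ v, K * Real.exp (-((γ ^ 2)⁻¹ * meijerPhase ξ θ v)) = 1 := by
  obtain ⟨h1, h2⟩ := integral_meijerDensity hγ hξ hθ
  have himg : Real.exp '' univ = Ioi 0 := by rw [image_univ, Real.range_exp]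
  have hd : ∀ v ∈ (univ : Set ℝ), HasDerivWithinAt Real.exp (Real.exp v) univ v := fun v _ =>
    (Real.hasDerivAt_exp v).hasDerivWithinAt
  have e : ∀ v : ℝ, |Real.exp v| • meijerDensity 1 γ ξ θ (Real.exp v) =
      K * Real.exp (-((γ ^ 2)⁻¹ * meijerPhase ξ θ v)) := by
    intro v
    rw [hK _ (Real.exp_pos v), Real.abs_exp, Real.log_exp, smul_eq_mul, ← mul_assoc,
      mul_inv_cancel₀ (Real.exp_pos v).ne', one_mul]
  rw [← himg, integrableOn_image_iff_integrableOn_abs_deriv_smul MeasurableSet.univ hd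
    Real.exp_injective.injOn, integrableOn_univ] at h1
  rw [← himg, integral_image_eq_integral_abs_deriv_smul MeasurableSet.univ hd
    Real.exp_injective.injOn, Measure.restrict_univ] at h2
  simp only [e] at h1 h2
  exact ⟨h1, h2⟩

/-- The case γ = 1: this function is a multiple of a probability density. -/
theorem integrable_exp_meijerPhase {ξ θ : ℝ} (hξ : 0 < ξ) (hθ : θ ∈ Icc 0 (Real.pi / 2)) :
    Integrable fun v => Real.exp (-meijerPhase ξ θ v) := by
  obtain ⟨K, hK⟩ := exists_meijerDensity_eq (γ := 1) one_pos hξ hθ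
  obtain ⟨h1, h2⟩ := integral_exp_meijerPhase one_pos hξ hθ (K := K) fun y hy => by
    have := hK 1 y one_pos hy
    rwa [Real.log_one, sub_zero] at this
  have hK0 : K ≠ 0 := by
    rintro rfl
    simp at h2
  have h3 := h1.const_mul K⁻¹
  refine h3.congr (Eventually.of_forall fun v => ?_)
  simp only [one_pow, inv_one, one_mul]
  rw [← mul_assoc, inv_mul_cancel₀ hK0, one_mul]

theorem isPhase_meijerPhase {ξ θ : ℝ} (hξ : 0 < ξ) (hθ : θ ∈ Icc 0 (Real.pi / 2)) :
    IsPhase (meijerPhase ξ θ) (Real.cos (2 * θ) / ξ) := by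
  have hint := integrable_exp_meijerPhase hξ hθ
  by_cases h0 : θ = 0
  · have e : meijerPhase ξ θ = gammaPhase ξ := funext fun v => by rw [meijerPhase, if_pos h0]
    rw [e] at hint ⊢
    rw [h0, mul_zero, Real.cos_zero]
    exact isPhase_gammaPhase hξ hint
  by_cases h1 : θ = Real.pi / 2
  · have e : meijerPhase ξ θ = invGammaPhase ξ := funext fun v => by
      rw [meijerPhase, if_neg h0, if_pos h1]
    rw [e] at hint ⊢
    rw [h1, mul_div_cancel₀ _ two_ne_zero, Real.cos_pi]
    exact isPhase_invGammaPhase hξ hint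
  have hc : 0 < Real.cos θ := Real.cos_pos_of_mem_Ioo
    ⟨by linarith [hθ.1, Real.pi_pos], lt_of_le_of_ne hθ.2 h1⟩
  have hs : 0 < Real.sin θ := Real.sin_pos_of_pos_of_lt_pi (lt_of_le_of_ne hθ.1 (Ne.symm h0))
    (by linarith [hθ.2, Real.pi_pos])
  have e : meijerPhase ξ θ = fisherPhase ξ (Real.cos θ ^ 2) (Real.sin θ ^ 2) := funext fun v => by
    rw [meijerPhase, if_neg h0, if_neg h1]
  rw [e] at hint ⊢
  have h2 : Real.cos (2 * θ) = 1 - 2 * Real.sin θ ^ 2 := by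
    rw [Real.cos_two_mul, Real.cos_sq']
    ring
  rw [h2]
  exact isPhase_fisherPhase hξ (pow_pos hc 2) (pow_pos hs 2) (Real.cos_sq_add_sin_sq θ) hint

/-- The Meijer density in terms of its phase. -/
theorem meijerDensity_eq {ν γ ξ θ y : ℝ} (hν : 0 < ν) (hγ : 0 < γ) (hξ : 0 < ξ)
    (hθ : θ ∈ Icc 0 (Real.pi / 2)) (hy : 0 < y) :
    meijerDensity ν γ ξ θ y = y⁻¹ * (phaseNorm (meijerPhase ξ θ) (γ ^ 2)⁻¹ *
      Real.exp (-((γ ^ 2)⁻¹ * meijerPhase ξ θ (Real.log y - Real.log ν)))) := by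
  obtain ⟨K, hK⟩ := exists_meijerDensity_eq hγ hξ hθ
  obtain ⟨-, h2⟩ := integral_exp_meijerPhase hγ hξ hθ (K := K) fun y hy => by
    have := hK 1 y one_pos hy
    rwa [Real.log_one, sub_zero] at this
  rw [integral_const_mul] at h2
  rw [hK ν y hν hy, phaseNorm, eq_inv_of_mul_eq_one_left h2]

/-- For θ > 0 the phase has slope ξ/sin²θ at +∞, so r = α turns the hypothesis into S + r > 1; if α
is infinite, r = 1 is enough. -/
theorem exists_growth_meijerPhase {ξ θ : ℝ} (hξ : 0 < ξ) (hθ : θ ∈ Icc 0 (Real.pi / 2)) {α : ℝ≥0∞}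
    (hLα : 1 < ENNReal.ofReal ξ / ENNReal.ofReal (Real.sin θ ^ 2) + α) :
    ∃ S r, 0 < S ∧ 0 ≤ r ∧ ENNReal.ofReal r ≤ α ∧ 1 < S + r ∧
      ∃ C, ∀ v, S * v - C ≤ meijerPhase ξ θ v := by
  by_cases h0 : θ = 0
  -- In the Gamma case any slope above 1 would do, and no negative moment is needed.
  · obtain ⟨C, hC⟩ := exists_le_gammaPhase hξ two_pos
    refine ⟨2, 0, two_pos, le_rfl, by simp, by norm_num, C, fun v => ?_⟩
    rw [meijerPhase, if_pos h0]
    exact hC v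
  have hs : 0 < Real.sin θ := Real.sin_pos_of_pos_of_lt_pi (lt_of_le_of_ne hθ.1 (Ne.symm h0))
    (by linarith [hθ.2, Real.pi_pos])
  have hB : 0 < Real.sin θ ^ 2 := pow_pos hs 2
  have hS : 0 < ξ / Real.sin θ ^ 2 := by positivity
  have hgrow : ∃ C, ∀ v, ξ / Real.sin θ ^ 2 * v - C ≤ meijerPhase ξ θ v := by
    by_cases h1 : θ = Real.pi / 2
    · obtain ⟨C, hC⟩ := exists_le_invGammaPhase hξ
      refine ⟨C, fun v => ?_⟩
      rw [meijerPhase, if_neg h0, if_pos h1, h1, Real.sin_pi_div_two, one_pow, div_one]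
      exact hC v
    · have hc : 0 < Real.cos θ := Real.cos_pos_of_mem_Ioo
        ⟨by linarith [hθ.1, Real.pi_pos], lt_of_le_of_ne hθ.2 h1⟩
      obtain ⟨C, hC⟩ := exists_le_fisherPhase hξ (pow_pos hc 2) hB (Real.cos_sq_add_sin_sq θ)
      refine ⟨C, fun v => ?_⟩
      rw [meijerPhase, if_neg h0, if_neg h1]
      exact hC v
  by_cases hα' : α = ⊤
  · exact ⟨_, 1, hS, zero_le_one, by simp [hα'], by linarith, hgrow⟩
  · refine ⟨_, α.toReal, hS, ENNReal.toReal_nonneg, by rw [ENNReal.ofReal_toReal hα'], ?_, hgrow⟩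
    rw [← ENNReal.ofReal_div_of_pos hB, ← ENNReal.ofReal_toReal hα',
      ← ENNReal.ofReal_add hS.le ENNReal.toReal_nonneg, ← ENNReal.ofReal_one,
      ENNReal.ofReal_lt_ofReal_iff_of_nonneg zero_le_one] at hLα
    exact hLα

end MeijerPhase

/-! ### From the kernel to the estimator. -/

section Estimator

theorem kernelGamma_pos {η t : ℝ} (hη : 0 < η) (ht : 0 < t) : 0 < kernelGamma η t := by
  unfold kernelGamma
  positivity

theorem kernelGamma_sq_inv {η t : ℝ} (hη : 0 < η) (ht : 0 < t) :
    (kernelGamma η t ^ 2)⁻¹ = kernelPrec η t := by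
  rw [kernelGamma, kernelPrec, div_pow, Real.sq_sqrt (by positivity)]
  field_simp

theorem kernelNu_eq {ξ θ η t : ℝ} (hη : 0 < η) (ht : 0 < t) :
    kernelNu ξ θ η t = 1 + (1 + Real.cos (2 * θ) / ξ) / 2 * (kernelPrec η t)⁻¹ := by
  rw [kernelNu, ← kernelGamma_sq_inv hη ht, inv_inv]
  ring

theorem measurable_kernelNu (ξ θ η : ℝ) : Measurable (kernelNu ξ θ η) := by
  unfold kernelNu kernelGamma
  fun_prop

/-- The factor 1/t cancels against the y⁻¹ of the density at y = x/t and leaves x⁻¹. -/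
theorem inv_mul_meijerKernel {ξ θ η t x : ℝ} (hξ : 0 < ξ) (hθ : θ ∈ Icc 0 (Real.pi / 2))
    (hη : 0 < η) (ht : 0 < t) (hx : 0 < x) (hν : 0 < kernelNu ξ θ η t) :
    1 / t * meijerKernel ξ θ η t (x / t) =
      phaseKernel (meijerPhase ξ θ) ((1 + Real.cos (2 * θ) / ξ) / 2) x η t := by
  rw [meijerKernel, meijerDensity_eq hν (kernelGamma_pos hη ht) hξ hθ (div_pos hx ht),
    kernelGamma_sq_inv hη ht, phaseKernel]
  rw [kernelNu_eq hη ht] at hν ⊢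
  rw [if_pos hν, ← mul_assoc]
  congr 1
  field_simp

variable {Ω : Type*} [MeasurableSpace Ω] {P : Measure Ω} {X : ℕ → Ω → ℝ} {μ : Measure ℝ}

/-- Positivity of ν passes from the first observation to the common law, then to all observations at
once, off a countable union of null sets. -/
theorem mellinMeijerKDE_ae_eq {ξ θ η x : ℝ} (hξ : 0 < ξ)
    (hθ : θ ∈ Icc 0 (Real.pi / 2)) (hη : 0 < η) (hx : 0 < x) (hXm : ∀ k, Measurable (X k))
    (hX : ∀ k, P.map (X k) = μ) (hpos : ∀ᵐ t ∂μ, 0 < t)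
    (hν : ∀ᵐ ω ∂P, 0 < kernelNu ξ θ η (X 0 ω)) (n : ℕ) :
    (fun ω => mellinMeijerKDE ξ θ η n (fun k => X k ω) x) =ᵐ[P] fun ω =>
      1 / (n : ℝ) * ∑ k ∈ Finset.range n,
        phaseKernel (meijerPhase ξ θ) ((1 + Real.cos (2 * θ) / ξ) / 2) x η (X k ω) := by
  have hμ : ∀ᵐ t ∂μ, 0 < kernelNu ξ θ η t := by
    rw [← hX 0]
    exact (ae_map_iff (hXm 0).aemeasurable
      (measurableSet_lt measurable_const (measurable_kernelNu ξ θ η))).2 hν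
  have hk : ∀ k, ∀ᵐ ω ∂P, 0 < X k ω ∧ 0 < kernelNu ξ θ η (X k ω) := fun k =>
    ae_of_ae_map (hXm k).aemeasurable (by rw [hX k]; exact hpos.and hμ)
  filter_upwards [ae_all_iff.2 hk] with ω h
  rw [mellinMeijerKDE]
  congr 1
  exact Finset.sum_congr rfl fun k _ => inv_mul_meijerKernel hξ hθ hη (h k).1 hx (h k).2

theorem memLp_sample_mean {h : ℝ → ℝ} (hXm : ∀ k, Measurable (X k))
    (hX : ∀ k, P.map (X k) = μ) (hh : MemLp h 2 μ) (n : ℕ) :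
    MemLp (fun ω => 1 / (n : ℝ) * ∑ k ∈ Finset.range n, h (X k ω)) 2 P :=
  (memLp_finsetSum _ fun k _ =>
    (show MemLp h 2 (P.map (X k)) by rwa [hX k]).comp_of_map (hXm k).aemeasurable).const_mul _

theorem integral_sample_mean [IsProbabilityMeasure P] {h : ℝ → ℝ} (hXm : ∀ k, Measurable (X k))
    (hX : ∀ k, P.map (X k) = μ) (hh : MemLp h 2 μ) {n : ℕ} (hn : n ≠ 0) :
    ∫ ω, 1 / (n : ℝ) * ∑ k ∈ Finset.range n, h (X k ω) ∂P = ∫ t, h t ∂μ := by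
  have hk : ∀ k, MemLp h 2 (P.map (X k)) := fun k => by rwa [hX k]
  have hi : ∀ k, ∫ ω, h (X k ω) ∂P = ∫ t, h t ∂μ := fun k => by
    rw [← hX k, integral_map (hXm k).aemeasurable (hk k).aestronglyMeasurable]
  have hik : ∀ k, Integrable (fun ω => h (X k ω)) P := fun k =>
    ((hk k).comp_of_map (hXm k).aemeasurable).integrable one_le_two
  rw [integral_const_mul, integral_finsetSum _ fun k _ => hik k]
  simp only [hi, Finset.sum_const, Finset.card_range, nsmul_eq_mul]
  have : (n : ℝ) ≠ 0 := by exact_mod_cast hn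
  field_simp

theorem variance_sample_mean [IsProbabilityMeasure P] {h : ℝ → ℝ} (hXm : ∀ k, Measurable (X k))
    (hXi : iIndepFun X P) (hX : ∀ k, P.map (X k) = μ) (hm : Measurable h) (hh : MemLp h 2 μ)
    {n : ℕ} (hn : n ≠ 0) :
    variance (fun ω => 1 / (n : ℝ) * ∑ k ∈ Finset.range n, h (X k ω)) P =
      1 / (n : ℝ) * (∫ t, h t ^ 2 ∂μ - (∫ t, h t ∂μ) ^ 2) := by
  have hk : ∀ k, MemLp (fun ω => h (X k ω)) 2 P := fun k =>
    (show MemLp h 2 (P.map (X k)) by rwa [hX k]).comp_of_map (hXm k).aemeasurable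
  have hv : ∀ k, variance (fun ω => h (X k ω)) P = ∫ t, h t ^ 2 ∂μ - (∫ t, h t ∂μ) ^ 2 := by
    intro k
    rw [variance_eq_sub (hk k), ← hX k, integral_map (hXm k).aemeasurable
      hm.aestronglyMeasurable, integral_map (hXm k).aemeasurable
      (hm.pow_const 2).aestronglyMeasurable]
    rfl
  have hs := IndepFun.variance_sum (s := Finset.range n) (fun k _ => hk k)
    fun i _ j _ hij => (hXi.comp (fun _ => h) fun _ => hm).indepFun hij
  rw [variance_const_mul, ← Finset.sum_fn, hs]
  simp only [hv, Finset.sum_const, Finset.card_range, nsmul_eq_mul]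
  have : (n : ℝ) ≠ 0 := by exact_mod_cast hn
  field_simp

end Estimator

/-! ### Bias and variance of the estimator. -/

theorem theorem2
    {Ω : Type*} [MeasurableSpace Ω] (P : Measure Ω) [IsProbabilityMeasure P]
    (X : ℕ → Ω → ℝ) (f : ℝ → ℝ) (α β : ℝ≥0∞) (ξ θ : ℝ) (η : ℕ → ℝ)
    -- an i.i.d. sample of positive variables with a density `f` of class `C²` on `(0, ∞)`
    (hXm : ∀ k, Measurable (X k))
    (hXi : iIndepFun X P)
    (hf0 : ∀ x, 0 < x → 0 ≤ f x)
    (hfX : ∀ k, P.map (X k) =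
      (volume.restrict (Ioi (0 : ℝ))).withDensity (fun x => ENNReal.ofReal (f x)))
    (hf2 : ContDiffOn ℝ 2 f (Ioi 0))
    -- moments; an infinite exponent means that all moments on that side are finite
    (hα : 0 < α) (hβ : 0 < β) (hαβ : 5 / 2 < 2 * α + β)
    (hmα : ∀ r : ℝ, 0 < r → ENNReal.ofReal r ≤ α → Integrable (fun ω => X 0 ω ^ (-r)) P)
    (hmβ : ∀ r : ℝ, 0 < r → ENNReal.ofReal r ≤ β → Integrable (fun ω => X 0 ω ^ r) P)
    -- the kernel: `ξ / cos² θ > 1 / 4 - β / 2` and `ξ / sin² θ > 1 - α`, where `ξ / 0 = ∞`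
    (hξ : 0 < ξ) (hθ : θ ∈ Icc 0 (Real.pi / 2))
    (hLβ : 1 / 4 < ENNReal.ofReal ξ / ENNReal.ofReal (Real.cos θ ^ 2) + β / 2)
    (hLα : 1 < ENNReal.ofReal ξ / ENNReal.ofReal (Real.sin θ ^ 2) + α)
    -- the smoothing parameter
    (hη : ∀ n, 0 < η n) (hη0 : Tendsto η atTop (𝓝 0))
    (hηn : Tendsto (fun n : ℕ => (n : ℝ) * η n) atTop atTop)
    -- the kernels are defined: their scale parameter `ν` is positive
    (hν : ∀ᶠ n in atTop, ∀ᵐ ω ∂P, 0 < kernelNu ξ θ (η n) (X 0 ω))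
    (x : ℝ) (hx : 0 < x) :
    -- the estimator at `x` has a mean and a variance
    (∀ᶠ n : ℕ in atTop,
      MemLp (fun ω => mellinMeijerKDE ξ θ (η n) n (fun k => X k ω) x) 2 P) ∧
    -- bias
    (fun n : ℕ =>
        ((∫ ω, mellinMeijerKDE ξ θ (η n) n (fun k => X k ω) x ∂P) - f x)
          - 1 / 2 * η n ^ 2 * x * deriv (deriv f) x)
      =o[atTop] (fun n : ℕ => η n ^ 2) ∧
    -- variance
    (fun n : ℕ =>
        variance (fun ω => mellinMeijerKDE ξ θ (η n) n (fun k => X k ω) x) P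
          - f x / (2 * Real.sqrt Real.pi * n * η n * Real.sqrt x))
      =o[atTop] (fun n : ℕ => ((n : ℝ) * η n)⁻¹) := by
  obtain ⟨S, r, hS, hr, hrα, hSr, hgS⟩ := exists_growth_meijerPhase hξ hθ hLα
  set μ := P.map (X 0) with hμ0
  have hX : ∀ k, P.map (X k) = μ := fun k => by rw [hμ0, hfX k, hfX 0]
  have hμ := hfX 0
  have : IsProbabilityMeasure μ := Measure.isProbabilityMeasure_map (hXm 0).aemeasurable
  have hint : Integrable (fun t : ℝ => t ^ (-r)) μ := by
    -- For r = 0 the integrand is constant; the moment hypothesis only covers r > 0.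
    rcases hr.eq_or_lt with rfl | hr
    · simp
    · rw [hμ0, integrable_map_measure (by fun_prop) (hXm 0).aemeasurable]
      exact hmα r hr hrα
  have hg := isPhase_meijerPhase hξ hθ
  have hη1 : Tendsto η atTop (𝓝[>] 0) :=
    tendsto_nhdsWithin_iff.2 ⟨hη0, Eventually.of_forall hη⟩
  set lam := (1 + Real.cos (2 * θ) / ξ) / 2 with hlam
  set h : ℕ → ℝ → ℝ := fun n => phaseKernel (meijerPhase ξ θ) lam x (η n) with hh
  have hmeas : ∀ n, Measurable (h n) := fun n => measurable_phaseKernel hg.continuous lam x (η n)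
  have hLp : ∀ᶠ n in atTop, MemLp (h n) 2 μ :=
    hη1.eventually (eventually_memLp_phaseKernel hg lam hx hS hgS hSr hμ)
  have hae : ∀ᶠ n in atTop, (fun ω => mellinMeijerKDE ξ θ (η n) n (fun k => X k ω) x) =ᵐ[P]
      fun ω => 1 / (n : ℝ) * ∑ k ∈ Finset.range n, h n (X k ω) := by
    filter_upwards [hν] with n hn
    exact mellinMeijerKDE_ae_eq hξ hθ (hη n) hx hXm hX (ae_pos_of_eq_withDensity hμ) hn n
  have hbias : (fun n => (∫ t, h n t ∂μ) - f x - 1 / 2 * η n ^ 2 * x * deriv (deriv f) x)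
      =o[atTop] fun n => η n ^ 2 :=
    (integral_phaseKernel_isLittleO hg hx hS hgS hSr hμ hf2 hf0 hint).comp_tendsto hη1
  refine ⟨?_, ?_, ?_⟩
  · filter_upwards [hLp, hae] with n h1 h2
    exact (memLp_congr_ae h2).2 (memLp_sample_mean hXm hX h1 n)
  · refine hbias.congr' ?_ EventuallyEq.rfl
    filter_upwards [hLp, hae, eventually_ne_atTop 0] with n h1 h2 hn
    rw [integral_congr_ae h2, integral_sample_mean hXm hX h1 hn]
  · have hη2 : Tendsto (fun n => η n ^ 2) atTop (𝓝 0) := by simpa using hη0.pow 2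
    have hmean : Tendsto (fun n => ∫ t, h n t ∂μ) atTop (𝓝 (f x)) := by
      have h1 := (hbias.trans_tendsto hη2).add
        (((hη2.const_mul (1 / 2)).mul_const (x * deriv (deriv f) x)).add_const (f x))
      refine (h1.congr fun n => ?_).trans_eq ?_
      · ring
      · simp
    have hsq := (tendsto_integral_phaseKernel_sq hg lam hx hS hgS hSr hμ hf2 hf0).comp hη1
    -- The first two terms are nη times the variance; the squared mean is negligible because the
    -- mean converges and η → 0.
    have hlim : Tendsto (fun n => η n * ∫ t, h n t ^ 2 ∂μ - η n * (∫ t, h n t ∂μ) ^ 2 -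
        f x / (2 * Real.sqrt Real.pi * Real.sqrt x)) atTop (𝓝 0) := by
      have h1 := (hsq.sub (hη0.mul (hmean.pow 2))).sub_const
        (f x / (2 * Real.sqrt Real.pi * Real.sqrt x))
      simpa using h1
    have h2 := ((isLittleO_one_iff ℝ).2 hlim).mul_isBigO
      (isBigO_refl (fun n : ℕ => ((n : ℝ) * η n)⁻¹) atTop)
    refine h2.congr' ?_ (Eventually.of_forall fun n => one_mul _)
    filter_upwards [hLp, hae, eventually_ne_atTop 0] with n h1 h2 hn
    rw [variance_congr h2, variance_sample_mean hXm hXi hX (hmeas n) h1 hn]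
    have hn' : (n : ℝ) ≠ 0 := by exact_mod_cast hn
    have := (hη n).ne'
    have := (Real.sqrt_pos.2 hx).ne'
    have := (Real.sqrt_pos.2 Real.pi_pos).ne'
    field_simp
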